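/- **Setting.** Let $r,T\in\mathbb N$, let $\bar s,\bar d,\bar\mu$ be $r$-tuples of positive integers, and for an admissible step $\bar\nu\in\mathbb Z^r$ (all components positive or all negative) put $$\chi_{\bar\nu}(z)=\prod_{j=1}^r(1-z^{\nu_js_j})^{d_j},\qquad \beta(i\lambda)=\prod_{j=1}^r\prod_{k=-[s_j/2]}^{[s_j/2]}(i\lambda-2\pi ik/s_j)^{d_j}.$$ Let $\vec\xi(m)=(\xi_p(m))_{p=1}^T$, $m\in\mathbb Z$, be a complex vector-valued stochastic sequence with wide sense stationary generalized multiple increments $\chi_{\bar\nu}(B)\vec\xi(m)$ ($B$ is the backward shift), i.e. these are square integrable, and their means and mixed second moments (for all pairs of admissible steps) do not depend on the time origin. Assume $\mathsf E\chi_{\bar\mu}(B)\vec\xi(m)=0$ and that there is a spectral density: an integrable, a.e. positive semidefinite matrix function $f$ on $[-\pi,\pi]$ with, for all admissible $\bar\nu_1,\bar\nu_2$, $$\mathsf E\,\chi_{\bar\nu_1}(B)\xi_p(m_0+m)\,\overline{\chi_{\bar\nu_2}(B)\xi_q(m_0)}=\frac1{2\pi}\int_{-\pi}^{\pi}e^{im\lambda}\,\frac{\chi_{\bar\nu_1}(e^{-i\lambda})\chi_{\bar\nu_2}(e^{i\lambda})}{|\beta(i\lambda)|^2}f_{pq}(\lambda)\,d\lambda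 .$$ Assume the minimality condition: $f(\lambda)$ is invertible for a.e. $\lambda$ and $\int_{-\pi}^{\pi}\operatorname{Tr}\big[\frac{|\beta(i\lambda)|^2}{|\chi_{\bar\mu}(e^{-i\lambda})|^2}f^{-1}(\lambda)\big]d\lambda<\infty$. Let $N\ge0$, $\vec a(0),\dots,\vec a(N)\in\mathbb C^T$, and $A_N\vec\xi=\sum_{k=0}^N\vec a(k)^\top\vec\xi(k)$. **Notation.** Let $\prod_i(1-x^{\mu_is_i})^{d_i}=\sum_ke(k)x^k$, $\prod_i(\sum_{j\ge0}x^{\mu_is_ij})^{d_i}=\sum_kd(k)x^k$, $n=\sum_i\mu_is_id_i$, $$\vec b_N(k)=(D_Na_N)_k=\sum_{m=k}^Nd(m-k)\vec a(m)\ (0\le k\le N),\quad \vec b_N(k)=0\ (k>N),\qquad \vec v_N(k)=\sum_{l=0}^{N\wedge(k+n)}e(l-k)\vec b_N(l)\ (-n\le k\le-1),$$ $V_N\vec\xi=\sum_{k=-n}^{-1}\vec v_N(k)^\top\vec\xi(k)$ and $\vec B_N(e^{i\lambda})=\sum_{k=0}^N\vec b_N(k)e^{ik\lambda}$. For $m\in\mathbb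 Z$ let $H^m$ be the closed span in $L_2(\mathsf P)$ of the $\chi_{\bar\mu}(B)\xi_p(k)$, $1\le p\le T$, $k\le m$. A linear estimate of $A_N\vec\xi$ from the observations $\vec\xi(m)$, $m\le-1$, is a random variable $\eta-V_N\vec\xi$ with $\eta\in H^{-1}$; it is optimal if it minimizes the mean square error $\mathsf E|A_N\vec\xi-\widehat A|^2$ among all linear estimates. $L_2(f)$ has the inner product $\int g_1^\top f\,\overline{g_2}\,d\lambda$, and $L_2^{0-}(f)$ is the closed span in it of the functions $e^{ik\lambda}\frac{\chi_{\bar\mu}(e^{-i\lambda})}{\beta(i\lambda)}\boldsymbol\delta_l$, $k\le-1$, $1\le l\le T$, where $\boldsymbol\delta_l$ is the $l$-th unit vector. The spectral characteristic is the orthogonal projection in $L_2(f)$ of $\vec B_N(e^{i\lambda})\frac{\chi_{\bar\mu}(e^{-i\lambda})}{\beta(i\lambda)}$ on $L_2^{0-}(f)$. Let $$F(k,j)=\frac1{2\pi}\int_{-\pi}^{\pi}e^{i\lambda(j-k)}\frac{|\beta(i\lambda)|^2}{|\chi_{\bar\mu}(e^{-i\lambda})|^2}\big(f^{-1}(\lambda)\big)^{\top}d\lambda,\qquad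 k,j\ge0,$$ and let $F_\mu$ be the (possibly unbounded) operator in $\ell_2(\mathbb C^T)$ determined by the block matrix $F(j,k)$, that is, the nonnegative self-adjoint operator associated with the closed form $$\mathfrak f[x,y]=\frac1{2\pi}\int_{-\pi}^\pi\frac{|\beta(i\lambda)|^2}{|\chi_{\bar\mu}(e^{-i\lambda})|^2}\,Y(\lambda)^*(f^{-1}(\lambda))^\top X(\lambda)\,d\lambda,\quad X=\sum_{k\ge0}x(k)e^{ik\lambda},\ Y=\sum_{k\ge0}y(k)e^{ik\lambda},$$ with domain the $x\in\ell_2$ such that $\mathfrak f[x,x]<\infty$; on finitely supported sequences $\mathfrak f[x,y]=\sum_{j,k}y(j)^*F(j,k)x(k)$. **Theorem.** There is a spectral process $\vec Z$ on $[-\pi,\pi]$ with uncorrelated increments, $\mathsf E\,d\vec Z\,d\vec Z^*=\frac1{2\pi}f\,d\lambda$, such that $\chi_{\bar\nu}(B)\xi_p(m)=\int_{-\pi}^{\pi}e^{im\lambda}\frac{\chi_{\bar\nu}(e^{-i\lambda})}{\beta(i\lambda)}dZ_p(\lambda)$ for all $m,p$ and all admissible $\bar\nu$, and for every such $\vec Z$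 the following holds. 1. The equation $F_\mu c=D_Na_N$ has exactly one solution $c=F_\mu^{-1}D_Na_N$ in the domain of $F_\mu$. The optimal linear estimate of $A_N\vec\xi$ exists and is $$\widehat A_N\vec\xi=\int_{-\pi}^{\pi}\vec h_N(\lambda)^\top d\vec Z(\lambda)-\sum_{k=-n}^{-1}\vec v_N(k)^\top\vec\xi(k),$$ its spectral characteristic is $$\vec h_N(\lambda)^\top=\vec B_N(e^{i\lambda})^\top\frac{\chi_{\bar\mu}(e^{-i\lambda})}{\beta(i\lambda)}-\frac{\overline{\beta(i\lambda)}}{\chi_{\bar\mu}(e^{i\lambda})}\,C(\lambda)^\top f^{-1}(\lambda),\qquad C(\lambda)=\sum_{k=0}^\infty(F_\mu^{-1}D_Na_N)_ke^{ik\lambda}$$ (series convergent in $L_2(-\pi,\pi)$), and its mean square error is finite and equal to $$\frac1{2\pi}\int_{-\pi}^{\pi}\frac{\overline{\beta(i\lambda)}}{\chi_{\bar\mu}(e^{i\lambda})}C(\lambda)^\top f^{-1}(\lambda)\overline{C(\lambda)}\frac{\beta(i\lambda)}{\chi_{\bar\mu}(e^{-i\lambda})}d\lambda=\big\langle D_Na_N,F_\mu^{-1}D_Na_N\big\rangle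 .$$ 2. Suppose that the increments admit a canonical moving average representation $\chi_{\bar\mu}(B)\vec\xi(m)=\sum_{k\ge0}\varphi_\mu(k)\vec\varepsilon(m-k)$ in mean square, where $\vec\varepsilon$ is an orthonormal $q$-dimensional innovation sequence (the closed span of $\vec\varepsilon(u)$, $u\le m$, equals $H^m$ for every $m$) and $\sum_k\|\varphi_\mu(k)\|^2<\infty$, with the canonical factorization $\frac{|\chi_{\bar\mu}(e^{-i\lambda})|^2}{|\beta(i\lambda)|^2}f(\lambda)=\Phi_\mu(e^{-i\lambda})\Phi_\mu^*(e^{-i\lambda})$ a.e., $\Phi_\mu(e^{-i\lambda})=\sum_{k\ge0}\varphi_\mu(k)e^{-ik\lambda}$, and let $\Psi_\mu(e^{-i\lambda})\Phi_\mu(e^{-i\lambda})=E_q$ a.e. Then the spectral characteristic of the optimal estimate is also given by $$\vec h_N(\lambda)=\frac{\chi_{\bar\mu}(e^{-i\lambda})}{\beta(i\lambda)}\Big(\vec B_N(e^{i\lambda})-\Psi_\mu(e^{-i\lambda})^\top\vec r_N(e^{i\lambda})\Big),\qquad \vec r_N(e^{i\lambda})=\sum_{k=0}^N(\widetilde D_NA_N\varphi_{\mu,N})_ke^{ik\lambda},$$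 $$(\widetilde D_NA_N\varphi_{\mu,N})_k=\sum_{m=0}^N\sum_{l=k}^N\varphi_\mu(m)^\top\vec a(m+l)\,d(l-k)\qquad(\vec a(j)=0\text{ for }j>N),$$ and its mean square error equals $$\frac1{2\pi}\int_{-\pi}^{\pi}\|\vec r_N(e^{i\lambda})\|^2d\lambda=\|\widetilde D_NA_N\varphi_{\mu,N}\|^2=\sum_{k=0}^N\|(\widetilde D_NA_N\varphi_{\mu,N})_k\|^2 .$$ -/

import Mathlib

open MeasureTheory Filter Topology
open scoped Matrix ENNReal ComplexConjugate ComplexOrder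

noncomputable section

namespace GMForecast

/-! ## Generalized multiple increments -/

/-- Admissible steps: all components positive or all components negative. -/
def AdmissibleStep {r : ℕ} (μ : Fin r → ℤ) : Prop :=
  (∀ i, 0 < μ i) ∨ (∀ i, μ i < 0)

/-- The generalized multiple (GM) increment
`(1 - B_{μ₁}^{s₁})^{d₁} ⋯ (1 - B_{μ_r}^{s_r})^{d_r} ξ_p(m)` of a vector-valued stochastic sequence. -/
def increment {Ω : Type*} {r T : ℕ} (s d : Fin r → ℕ) (μ : Fin r → ℤ)
    (ξ : ℤ → Fin T → Ω → ℂ) (m : ℤ) (p : Fin T) (ω : Ω) : ℂ :=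
  ∑ l ∈ Fintype.piFinset (fun i => Finset.range (d i + 1)),
    (-1 : ℂ) ^ (∑ i, l i) * (∏ i, ((d i).choose (l i) : ℂ)) *
      ξ (m - ∑ i, μ i * (s i : ℤ) * (l i : ℤ)) p ω

/-- `χ_μ(z) = ∏_j (1 - z^{μ_j s_j})^{d_j}`. -/
def chi {r : ℕ} (s d : Fin r → ℕ) (μ : Fin r → ℤ) (z : ℂ) : ℂ :=
  ∏ j, (1 - z ^ (μ j * (s j : ℤ))) ^ d j

/-- `β(iλ) = ∏_j ∏_{k = -[s_j/2]}^{[s_j/2]} (iλ - 2πik/s_j)^{d_j}`, as a function of `λ = t`. -/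
def beta {r : ℕ} (s d : Fin r → ℕ) (t : ℝ) : ℂ :=
  ∏ j, ∏ k ∈ Finset.Icc (-((s j : ℤ) / 2)) ((s j : ℤ) / 2),
    (Complex.I * t - 2 * Real.pi * Complex.I * k / (s j : ℂ)) ^ d j

/-- The point `e^{ikλ}` of the unit circle. -/
def ex (k : ℤ) (t : ℝ) : ℂ := Complex.exp (Complex.I * k * t)

/-- The factor `χ_μ(e^{-iλ}) / β(iλ)`. -/
def ratio {r : ℕ} (s d : Fin r → ℕ) (μ : Fin r → ℤ) (t : ℝ) : ℂ :=
  chi s d μ (ex (-1) t) / beta s d t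

/-- Lebesgue measure on `(-π, π]`. -/
def circ : Measure ℝ := volume.restrict (Set.Ioc (-Real.pi) Real.pi)

/-- The GM increments of `ξ` are wide sense stationary: for all admissible steps the first moments
and the mixed second moments exist and do not depend on the time origin. -/
structure HasStationaryIncrements {Ω : Type*} [MeasurableSpace Ω] (P : Measure Ω) {r T : ℕ}
    (s d : Fin r → ℕ) (ξ : ℤ → Fin T → Ω → ℂ) : Prop where
  measurable : ∀ m p, Measurable (ξ m p)
  memLp : ∀ μ, AdmissibleStep μ → ∀ m p, MemLp (increment s d μ ξ m p) 2 P
  mean : ∀ μ, AdmissibleStep μ → ∃ c : Fin T → ℂ, ∀ m p, ∫ ω, increment s d μ ξ m p ω ∂P = c p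
  structural : ∀ μ₁ μ₂, AdmissibleStep μ₁ → AdmissibleStep μ₂ →
    ∃ D : ℤ → Matrix (Fin T) (Fin T) ℂ, ∀ m₀ m p q,
      ∫ ω, increment s d μ₁ ξ (m₀ + m) p ω * conj (increment s d μ₂ ξ m₀ q ω) ∂P = D m p q

/-- `f` is the spectral density matrix of the stationary GM increments of `ξ`: the structural
function is `∫ e^{iλm} χ_{μ₁}(e^{-iλ}) χ_{μ₂}(e^{iλ}) |β(iλ)|⁻² dF(λ)` with `dF = (2π)⁻¹ f dλ`. -/
structure IsSpectralDensity {Ω : Type*} [MeasurableSpace Ω] (P : Measure Ω) {r T : ℕ}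
    (s d : Fin r → ℕ) (ξ : ℤ → Fin T → Ω → ℂ) (f : ℝ → Matrix (Fin T) (Fin T) ℂ) : Prop where
  integrable : ∀ p q, Integrable (fun t => f t p q) circ
  posSemidef : ∀ᵐ t ∂circ, (f t).PosSemidef
  structural : ∀ μ₁ μ₂, AdmissibleStep μ₁ → AdmissibleStep μ₂ → ∀ m₀ m p q,
    ∫ ω, increment s d μ₁ ξ (m₀ + m) p ω * conj (increment s d μ₂ ξ m₀ q ω) ∂P =
      1 / (2 * Real.pi) * ∫ t, ex m t * chi s d μ₁ (ex (-1) t) * chi s d μ₂ (ex 1 t) /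
        ((‖beta s d t‖ ^ 2 : ℝ) : ℂ) * f t p q ∂circ

/-- The minimality condition `∫ Tr[|β(iλ)|² |χ_μ(e^{-iλ})|⁻² f(λ)⁻¹] dλ < ∞`; it includes that
`f(λ)` is invertible for almost all `λ`. -/
def MinimalityCondition {r T : ℕ} (s d : Fin r → ℕ) (μ : Fin r → ℤ)
    (f : ℝ → Matrix (Fin T) (Fin T) ℂ) : Prop :=
  (∀ᵐ t ∂circ, IsUnit (f t).det) ∧
    Integrable (fun t => Matrix.trace
      (((‖beta s d t‖ ^ 2 / ‖chi s d μ (ex (-1) t)‖ ^ 2 : ℝ) : ℂ) • (f t)⁻¹)) circ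

/-! ## The space `L₂(f)`, the spectral process and its stochastic integral -/

/-- The squared norm `∫ g(λ)ᵀ f(λ) conj(g(λ)) dλ` of `L₂(f)`. -/
def normSqL2 {T : ℕ} (f : ℝ → Matrix (Fin T) (Fin T) ℂ) (g : ℝ → Fin T → ℂ) : ℝ≥0∞ :=
  ∫⁻ t, ENNReal.ofReal (g t ⬝ᵥ (f t *ᵥ star (g t))).re ∂circ

/-- Membership in `L₂(f)`. -/
def MemL2 {T : ℕ} (f : ℝ → Matrix (Fin T) (Fin T) ℂ) (g : ℝ → Fin T → ℂ) : Prop :=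
  AEMeasurable g circ ∧ normSqL2 f g < ⊤

/-- Step functions `λ ↦ ∑ᵢ vᵢ 1_{[xᵢ, yᵢ)}(λ)` on `[-π, π]`. -/
structure StepFn (T : ℕ) where
  n : ℕ
  x : Fin n → ℝ
  y : Fin n → ℝ
  v : Fin n → Fin T → ℂ
  lower : ∀ i, -Real.pi ≤ x i
  ordered : ∀ i, x i ≤ y i
  upper : ∀ i, y i ≤ Real.pi

/-- The function given by a step function. -/
def StepFn.eval {T : ℕ} (g : StepFn T) (t : ℝ) : Fin T → ℂ :=
  ∑ i, (Set.Ico (g.x i) (g.y i)).indicator (fun _ => g.v i) t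

/-- `∫ gᵀ dZ = ∑ᵢ vᵢᵀ (Z(yᵢ) - Z(xᵢ))` for a step function `g`. -/
def StepFn.integral {Ω : Type*} {T : ℕ} (g : StepFn T) (Z : ℝ → Fin T → Ω → ℂ) (ω : Ω) : ℂ :=
  ∑ i, ∑ p, g.v i p * (Z (g.y i) p ω - Z (g.x i) p ω)

/-- `Y = ∫ g(λ)ᵀ dZ(λ)`: the extension by isometry of the integral of step functions to `L₂(f)`. -/
def HasStochIntegral {Ω : Type*} [MeasurableSpace Ω] (P : Measure Ω) {T : ℕ}
    (f : ℝ → Matrix (Fin T) (Fin T) ℂ) (Z : ℝ → Fin T → Ω → ℂ)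
    (g : ℝ → Fin T → ℂ) (Y : Ω → ℂ) : Prop :=
  MemL2 f g ∧ MemLp Y 2 P ∧
    ∀ δ : ℝ≥0∞, 0 < δ → ∃ u : StepFn T,
      normSqL2 f (fun t => g t - u.eval t) < δ ∧ eLpNorm (fun ω => Y ω - u.integral Z ω) 2 P < δ

/-- `Z` is the vector-valued spectral process of the increments of `ξ`: it has uncorrelated
increments with `E dZ dZ^* = (2π)⁻¹ f dλ`, and
`χ_{μ,s}(ξ_p(m)) = ∫ e^{imλ} χ_μ(e^{-iλ}) β(iλ)⁻¹ dZ_p(λ)` for all admissible steps. -/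
structure IsSpectralProcess {Ω : Type*} [MeasurableSpace Ω] (P : Measure Ω) {r T : ℕ}
    (s d : Fin r → ℕ) (ξ : ℤ → Fin T → Ω → ℂ) (f : ℝ → Matrix (Fin T) (Fin T) ℂ)
    (Z : ℝ → Fin T → Ω → ℂ) : Prop where
  memLp : ∀ t ∈ Set.Icc (-Real.pi) Real.pi, ∀ p, MemLp (Z t p) 2 P
  increments : ∀ x y x' y' : ℝ, -Real.pi ≤ x → x ≤ y → y ≤ Real.pi →
    -Real.pi ≤ x' → x' ≤ y' → y' ≤ Real.pi → ∀ p q,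
    ∫ ω, (Z y p ω - Z x p ω) * conj (Z y' q ω - Z x' q ω) ∂P =
      1 / (2 * Real.pi) * ∫ t in Set.Ico x y ∩ Set.Ico x' y', f t p q
  representation : ∀ μ, AdmissibleStep μ → ∀ m p,
    HasStochIntegral P f Z (fun t => Pi.single p (ex m t * ratio s d μ t))
      (increment s d μ ξ m p)

/-! ## The functional, its representation, and linear estimates -/

/-- `A_N ξ = ∑_{k=0}^N a(k)ᵀ ξ(k)`. -/
def functionalA {Ω : Type*} {T : ℕ} (a : ℕ → Fin T → ℂ) (N : ℕ) (ξ : ℤ → Fin T → Ω → ℂ)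
    (ω : Ω) : ℂ :=
  ∑ k ∈ Finset.range (N + 1), a k ⬝ᵥ (fun p => ξ (k : ℤ) p ω)

/-- `n(γ) = ∑_i μ_i s_i d_i`. -/
def nGamma {r : ℕ} (s d μ : Fin r → ℕ) : ℕ := ∑ i, μ i * s i * d i

/-- `e_γ(k)`, the coefficients of `∏_i (1 - x^{μ_i s_i})^{d_i} = ∑_k e_γ(k) x^k`. -/
def coeffE {r : ℕ} (s d μ : Fin r → ℕ) (k : ℕ) : ℂ :=
  (∏ i, ((1 : Polynomial ℂ) - Polynomial.X ^ (μ i * s i)) ^ d i).coeff k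

/-- `d_μ(k)`, the coefficients of `∏_i (∑_j x^{μ_i s_i j})^{d_i} = ∑_k d_μ(k) x^k`. -/
def coeffD {r : ℕ} (s d μ : Fin r → ℕ) (k : ℕ) : ℂ :=
  PowerSeries.coeff k
    (∏ i, (PowerSeries.mk (fun n => if μ i * s i ∣ n then (1 : ℂ) else 0)) ^ d i)

/-- `b_N(k) = (D_N^μ a_N)_k = ∑_{m=k}^N d_μ(m-k) a(m)` (zero for `k > N`). -/
def bN {r T : ℕ} (s d μ : Fin r → ℕ) (a : ℕ → Fin T → ℂ) (N k : ℕ) : Fin T → ℂ :=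
  ∑ m ∈ Finset.Icc k N, coeffD s d μ (m - k) • a m

/-- `v_N(-k) = ∑_{l=0}^{min(N, n(γ)-k)} e_γ(l+k) b_N(l)`, for `k = 1, …, n(γ)`. -/
def vN {r T : ℕ} (s d μ : Fin r → ℕ) (a : ℕ → Fin T → ℂ) (N k : ℕ) : Fin T → ℂ :=
  ∑ l ∈ Finset.range (min N (nGamma s d μ - k) + 1), coeffE s d μ (l + k) • bN s d μ a N l

/-- `V_N ξ = ∑_{k=-n(γ)}^{-1} v_N(k)ᵀ ξ(k)`, a combination of observed initial values. -/
def functionalV {Ω : Type*} {r T : ℕ} (s d μ : Fin r → ℕ) (a : ℕ → Fin T → ℂ) (N : ℕ)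
    (ξ : ℤ → Fin T → Ω → ℂ) (ω : Ω) : ℂ :=
  ∑ k ∈ Finset.Icc 1 (nGamma s d μ), vN s d μ a N k ⬝ᵥ (fun p => ξ (-(k : ℤ)) p ω)

/-- `B_{μ,N}(e^{iλ}) = ∑_{k=0}^N (D_N^μ a_N)_k e^{iλk}`. -/
def BN {r T : ℕ} (s d μ : Fin r → ℕ) (a : ℕ → Fin T → ℂ) (N : ℕ) (t : ℝ) : Fin T → ℂ :=
  ∑ k ∈ Finset.range (N + 1), ex k t • bN s d μ a N k

/-- The closed linear subspace of `L₂(Ω)` generated by a family of random variables. -/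
def closedSpan {Ω : Type*} [MeasurableSpace Ω] (P : Measure Ω) {ι : Type*} (X : ι → Ω → ℂ) :
    Submodule ℂ (Lp ℂ 2 P) :=
  (Submodule.span ℂ {g : Lp ℂ 2 P | ∃ i, ⇑g =ᵐ[P] X i}).topologicalClosure

/-- The closed subspace generated by the components of `X(m)`, `m ≤ q`. -/
def pastSpace {Ω : Type*} [MeasurableSpace Ω] (P : Measure Ω) {n : ℕ}
    (X : ℤ → Fin n → Ω → ℂ) (q : ℤ) : Submodule ℂ (Lp ℂ 2 P) :=
  closedSpan P (fun i : {m : ℤ // m ≤ q} × Fin n => X i.1 i.2)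

/-- Linear estimates of `A_N ξ` from the observations `ξ(m)`, `m ≤ -1`: the sums of `-V_N ξ` and an
element of the closed span of the observed increments. -/
def IsLinearEstimate {Ω : Type*} [MeasurableSpace Ω] (P : Measure Ω) {r T : ℕ}
    (s d μ : Fin r → ℕ) (ξ : ℤ → Fin T → Ω → ℂ) (a : ℕ → Fin T → ℂ) (N : ℕ) (Y : Ω → ℂ) : Prop :=
  ∃ η ∈ pastSpace P (increment s d (fun i => (μ i : ℤ)) ξ) (-1),
    Y =ᵐ[P] fun ω => η ω - functionalV s d μ a N ξ ω

/-- The mean square error `E|A_N ξ - Y|²`. -/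
def mse {Ω : Type*} [MeasurableSpace Ω] (P : Measure Ω) {T : ℕ} (ξ : ℤ → Fin T → Ω → ℂ)
    (a : ℕ → Fin T → ℂ) (N : ℕ) (Y : Ω → ℂ) : ℝ≥0∞ :=
  ∫⁻ ω, ‖functionalA a N ξ ω - Y ω‖ₑ ^ 2 ∂P

/-- Mean square optimal linear estimates of `A_N ξ`. -/
def IsOptimalEstimate {Ω : Type*} [MeasurableSpace Ω] (P : Measure Ω) {r T : ℕ}
    (s d μ : Fin r → ℕ) (ξ : ℤ → Fin T → Ω → ℂ) (a : ℕ → Fin T → ℂ) (N : ℕ) (Y : Ω → ℂ) : Prop :=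
  IsLinearEstimate P s d μ ξ a N Y ∧
    ∀ Y', IsLinearEstimate P s d μ ξ a N Y' → mse P ξ a N Y ≤ mse P ξ a N Y'

/-- The subspace `L₂^{0-}(f)` of `L₂(f)`: the closed span of the functions
`e^{iλk} χ_μ(e^{-iλ}) β(iλ)⁻¹ δ_l`, `k ≤ -1`, `l = 1, …, T`. -/
def MemL2Minus {r T : ℕ} (s d μ : Fin r → ℕ) (f : ℝ → Matrix (Fin T) (Fin T) ℂ)
    (h : ℝ → Fin T → ℂ) : Prop :=
  MemL2 f h ∧ ∀ δ : ℝ≥0∞, 0 < δ → ∃ (n : ℕ) (u : ℕ → Fin T → ℂ),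
    normSqL2 f (fun t => h t - ratio s d (fun i => (μ i : ℤ)) t •
      ∑ k ∈ Finset.Icc 1 n, ex (-(k : ℤ)) t • u k) < δ

/-- `h` is the spectral characteristic of the optimal estimate: the orthogonal projection in `L₂(f)`
of `B_{μ,N}(e^{iλ}) χ_μ(e^{-iλ}) β(iλ)⁻¹` on `L₂^{0-}(f)`. -/
def IsSpectralCharacteristic {r T : ℕ} (s d μ : Fin r → ℕ) (f : ℝ → Matrix (Fin T) (Fin T) ℂ)
    (a : ℕ → Fin T → ℂ) (N : ℕ) (h : ℝ → Fin T → ℂ) : Prop :=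
  MemL2Minus s d μ f h ∧ ∀ g, MemL2Minus s d μ f g →
    ∫ t, (ratio s d (fun i => (μ i : ℤ)) t • BN s d μ a N t - h t) ⬝ᵥ (f t *ᵥ star (g t)) ∂circ = 0

/-! ## The operator `F_μ` -/

/-- `C = ∑_{k ≥ 0} u_k` in the sense of mean square convergence. -/
def IsL2Sum {X : Type*} [MeasurableSpace X] (ν : Measure X) (u : ℕ → X → ℂ) (C : X → ℂ) : Prop :=
  MemLp C 2 ν ∧
    Tendsto (fun n => eLpNorm (fun x => C x - ∑ k ∈ Finset.range n, u k x) 2 ν) atTop (𝓝 0)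

/-- `C(λ) = ∑_{k ≥ 0} c(k) e^{iλk}` in `L₂(-π, π)`; such a `C` exists exactly when `c` is in
`ℓ₂`. -/
def IsFourierSum {T : ℕ} (c : ℕ → Fin T → ℂ) (C : ℝ → Fin T → ℂ) : Prop :=
  ∀ p, IsL2Sum circ (fun k t => c k p * ex k t) (fun t => C t p)

/-- The symbol `|β(iλ)|² |χ_μ(e^{-iλ})|⁻² (f(λ)⁻¹)ᵀ`. -/
def symbolF {r T : ℕ} (s d μ : Fin r → ℕ) (f : ℝ → Matrix (Fin T) (Fin T) ℂ) (t : ℝ) :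
    Matrix (Fin T) (Fin T) ℂ :=
  ((‖beta s d t‖ ^ 2 / ‖chi s d (fun i => (μ i : ℤ)) (ex (-1) t)‖ ^ 2 : ℝ) : ℂ) • ((f t)⁻¹)ᵀ

/-- The blocks `F^μ(k,j) = (2π)⁻¹ ∫ e^{iλ(j-k)} |β(iλ)|² |χ_μ(e^{-iλ})|⁻² (f(λ)⁻¹)ᵀ dλ`. -/
def entryF {r T : ℕ} (s d μ : Fin r → ℕ) (f : ℝ → Matrix (Fin T) (Fin T) ℂ) (k j : ℕ) :
    Matrix (Fin T) (Fin T) ℂ :=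
  Matrix.of fun p q =>
    1 / (2 * Real.pi) * ∫ t, ex ((j : ℤ) - (k : ℤ)) t * symbolF s d μ f t p q ∂circ

/-- The sesquilinear form generated by the matrix `F^μ(j,k)`, written for
`X = ∑ x(k) e^{iλk}`, `Y = ∑ y(k) e^{iλk}`; `formF_eq_sum` identifies it, on finitely supported
sequences, with `∑_{j,k} y(j)^* F^μ(j,k) x(k)`. -/
def formF {r T : ℕ} (s d μ : Fin r → ℕ) (f : ℝ → Matrix (Fin T) (Fin T) ℂ)
    (X Y : ℝ → Fin T → ℂ) : ℂ :=
  1 / (2 * Real.pi) * ∫ t, star (Y t) ⬝ᵥ (symbolF s d μ f t *ᵥ X t) ∂circ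

/-- Finiteness of the quadratic form `formF X X`. -/
def FiniteEnergy {r T : ℕ} (s d μ : Fin r → ℕ) (f : ℝ → Matrix (Fin T) (Fin T) ℂ)
    (X : ℝ → Fin T → ℂ) : Prop :=
  ∫⁻ t, ENNReal.ofReal (star (X t) ⬝ᵥ (symbolF s d μ f t *ᵥ X t)).re ∂circ < ⊤

/-- `F_μ c = b`, where `F_μ` is the operator in `ℓ₂` determined by the matrix `F^μ(j,k)`. In general
the symbol is only integrable, so that the columns of the matrix need not be in `ℓ₂` and `F_μ` is
unbounded: it is the nonnegative self-adjoint operator associated with the closed form `formF`, that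
is, `c` is in the domain of the form and `⟨F_μ c, x⟩ = ⟨b, x⟩` for all `x` in that domain. -/
def OperatorF {r T : ℕ} (s d μ : Fin r → ℕ) (f : ℝ → Matrix (Fin T) (Fin T) ℂ)
    (c b : ℕ → Fin T → ℂ) : Prop :=
  Summable (fun k => ∑ p, ‖b k p‖ ^ 2) ∧
  ∃ C, IsFourierSum c C ∧ FiniteEnergy s d μ f C ∧
    ∀ x X, IsFourierSum x X → FiniteEnergy s d μ f X →
      formF s d μ f C X = ∑' k, b k ⬝ᵥ star (x k)

/-- On finitely supported sequences the form is given by the matrix `F^μ(j,k)`. -/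
theorem formF_eq_sum {r T : ℕ} (s d μ : Fin r → ℕ) (f : ℝ → Matrix (Fin T) (Fin T) ℂ)
    (hf : ∀ p q, Integrable (fun t => symbolF s d μ f t p q) circ)
    (n : ℕ) (x y : ℕ → Fin T → ℂ) :
    formF s d μ f (fun t => ∑ k ∈ Finset.range n, ex k t • x k)
        (fun t => ∑ j ∈ Finset.range n, ex j t • y j) =
      ∑ j ∈ Finset.range n, ∑ k ∈ Finset.range n, star (y j) ⬝ᵥ (entryF s d μ f j k *ᵥ x k) := by
  have hex : ∀ (m : ℤ) (p q : Fin T),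
      Integrable (fun t => ex m t * symbolF s d μ f t p q) circ := by
    intro m p q
    refine (hf p q).bdd_mul (c := 1) ?_ (Eventually.of_forall fun t => ?_)
    · unfold ex
      exact Continuous.aestronglyMeasurable (by fun_prop)
    · have h : Complex.I * (m : ℂ) * (t : ℂ) = ((m * t : ℝ) : ℂ) * Complex.I := by
        push_cast
        ring
      rw [ex, h, Complex.norm_exp_ofReal_mul_I]
  have hstar : ∀ (j k : ℕ) (t : ℝ),
      star (ex j t) * ex k t = ex ((k : ℤ) - (j : ℤ)) t := by
    intro j k t
    simp only [ex, Complex.star_def, ← Complex.exp_conj, ← Complex.exp_add]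
    congr 1
    simp
    ring
  have hpt : ∀ t, star (∑ j ∈ Finset.range n, ex j t • y j) ⬝ᵥ
      (symbolF s d μ f t *ᵥ ∑ k ∈ Finset.range n, ex k t • x k) =
      ∑ j ∈ Finset.range n, ∑ k ∈ Finset.range n, ∑ p, ∑ q,
        star (y j p) * x k q * (ex ((k : ℤ) - (j : ℤ)) t * symbolF s d μ f t p q) := by
    intro t
    rw [star_sum, sum_dotProduct]
    refine Finset.sum_congr rfl fun j _ => ?_
    rw [Matrix.mulVec_sum, dotProduct_sum]
    refine Finset.sum_congr rfl fun k _ => ?_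
    simp only [dotProduct, Matrix.mulVec, Finset.mul_sum, Pi.star_apply, Pi.smul_apply,
      smul_eq_mul, star_mul', ← hstar]
    refine Finset.sum_congr rfl fun p _ => Finset.sum_congr rfl fun q _ => ?_
    ring
  unfold formF
  simp only [hpt]
  rw [integral_finsetSum _ fun j _ => integrable_finsetSum _ fun k _ =>
    integrable_finsetSum _ fun p _ => integrable_finsetSum _ fun q _ => (hex _ p q).const_mul _,
    Finset.mul_sum]
  refine Finset.sum_congr rfl fun j _ => ?_
  rw [integral_finsetSum _ fun k _ =>
    integrable_finsetSum _ fun p _ => integrable_finsetSum _ fun q _ => (hex _ p q).const_mul _,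
    Finset.mul_sum]
  refine Finset.sum_congr rfl fun k _ => ?_
  rw [integral_finsetSum _ fun p _ =>
    integrable_finsetSum _ fun q _ => (hex _ p q).const_mul _, Finset.mul_sum]
  simp only [dotProduct, Matrix.mulVec, Finset.mul_sum, Pi.star_apply, entryF, Matrix.of_apply]
  refine Finset.sum_congr rfl fun p _ => ?_
  rw [integral_finsetSum _ fun q _ => (hex _ p q).const_mul _, Finset.mul_sum]
  refine Finset.sum_congr rfl fun q _ => ?_
  rw [integral_const_mul]
  ring

/-! ## Canonical factorization -/

/-- `χ_{μ,s}(ξ(m)) = ∑_{k ≥ 0} φ(k) ε(m-k)` is a canonical moving average representation with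
innovation sequence `ε`, and `Φ Φ^* = |χ_μ(e^{-iλ})|² |β(iλ)|⁻² f(λ)` with
`Φ(λ) = Φ_μ(e^{-iλ}) = ∑_{k ≥ 0} φ(k) e^{-iλk}` is the corresponding canonical factorization. -/
structure IsCanonicalFactorization {Ω : Type*} [MeasurableSpace Ω] (P : Measure Ω) {r T q : ℕ}
    (s d μ : Fin r → ℕ) (ξ : ℤ → Fin T → Ω → ℂ) (f : ℝ → Matrix (Fin T) (Fin T) ℂ)
    (ε : ℤ → Fin q → Ω → ℂ) (φ : ℕ → Matrix (Fin T) (Fin q) ℂ)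
    (Φ : ℝ → Matrix (Fin T) (Fin q) ℂ) : Prop where
  memLp : ∀ u k, MemLp (ε u k) 2 P
  orthonormal : ∀ u v k j,
    ∫ ω, ε u k ω * conj (ε v j ω) ∂P = if u = v ∧ k = j then 1 else 0
  innovation : ∀ m, pastSpace P (increment s d (fun i => (μ i : ℤ)) ξ) m = pastSpace P ε m
  summable : Summable (fun k => ∑ i, ∑ j, ‖φ k i j‖ ^ 2)
  movingAverage : ∀ m p, IsL2Sum P (fun k ω => ∑ j, φ k p j * ε (m - k) j ω)
    (increment s d (fun i => (μ i : ℤ)) ξ m p)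
  series : ∀ i j, IsL2Sum circ (fun k t => φ k i j * ex (-(k : ℤ)) t) (fun t => Φ t i j)
  factorization : ∀ᵐ t ∂circ, Φ t * (Φ t)ᴴ =
    ((‖chi s d (fun i => (μ i : ℤ)) (ex (-1) t)‖ ^ 2 / ‖beta s d t‖ ^ 2 : ℝ) : ℂ) • f t

/-- `(D̃_N^μ A_N φ_{μ,N})_k = ∑_{m=0}^N ∑_{l=k}^N φ_μ(m)ᵀ a(m+l) d_μ(l-k)`, with `a(j) = 0` for
`j > N`. -/
def rCoeff {r T q : ℕ} (s d μ : Fin r → ℕ) (a : ℕ → Fin T → ℂ) (N : ℕ)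
    (φ : ℕ → Matrix (Fin T) (Fin q) ℂ) (k : ℕ) : Fin q → ℂ :=
  ∑ m ∈ Finset.range (N + 1), ∑ l ∈ Finset.Icc k N,
    coeffD s d μ (l - k) • ((φ m)ᵀ *ᵥ (if m + l ≤ N then a (m + l) else 0))

/-- `r_{μ,N}(e^{iλ}) = ∑_{k=0}^N (D̃_N^μ A_N φ_{μ,N})_k e^{iλk}`. -/
def rFun {r T q : ℕ} (s d μ : Fin r → ℕ) (a : ℕ → Fin T → ℂ) (N : ℕ)
    (φ : ℕ → Matrix (Fin T) (Fin q) ℂ) (t : ℝ) : Fin q → ℂ :=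
  ∑ k ∈ Finset.range (N + 1), ex k t • rCoeff s d μ a N φ k

/-! ## The two formulas for the spectral characteristic -/

/-- The function `h` with
`hᵀ = B_{μ,N}(e^{iλ})ᵀ χ_μ(e^{-iλ})/β(iλ) - (conj β(iλ)/χ_μ(e^{iλ})) C(λ)ᵀ f(λ)⁻¹`. -/
def hOfC {r T : ℕ} (s d μ : Fin r → ℕ) (f : ℝ → Matrix (Fin T) (Fin T) ℂ)
    (a : ℕ → Fin T → ℂ) (N : ℕ) (C : ℝ → Fin T → ℂ) (t : ℝ) : Fin T → ℂ :=
  ratio s d (fun i => (μ i : ℤ)) t • BN s d μ a N t -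
    (conj (beta s d t) / chi s d (fun i => (μ i : ℤ)) (ex 1 t)) • (C t ᵥ* (f t)⁻¹)

/-- `(χ_μ(e^{-iλ})/β(iλ)) (B_{μ,N}(e^{iλ}) - Ψ_μ(e^{-iλ})ᵀ r_{μ,N}(e^{iλ}))`. -/
def hOfPsi {r T q : ℕ} (s d μ : Fin r → ℕ) (a : ℕ → Fin T → ℂ) (N : ℕ)
    (φ : ℕ → Matrix (Fin T) (Fin q) ℂ) (Ψ : ℝ → Matrix (Fin q) (Fin T) ℂ) (t : ℝ) : Fin T → ℂ :=
  ratio s d (fun i => (μ i : ℤ)) t • (BN s d μ a N t - (Ψ t)ᵀ *ᵥ rFun s d μ a N φ t)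

/-- The optimal linear estimate of `A_N ξ` exists and is `∫ h(λ)ᵀ dZ(λ) - V_N ξ`, its spectral
characteristic is `h`, and its mean square error is the finite number `Δ`. -/
def SolvesForecast {Ω : Type*} [MeasurableSpace Ω] (P : Measure Ω) {r T : ℕ}
    (s d μ : Fin r → ℕ) (ξ : ℤ → Fin T → Ω → ℂ) (f : ℝ → Matrix (Fin T) (Fin T) ℂ)
    (Z : ℝ → Fin T → Ω → ℂ) (a : ℕ → Fin T → ℂ) (N : ℕ) (h : ℝ → Fin T → ℂ) (Δ : ℂ) : Prop :=
  IsSpectralCharacteristic s d μ f a N h ∧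
  (∃ Y, IsOptimalEstimate P s d μ ξ a N Y) ∧
  ∀ Y, IsOptimalEstimate P s d μ ξ a N Y →
    HasStochIntegral P f Z h (fun ω => Y ω + functionalV s d μ a N ξ ω) ∧
    mse P ξ a N Y ≠ ⊤ ∧ ((mse P ξ a N Y).toReal : ℂ) = Δ

end GMForecast

end

open GMForecast

/-!
Write `ρ = χ_μ(e^{-iλ}) / β(iλ)`. This function is bounded and almost everywhere nonzero.

*Coordinates.* With a measurable root `S^* S = (2π)⁻¹ fᵀ` the map `g ↦ S g` identifies `L₂(f)` with
the space of square integrable vector functions on `(-π, π]` (`exists_isRoot`, `IsRoot.inner_vec`).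
The functions `e^{imλ} ρ δ_p`, `m ∈ ℤ`, are total in it, because an integrable function is determined
by its Fourier coefficients. The spectral density says that these functions, and their analogues for
all other admissible steps, have the Gram matrix of the increments, so there is an isometry
`U : L₂(f) → L₂(P)` carrying the former to the latter (`IsRoot.exists_spectralIsometry`). A spectral
process is obtained by applying `U` to indicator functions, and for every spectral process the
stochastic integral equals `U`, because it is a closed linear relation that agrees with `U` on a total
set (`IsRoot.hasStochIntegral`).

*Reduction to a projection.* The sequences `e` and `d` are convolution inverses, so
`A_N ξ + V_N ξ = ∑_{k ≤ N} b_N(k)ᵀ χ_μ(B) ξ(k)` (`functionalA_add_functionalV`). Hence the optimal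
estimate is `U h - V_N ξ`, where `h` is the projection of `ρ B_N` on `L₂^{0-}(f)`, and its mean square
error is the squared norm of `e = ρ B_N - h` (`solvesForecast`).

*The operator `F_μ`.* Put `C = conj(ρ) fᵀ e`. The Fourier coefficients of `C` with negative indices
vanish, since `e` is orthogonal to `L₂^{0-}(f)`, and pairing with `e` shows that the sequence `c` of
the remaining ones solves `F_μ c = D_N a_N`, provided that `C` is square integrable. As `f` need not be
bounded this requires an argument: `e` is a sum of `N + 1` vectors, the `k`-th of which lies in the
span of the past up to time `k` and is orthogonal to the past up to time `k - 1`. Such a wandering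
vector `w` is orthogonal to `e^{ijλ} w` for all `j ≠ 0`, so that `wᵀ f w̄` is constant
(`IsRoot.exists_norm_le_of_wandering`). Therefore `S e` is bounded, and `C = 2π conj(ρ) S^* (S e)` is
square integrable along with `S`.

*The canonical factorization.* The isometry carries `ρ Ψᵀ e^{ikλ} δ_j` to the innovation `ε_j(k)`
(`IsCanonicalFactorization.map_innov`). The prediction error is the part of `∑_k b_N(k)ᵀ χ_μ(B) ξ(k)`
carried by the innovations at times `0, …, N`, and the coefficients of this part are those of `r_N`.
-/

noncomputable section

namespace GMForecast

/-! ### Exponentials and the factor `χ_μ(e^{-iλ}) / β(iλ)` -/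

lemma ex_eq (k : ℤ) (t : ℝ) : ex k t = Complex.exp (Complex.I * ((k * t : ℝ) : ℂ)) := by
  unfold ex; congr 1; push_cast; ring

@[simp] lemma norm_ex (k : ℤ) (t : ℝ) : ‖ex k t‖ = 1 := by
  rw [ex_eq, Complex.norm_exp_I_mul_ofReal]

lemma continuous_ex (k : ℤ) : Continuous (ex k) := by
  unfold ex; fun_prop

lemma ex_add (k j : ℤ) (t : ℝ) : ex (k + j) t = ex k t * ex j t := by
  simp only [ex, ← Complex.exp_add]; congr 1; push_cast; ring

@[simp] lemma ex_zero (t : ℝ) : ex 0 t = 1 := by simp [ex]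

lemma conj_ex (k : ℤ) (t : ℝ) : conj (ex k t) = ex (-k) t := by
  simp only [ex, ← Complex.exp_conj]; congr 1; simp

lemma ex_zpow (k m : ℤ) (t : ℝ) : ex k t ^ m = ex (m * k) t := by
  simp only [ex, ← Complex.exp_int_mul]; congr 1; push_cast; ring

lemma conj_chi {r : ℕ} (s d : Fin r → ℕ) (ν : Fin r → ℤ) (t : ℝ) :
    conj (chi s d ν (ex (-1) t)) = chi s d ν (ex 1 t) := by
  simp [chi, ex_zpow, conj_ex]

lemma continuous_chi {r : ℕ} (s d : Fin r → ℕ) (ν : Fin r → ℤ) :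
    Continuous fun t => chi s d ν (ex (-1) t) := by
  simp only [chi, ex_zpow]
  exact continuous_finsetProd _ fun j _ => (continuous_const.sub (continuous_ex _)).pow _

lemma continuous_beta {r : ℕ} (s d : Fin r → ℕ) : Continuous (beta s d) := by
  unfold beta; fun_prop

lemma measurable_ratio {r : ℕ} (s d : Fin r → ℕ) (ν : Fin r → ℤ) : Measurable (ratio s d ν) :=
  (continuous_chi s d ν).measurable.div (continuous_beta s d).measurable

lemma AdmissibleStep.ne_zero {r : ℕ} {ν : Fin r → ℤ} (h : AdmissibleStep ν) (i : Fin r) :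
    ν i ≠ 0 := by
  rcases h with h | h
  · exact (h i).ne'
  · exact (h i).ne

lemma admissibleStep_natCast {r : ℕ} {μ : Fin r → ℕ} (hμ : ∀ i, 0 < μ i) :
    AdmissibleStep fun i => (μ i : ℤ) :=
  Or.inl fun i => Int.natCast_pos.2 (hμ i)

/-- Every zero of the denominator `∏_k (iλ - 2πik/s)` is a zero of `1 - e^{-iλνs}`. The zeros of the
denominator being `2π/s` apart, all its factors but the smallest have modulus at least `π/s`. -/
lemma exists_norm_one_sub_ex_le {s : ℕ} (hs : 0 < s) (ν : ℤ) :
    ∃ K : ℝ, 0 ≤ K ∧ ∀ t : ℝ, ‖1 - ex (-1) t ^ (ν * (s : ℤ))‖ ≤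
      K * ‖∏ k ∈ Finset.Icc (-((s : ℤ) / 2)) ((s : ℤ) / 2),
        (Complex.I * t - 2 * Real.pi * Complex.I * k / (s : ℂ))‖ := by
  set I := Finset.Icc (-((s : ℤ) / 2)) ((s : ℤ) / 2)
  have hs' : (0 : ℝ) < s := by exact_mod_cast hs
  have hsc : (s : ℂ) ≠ 0 := by exact_mod_cast hs.ne'
  have hpi := Real.pi_pos
  have hnorm : ∀ (t : ℝ) (k : ℤ), ‖Complex.I * t - 2 * Real.pi * Complex.I * k / (s : ℂ)‖
      = |t - 2 * Real.pi * k / s| := by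
    intro t k
    have : Complex.I * t - 2 * Real.pi * Complex.I * k / (s : ℂ)
        = Complex.I * ((t - 2 * Real.pi * k / s : ℝ) : ℂ) := by push_cast; ring
    rw [this, norm_mul, Complex.norm_I, one_mul, Complex.norm_real, Real.norm_eq_abs]
  refine ⟨|(ν * s : ℝ)| / (Real.pi / s) ^ (I.card - 1), by positivity, fun t => ?_⟩
  have hI : I.Nonempty := ⟨0, by simp [I]; omega⟩
  obtain ⟨k, hk, hmin⟩ := I.exists_min_image (fun k : ℤ => |t - 2 * Real.pi * k / s|) hI
  rw [norm_prod, Finset.prod_congr rfl fun k _ => hnorm t k, ← Finset.mul_prod_erase I _ hk]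
  have hfar : (Real.pi / s) ^ (I.card - 1) ≤ ∏ j ∈ I.erase k, |t - 2 * Real.pi * j / s| := by
    rw [← Finset.card_erase_of_mem hk, ← Finset.prod_const]
    refine Finset.prod_le_prod (fun _ _ => by positivity) fun j hj => ?_
    obtain ⟨hjk, hj⟩ := Finset.mem_erase.1 hj
    have h1 := hmin j hj
    have h2 : 2 * Real.pi / s ≤ |2 * Real.pi * j / s - 2 * Real.pi * k / s| := by
      rw [show 2 * Real.pi * j / s - 2 * Real.pi * k / s = 2 * Real.pi / s * ((j - k : ℤ) : ℝ) by
        push_cast; ring, abs_mul, abs_of_pos (by positivity : 0 < 2 * Real.pi / (s : ℝ))]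
      refine le_mul_of_one_le_right (by positivity) ?_
      exact_mod_cast Int.one_le_abs (sub_ne_zero.2 hjk)
    have h4 : |2 * Real.pi * j / s - 2 * Real.pi * k / s| ≤
        |t - 2 * Real.pi * k / s| + |t - 2 * Real.pi * j / s| := by
      rw [show 2 * Real.pi * j / s - 2 * Real.pi * k / s =
        (t - 2 * Real.pi * k / s) - (t - 2 * Real.pi * j / s) by ring]
      exact abs_sub _ _
    have h5 : 2 * Real.pi / s = 2 * (Real.pi / s) := by ring
    linarith
  have hnear : ‖1 - ex (-1) t ^ (ν * (s : ℤ))‖ ≤ |(ν * s : ℝ)| * |t - 2 * Real.pi * k / s| := by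
    have h1 : ex (-1) t ^ (ν * (s : ℤ)) =
        Complex.exp (Complex.I * ((-(ν * s) * (t - 2 * Real.pi * k / s) : ℝ) : ℂ)) := by
      rw [ex_zpow, ex]
      refine (Complex.exp_eq_exp_iff_exists_int).2 ⟨-(ν * k), ?_⟩
      push_cast
      field_simp
      ring
    rw [h1, norm_sub_rev]
    refine Real.norm_exp_I_mul_ofReal_sub_one_le.trans ?_
    rw [Real.norm_eq_abs, abs_mul, abs_neg]
  refine hnear.trans ?_
  have hp : 0 < (Real.pi / s) ^ (I.card - 1) := by positivity
  rw [div_mul_eq_mul_div, le_div_iff₀ hp, mul_assoc]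
  gcongr

lemma exists_norm_ratio_le {r : ℕ} {s : Fin r → ℕ} (hs : ∀ i, 0 < s i) (d : Fin r → ℕ)
    (ν : Fin r → ℤ) : ∃ K : ℝ, 0 ≤ K ∧ ∀ t, ‖ratio s d ν t‖ ≤ K := by
  choose K hK0 hK using fun i => exists_norm_one_sub_ex_le (hs i) (ν i)
  refine ⟨∏ i, K i ^ d i, Finset.prod_nonneg fun i _ => pow_nonneg (hK0 i) _, fun t => ?_⟩
  unfold ratio chi beta
  rw [← Finset.prod_div_distrib, norm_prod]
  refine Finset.prod_le_prod (fun _ _ => norm_nonneg _) fun i _ => ?_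
  rw [Finset.prod_pow, ← div_pow, norm_pow, norm_div]
  gcongr
  exact div_le_of_le_mul₀ (norm_nonneg _) (hK0 i) (hK i t)

lemma ae_chi_ne_zero {r : ℕ} {s : Fin r → ℕ} (hs : ∀ i, 0 < s i) (d : Fin r → ℕ)
    {ν : Fin r → ℤ} (hν : ∀ i, ν i ≠ 0) : ∀ᵐ t ∂circ, chi s d ν (ex (-1) t) ≠ 0 := by
  refine ae_mono Measure.restrict_le_self ?_
  have hc : (⋃ i, Set.range fun n : ℤ => (-(2 * Real.pi * n / (ν i * s i)) : ℝ)).Countable :=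
    Set.countable_iUnion fun i => Set.countable_range _
  filter_upwards [hc.ae_notMem volume] with t ht h0
  obtain ⟨i, -, hi⟩ := Finset.prod_eq_zero_iff.1 h0
  have h1 := eq_zero_of_pow_eq_zero hi
  rw [ex_zpow, ex, sub_eq_zero, eq_comm, Complex.exp_eq_one_iff] at h1
  obtain ⟨n, hn⟩ := h1
  refine ht (Set.mem_iUnion.2 ⟨i, n, ?_⟩)
  have hsi : (s i : ℝ) ≠ 0 := by exact_mod_cast (hs i).ne'
  have hνi : (ν i : ℝ) ≠ 0 := by exact_mod_cast hν i
  have h2 : Complex.I * ((-(ν i * s i) * t : ℝ) : ℂ) = Complex.I * ((n * (2 * Real.pi) : ℝ) : ℂ) := by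
    push_cast at hn ⊢
    linear_combination hn
  have h3 := Complex.ofReal_injective (mul_left_cancel₀ Complex.I_ne_zero h2)
  field_simp
  linarith

lemma ae_beta_ne_zero {r : ℕ} (s d : Fin r → ℕ) : ∀ᵐ t ∂circ, beta s d t ≠ 0 := by
  refine ae_mono Measure.restrict_le_self ?_
  have hc : (⋃ i, Set.range fun n : ℤ => (2 * Real.pi * n / (s i) : ℝ)).Countable :=
    Set.countable_iUnion fun i => Set.countable_range _
  filter_upwards [hc.ae_notMem volume] with t ht h0
  obtain ⟨i, -, hi⟩ := Finset.prod_eq_zero_iff.1 h0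
  obtain ⟨k, -, hk⟩ := Finset.prod_eq_zero_iff.1 hi
  have h1 := eq_zero_of_pow_eq_zero hk
  refine ht (Set.mem_iUnion.2 ⟨i, k, ?_⟩)
  have h2 : Complex.I * ((t - 2 * Real.pi * k / (s i) : ℝ) : ℂ) = 0 := by
    rw [← h1]; push_cast; ring
  have h3 := (mul_eq_zero.1 h2).resolve_left Complex.I_ne_zero
  have h4 : t - 2 * Real.pi * k / (s i) = 0 := by exact_mod_cast h3
  simp only
  linarith

lemma ae_ratio_ne_zero {r : ℕ} {s : Fin r → ℕ} (hs : ∀ i, 0 < s i) (d : Fin r → ℕ)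
    {ν : Fin r → ℤ} (hν : ∀ i, ν i ≠ 0) : ∀ᵐ t ∂circ, ratio s d ν t ≠ 0 := by
  filter_upwards [ae_chi_ne_zero hs d hν, ae_beta_ne_zero s d] with t h1 h2
  exact div_ne_zero h1 h2

/-! ### Fourier coefficients on `(-π, π]` -/

instance : IsFiniteMeasure circ := by
  unfold circ; infer_instance

lemma integral_circ_eq_intervalIntegral (F : ℝ → ℂ) :
    ∫ t, F t ∂circ = ∫ t in (-Real.pi)..Real.pi, F t := by
  rw [circ, intervalIntegral.integral_of_le (by linarith [Real.pi_pos])]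

lemma integral_ex (k : ℤ) :
    ∫ t, ex k t ∂circ = if k = 0 then (2 * Real.pi : ℂ) else 0 := by
  rw [integral_circ_eq_intervalIntegral]
  split_ifs with h
  · subst h; simp; ring
  · have hk : Complex.I * (k : ℂ) ≠ 0 :=
      mul_ne_zero Complex.I_ne_zero (by exact_mod_cast h)
    have : ∀ t : ℝ, ex k t = Complex.exp (Complex.I * k * t) := fun t => rfl
    simp only [this]
    rw [integral_exp_mul_complex hk, div_eq_zero_iff]
    left
    rw [sub_eq_zero]
    refine Complex.exp_eq_exp_iff_exists_int.2 ⟨k, ?_⟩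
    push_cast; ring

lemma integrable_ex_mul {F : ℝ → ℂ} (hF : Integrable F circ) (k : ℤ) :
    Integrable (fun t => ex k t * F t) circ :=
  hF.bdd_mul (c := 1) (continuous_ex k).aestronglyMeasurable
    (Eventually.of_forall fun t => (norm_ex k t).le)

/-- An integrable function with vanishing Fourier coefficients integrates to zero against every
trigonometric polynomial, so against every continuous function on the circle. -/
lemma ae_eq_zero_of_fourier {F : ℝ → ℂ} (hF : Integrable F circ)
    (h : ∀ m : ℤ, ∫ t, ex m t * F t ∂circ = 0) : F =ᵐ[circ] 0 := by
  have : Fact (0 < 2 * Real.pi) := ⟨Real.two_pi_pos⟩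
  have hint : ∀ G : C(AddCircle (2 * Real.pi), ℂ),
      Integrable (fun t : ℝ => G (t : AddCircle (2 * Real.pi)) * F t) circ := fun G =>
    hF.bdd_mul (c := ‖G‖)
      (G.continuous.comp (AddCircle.continuous_mk' _)).aestronglyMeasurable
      (Eventually.of_forall fun t => G.norm_coe_le_norm _)
  let Λ₀ : C(AddCircle (2 * Real.pi), ℂ) →ₗ[ℂ] ℂ :=
    { toFun := fun G => ∫ t : ℝ, G (t : AddCircle (2 * Real.pi)) * F t ∂circ
      map_add' := fun G₁ G₂ => by
        rw [← integral_add (hint G₁) (hint G₂)]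
        simp [add_mul]
      map_smul' := fun c G => by
        simp only [ContinuousMap.smul_apply, smul_eq_mul, mul_assoc, RingHom.id_apply]
        rw [integral_const_mul] }
  let Λ : C(AddCircle (2 * Real.pi), ℂ) →L[ℂ] ℂ := Λ₀.mkContinuous (∫ t, ‖F t‖ ∂circ) fun G => by
    refine (norm_integral_le_integral_norm _).trans ?_
    rw [← integral_mul_const]
    refine integral_mono (hint G).norm (hF.norm.mul_const _) fun t => ?_
    simp only [norm_mul]
    rw [mul_comm]
    gcongr
    exact G.norm_coe_le_norm _
  have hfour : ∀ n : ℤ, Λ (fourier n) = 0 := by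
    intro n
    change ∫ t : ℝ, fourier n (t : AddCircle (2 * Real.pi)) * F t ∂circ = 0
    rw [← h n]
    refine integral_congr_ae (Eventually.of_forall fun t => ?_)
    simp only [fourier_coe_apply, ex]
    congr 2
    have : (Real.pi : ℂ) ≠ 0 := by exact_mod_cast Real.pi_ne_zero
    push_cast
    field_simp
  have hΛ : ∀ G, Λ G = 0 := by
    have hker : (⊤ : Submodule ℂ C(AddCircle (2 * Real.pi), ℂ)) ≤ LinearMap.ker Λ.toLinearMap := by
      rw [← span_fourier_closure_eq_top]
      refine Submodule.topologicalClosure_minimal _ ?_ Λ.isClosed_ker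
      rw [Submodule.span_le]
      rintro _ ⟨n, rfl⟩
      exact hfour n
    exact fun G => hker (Submodule.mem_top (x := G))
  have hIoo : circ = volume.restrict (Set.Ioo (-Real.pi) Real.pi) :=
    (restrict_Ioo_eq_restrict_Ioc).symm
  rw [hIoo]
  have hloc : IntegrableOn F (Set.Ioo (-Real.pi) Real.pi) volume := by
    rw [IntegrableOn, ← hIoo]; exact hF
  have key := isOpen_Ioo.ae_eq_zero_of_integral_contDiff_smul_eq_zero
    (U := Set.Ioo (-Real.pi) Real.pi) (μ := volume) (f := F) hloc.locallyIntegrableOn ?_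
  · exact (ae_restrict_iff' measurableSet_Ioo).2 key
  intro g hg _ hsupp
  have hg0 : ∀ t, t ∉ Set.Ioo (-Real.pi) Real.pi → g t = 0 := fun t ht =>
    image_eq_zero_of_notMem_tsupport fun h => ht (hsupp h)
  have hend : (fun t => (g t : ℂ)) (-Real.pi) = (fun t => (g t : ℂ)) (-Real.pi + 2 * Real.pi) := by
    simp only
    rw [hg0 _ (by simp), hg0 _ fun h => by linarith [h.2]]
  let G : C(AddCircle (2 * Real.pi), ℂ) :=
    ⟨AddCircle.liftIoc (2 * Real.pi) (-Real.pi) fun t => (g t : ℂ),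
      AddCircle.liftIoc_continuous hend
        (Complex.continuous_ofReal.comp hg.continuous).continuousOn⟩
  have h1 : ∫ t : ℝ, G (t : AddCircle (2 * Real.pi)) * F t ∂circ = 0 := hΛ G
  have h2 : ∫ t, (g t : ℂ) * F t ∂circ = 0 := by
    rw [← h1]
    refine integral_congr_ae ((ae_restrict_iff' measurableSet_Ioc).2
      (Eventually.of_forall fun t ht => ?_))
    have ht' : t ∈ Set.Ioc (-Real.pi) (-Real.pi + 2 * Real.pi) := by
      rwa [show -Real.pi + 2 * Real.pi = Real.pi by ring]
    simp only [G, ContinuousMap.coe_mk, AddCircle.liftIoc_coe_apply ht']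
  rw [hIoo] at h2
  rw [← setIntegral_eq_integral_of_forall_compl_eq_zero (s := Set.Ioo (-Real.pi) Real.pi)
    fun t ht => by rw [hg0 t ht, zero_smul]]
  simpa only [Complex.real_smul] using h2

lemma ae_eq_zero_of_forall_Ico {F : ℝ → ℂ} (hF : Integrable F circ)
    (h : ∀ x y : ℝ, -Real.pi ≤ x → x ≤ y → y ≤ Real.pi → ∫ t in Set.Ico x y, F t ∂circ = 0) :
    F =ᵐ[circ] 0 := by
  have hpi := Real.pi_pos
  have hIco : circ = volume.restrict (Set.Ico (-Real.pi) Real.pi) :=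
    (restrict_Ico_eq_restrict_Ioc).symm
  have huniv : ∫ t, F t ∂circ = 0 := by
    have := h (-Real.pi) Real.pi le_rfl (by linarith) le_rfl
    rwa [hIco, Measure.restrict_restrict measurableSet_Ico, Set.inter_self, ← hIco] at this
  refine hF.ae_eq_zero_of_forall_setIntegral_eq_zero fun s hs _ => ?_
  have hgen : (inferInstance : MeasurableSpace ℝ) =
      MeasurableSpace.generateFrom (Set.range (Set.Iio : ℝ → Set ℝ)) :=
    (BorelSpace.measurable_eq).trans (borel_eq_generateFrom_Iio ℝ)
  refine MeasurableSpace.induction_on_inter (C := fun s _ => ∫ t in s, F t ∂circ = 0) hgen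
    isPiSystem_Iio (by simp) ?_ ?_ ?_ s hs
  · rintro _ ⟨a, rfl⟩
    rcases le_or_gt a (-Real.pi) with ha | ha
    · rw [hIco, Measure.restrict_restrict measurableSet_Iio,
        show Set.Iio a ∩ Set.Ico (-Real.pi) Real.pi = ∅ by
          ext t; simp; intro h1 h2; linarith]
      simp
    · have := h (-Real.pi) (min a Real.pi) le_rfl (le_min ha.le (by linarith)) (min_le_right _ _)
      rw [hIco, Measure.restrict_restrict measurableSet_Ico] at this
      rw [hIco, Measure.restrict_restrict measurableSet_Iio, ← this]
      congr 2
      ext t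
      simp
      grind
  · intro s hs h1
    have := integral_add_compl hs hF
    rw [h1, zero_add, huniv] at this
    exact this
  · intro g hd hm h1
    rw [integral_iUnion hm hd hF.integrableOn]
    simp [h1]

/-! ### The increment operator and its formal inverse -/

/-- The polynomial `∏_i (1 - x^{μ_i s_i})^{d_i}` of the increment operator. -/
def polyE {r : ℕ} (s d μ : Fin r → ℕ) : Polynomial ℂ :=
  ∏ i, ((1 : Polynomial ℂ) - Polynomial.X ^ (μ i * s i)) ^ d i

lemma natDegree_polyE_le {r : ℕ} (s d μ : Fin r → ℕ) :
    (polyE s d μ).natDegree ≤ nGamma s d μ := by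
  refine (Polynomial.natDegree_prod_le _ _).trans (Finset.sum_le_sum fun i _ => ?_)
  refine Polynomial.natDegree_pow_le.trans ?_
  rw [mul_comm]
  gcongr
  refine (Polynomial.natDegree_sub_le _ _).trans ?_
  simp

lemma coeffE_eq_zero {r : ℕ} {s d μ : Fin r → ℕ} {k : ℕ} (h : nGamma s d μ < k) :
    coeffE s d μ k = 0 :=
  Polynomial.coeff_eq_zero_of_natDegree_lt ((natDegree_polyE_le s d μ).trans_lt h)

lemma polyE_eq_sum {r : ℕ} (s d μ : Fin r → ℕ) :
    polyE s d μ = ∑ l ∈ Fintype.piFinset (fun i => Finset.range (d i + 1)),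
      Polynomial.monomial (∑ i, μ i * s i * l i)
        ((-1 : ℂ) ^ (∑ i, l i) * (∏ i, ((d i).choose (l i) : ℂ))) := by
  have h : ∀ i, ((1 : Polynomial ℂ) - Polynomial.X ^ (μ i * s i)) ^ d i =
      ∑ l ∈ Finset.range (d i + 1),
        Polynomial.monomial (μ i * s i * l) ((-1 : ℂ) ^ l * ((d i).choose l : ℂ)) := by
    intro i
    rw [sub_eq_neg_add, add_pow]
    refine Finset.sum_congr rfl fun l _ => ?_
    rw [one_pow, mul_one, neg_pow, ← pow_mul, ← Polynomial.C_mul_X_pow_eq_monomial]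
    simp only [map_mul, map_pow, map_neg, map_one, map_natCast]
    ring
  rw [polyE, Finset.prod_congr rfl fun i _ => h i, Finset.prod_univ_sum]
  refine Finset.sum_congr rfl fun l _ => ?_
  simp only [← Polynomial.C_mul_X_pow_eq_monomial, Finset.prod_mul_distrib, map_mul, map_prod,
    Finset.prod_pow_eq_pow_sum, map_pow]

/-- The GM increment with positive steps is `∑_k e(k) ξ(m - k)`. -/
lemma increment_eq_sum {Ω : Type*} {r T : ℕ} (s d μ : Fin r → ℕ) (ξ : ℤ → Fin T → Ω → ℂ)
    (m : ℤ) (p : Fin T) (ω : Ω) :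
    increment s d (fun i => (μ i : ℤ)) ξ m p ω =
      ∑ l ∈ Finset.range (nGamma s d μ + 1), coeffE s d μ l * ξ (m - l) p ω := by
  have h1 : (polyE s d μ).sum (fun l c => c * ξ (m - l) p ω) =
      ∑ l ∈ Finset.range (nGamma s d μ + 1), coeffE s d μ l * ξ (m - l) p ω :=
    Polynomial.sum_over_range' _ (by simp) _ (Nat.lt_succ_of_le (natDegree_polyE_le s d μ))
  let Λ : Polynomial ℂ →ₗ[ℂ] ℂ := Polynomial.lsum fun l : ℕ => LinearMap.mulRight ℂ (ξ (m - l) p ω)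
  have h2 : ∀ Q : Polynomial ℂ, Λ Q = Q.sum (fun l c => c * ξ (m - l) p ω) := fun Q => rfl
  rw [← h1, ← h2, polyE_eq_sum, map_sum, increment]
  refine Finset.sum_congr rfl fun l _ => ?_
  rw [h2, Polynomial.sum_monomial_index _ _ (by simp)]
  push_cast
  rfl

lemma mk_dvd_mul_one_sub_X_pow {a : ℕ} (ha : 0 < a) :
    PowerSeries.mk (fun n => if a ∣ n then (1 : ℂ) else 0) * (1 - PowerSeries.X ^ a) = 1 := by
  ext n
  rw [mul_sub, mul_one, map_sub, mul_comm, PowerSeries.coeff_X_pow_mul', PowerSeries.coeff_mk,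
    PowerSeries.coeff_one]
  by_cases hn : a ≤ n
  · have h1 : a ∣ n - a ↔ a ∣ n := by
      rw [Nat.dvd_sub_iff_left hn dvd_rfl]
    rw [if_pos hn, PowerSeries.coeff_mk, if_neg (by omega : ¬ n = 0)]
    simp only [h1, sub_self]
  · rw [if_neg hn, sub_zero]
    by_cases h0 : n = 0
    · simp [h0]
    · rw [if_neg h0, if_neg]
      exact fun h => hn (Nat.le_of_dvd (by omega) h)

/-- The sequences `e` and `d` are convolution inverses. -/
lemma sum_coeffE_mul_coeffD {r : ℕ} {s μ : Fin r → ℕ} (d : Fin r → ℕ) (hs : ∀ i, 0 < s i)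
    (hμ : ∀ i, 0 < μ i) (k : ℕ) :
    ∑ x ∈ Finset.HasAntidiagonal.antidiagonal k, coeffE s d μ x.1 * coeffD s d μ x.2 = if k = 0 then 1 else 0 := by
  have h : (polyE s d μ : PowerSeries ℂ) *
      ∏ i, (PowerSeries.mk (fun n => if μ i * s i ∣ n then (1 : ℂ) else 0)) ^ d i = 1 := by
    rw [polyE, ← Polynomial.coeToPowerSeries.ringHom_apply, map_prod, ← Finset.prod_mul_distrib]
    refine Finset.prod_eq_one fun i _ => ?_
    rw [Polynomial.coeToPowerSeries.ringHom_apply, Polynomial.coe_pow, ← mul_pow, mul_comm, Polynomial.coe_sub, Polynomial.coe_one,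
      Polynomial.coe_pow, Polynomial.coe_X,
      mk_dvd_mul_one_sub_X_pow (Nat.mul_pos (hμ i) (hs i)), one_pow]
  have h2 := congrArg (PowerSeries.coeff k) h
  rw [PowerSeries.coeff_mul, PowerSeries.coeff_one] at h2
  simp only [Polynomial.coeff_coe] at h2
  exact h2

lemma bN_eq_zero {r T : ℕ} (s d μ : Fin r → ℕ) (a : ℕ → Fin T → ℂ) {N k : ℕ} (h : N < k) :
    bN s d μ a N k = 0 := by
  rw [bN, Finset.Icc_eq_empty (by omega), Finset.sum_empty]

/-- Convolution with `e` recovers `a` from `D_N a`. -/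
lemma sum_coeffE_smul_bN {r T : ℕ} {s μ : Fin r → ℕ} (d : Fin r → ℕ) (hs : ∀ i, 0 < s i)
    (hμ : ∀ i, 0 < μ i) (a : ℕ → Fin T → ℂ) (N : ℕ) {j : ℕ} (hj : j ≤ N) :
    ∑ k ∈ Finset.Icc j N, coeffE s d μ (k - j) • bN s d μ a N k = a j := by
  simp only [bN, Finset.smul_sum, smul_smul]
  rw [Finset.sum_sigma']
  have h1 : ∑ x ∈ (Finset.Icc j N).sigma fun k => Finset.Icc k N,
        (coeffE s d μ (x.1 - j) * coeffD s d μ (x.2 - x.1)) • a x.2 =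
      ∑ x ∈ (Finset.Icc j N).sigma fun m => Finset.HasAntidiagonal.antidiagonal (m - j),
        (coeffE s d μ x.2.1 * coeffD s d μ x.2.2) • a x.1 := by
    refine Finset.sum_bij' (fun x _ => ⟨x.2, (x.1 - j, x.2 - x.1)⟩)
      (fun x _ => ⟨x.2.1 + j, x.1⟩) ?_ ?_ ?_ ?_ ?_
    · rintro ⟨k, m⟩ h
      simp at h ⊢; omega
    · rintro ⟨m, x, y⟩ h
      simp at h ⊢; omega
    · rintro ⟨k, m⟩ h
      simp at h ⊢; omega
    · rintro ⟨m, x, y⟩ h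
      simp at h ⊢; omega
    · rintro ⟨k, m⟩ h
      rfl
  rw [h1, ← Finset.sum_sigma' (Finset.Icc j N) (fun m => Finset.HasAntidiagonal.antidiagonal (m - j))
    (fun m x => (coeffE s d μ x.1 * coeffD s d μ x.2) • a m)]
  simp only [← Finset.sum_smul]
  rw [Finset.sum_eq_single j]
  · rw [sum_coeffE_mul_coeffD d hs hμ]; simp
  · intro m hm hmj
    rw [Finset.mem_Icc] at hm
    rw [sum_coeffE_mul_coeffD d hs hμ, if_neg (by omega), zero_smul]
  · intro h
    exact absurd (Finset.mem_Icc.2 ⟨le_rfl, hj⟩) h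

/-- `B_N ξ = ∑_{k=0}^N b_N(k)ᵀ χ_μ(B) ξ(k)`. -/
def functionalB {Ω : Type*} {r T : ℕ} (s d μ : Fin r → ℕ) (a : ℕ → Fin T → ℂ) (N : ℕ)
    (ξ : ℤ → Fin T → Ω → ℂ) (ω : Ω) : ℂ :=
  ∑ k ∈ Finset.range (N + 1), ∑ p, bN s d μ a N k p * increment s d (fun i => (μ i : ℤ)) ξ k p ω

/-- The functional splits as `A_N ξ = B_N ξ - V_N ξ`: the future values enter only through the
increments at times `0, …, N`, and the remainder consists of observed values. -/
lemma functionalA_add_functionalV {Ω : Type*} {r T : ℕ} {s μ : Fin r → ℕ} (d : Fin r → ℕ)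
    (hs : ∀ i, 0 < s i) (hμ : ∀ i, 0 < μ i) (a : ℕ → Fin T → ℂ) (N : ℕ)
    (ξ : ℤ → Fin T → Ω → ℂ) (ω : Ω) :
    functionalA a N ξ ω + functionalV s d μ a N ξ ω = functionalB s d μ a N ξ ω := by
  set n := nGamma s d μ with hn
  set x : ℤ → Fin T → ℂ := fun k p => ξ k p ω
  have hB : functionalB s d μ a N ξ ω = ∑ k ∈ Finset.range (N + 1), ∑ l ∈ Finset.range (n + 1),
      coeffE s d μ l * (bN s d μ a N k ⬝ᵥ x ((k : ℤ) - l)) := by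
    unfold functionalB
    refine Finset.sum_congr rfl fun k _ => ?_
    simp only [increment_eq_sum, dotProduct, Finset.mul_sum, ← hn]
    rw [Finset.sum_comm]
    refine Finset.sum_congr rfl fun l _ => Finset.sum_congr rfl fun p _ => ?_
    ring
  have hA : functionalA a N ξ ω = ∑ j ∈ Finset.range (N + 1), ∑ k ∈ Finset.Icc j N,
      coeffE s d μ (k - j) * (bN s d μ a N k ⬝ᵥ x j) := by
    unfold functionalA
    refine Finset.sum_congr rfl fun j hj => ?_
    rw [← sum_coeffE_smul_bN d hs hμ a N (Nat.lt_succ_iff.1 (Finset.mem_range.1 hj)),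
      sum_dotProduct]
    refine Finset.sum_congr rfl fun k _ => ?_
    rw [smul_dotProduct, smul_eq_mul]
  have hV : functionalV s d μ a N ξ ω = ∑ i ∈ Finset.Icc 1 n,
      ∑ k ∈ Finset.range (min N (n - i) + 1),
        coeffE s d μ (k + i) * (bN s d μ a N k ⬝ᵥ x (-(i : ℤ))) := by
    unfold functionalV
    refine Finset.sum_congr rfl fun i _ => ?_
    rw [vN, sum_dotProduct]
    refine Finset.sum_congr rfl fun k _ => ?_
    rw [smul_dotProduct, smul_eq_mul]
  rw [hA, hV, hB, Finset.sum_sigma', Finset.sum_sigma', Finset.sum_sigma']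
  rw [← Finset.sum_filter_add_sum_filter_not ((Finset.range (N + 1)).sigma fun _ =>
    Finset.range (n + 1)) (fun y => y.2 ≤ y.1)]
  congr 1
  · rw [← Finset.sum_filter_of_ne (p := fun y => y.2 - y.1 ≤ n)]
    swap
    · rintro ⟨j, k⟩ _ h
      by_contra hlt
      exact h (by simp only at hlt ⊢; rw [coeffE_eq_zero (by omega), zero_mul])
    refine Finset.sum_bij' (fun y _ => ⟨y.2, y.2 - y.1⟩) (fun y _ => ⟨y.1 - y.2, y.1⟩) ?_ ?_ ?_ ?_ ?_
    · rintro ⟨j, k⟩ h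
      simp at h ⊢; omega
    · rintro ⟨k, l⟩ h
      simp at h ⊢; omega
    · rintro ⟨j, k⟩ h
      simp at h ⊢; omega
    · rintro ⟨k, l⟩ h
      simp at h ⊢; omega
    · rintro ⟨j, k⟩ h
      simp at h ⊢
      left
      congr 2
      omega
  · refine Finset.sum_bij' (fun y _ => ⟨y.2, y.1 + y.2⟩) (fun y _ => ⟨y.2 - y.1, y.1⟩) ?_ ?_ ?_ ?_ ?_
    · rintro ⟨j, k⟩ h
      simp at h ⊢; omega
    · rintro ⟨k, l⟩ h
      simp at h ⊢; omega
    · rintro ⟨j, k⟩ h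
      simp at h ⊢
    · rintro ⟨k, l⟩ h
      simp at h ⊢; omega
    · rintro ⟨i, k⟩ h
      simp at h ⊢
      left
      rw [add_comm k i]

/-! ### The weighted space `L₂(f)` in coordinates -/

/-- `S` is a measurable root of the weight: `S^* S = (2π)⁻¹ fᵀ` with `S(λ)` invertible for almost
all `λ`. Then `g ↦ S g` identifies `L₂(f)`, with the norm divided by `√(2π)`, with the space of
square integrable functions, and with this normalization the spectral isometry into `L₂(P)` has no
extra factor. -/
structure IsRoot {T : ℕ} (f S : ℝ → Matrix (Fin T) (Fin T) ℂ) : Prop where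
  memLp : ∀ p q, MemLp (fun t => S t p q) 2 circ
  gram : ∀ᵐ t ∂circ, (S t)ᴴ * S t = (1 / (2 * Real.pi) : ℂ) • (f t)ᵀ
  isUnit_det : ∀ᵐ t ∂circ, IsUnit (S t).det

lemma aestronglyMeasurable_pi {X ι E : Type*} [MeasurableSpace X] {ν : Measure X} [Fintype ι]
    [NormedAddCommGroup E] [SecondCountableTopology E] [MeasurableSpace E] [BorelSpace E]
    {F : X → ι → E} : AEStronglyMeasurable F ν ↔ ∀ i, AEStronglyMeasurable (fun x => F x i) ν := by
  simp only [aestronglyMeasurable_iff_aemeasurable, aemeasurable_pi_iff]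

open scoped Matrix.Norms.L2Operator MatrixOrder in
/-- On positive semidefinite matrices the square root agrees with the map
`M ↦ ((M^* M)^{1/2})^{1/2}`, which is continuous on the space of all matrices. -/
lemma continuous_sqrt_sqrt (T : ℕ) :
    Continuous fun M : Matrix (Fin T) (Fin T) ℂ => CFC.sqrt (CFC.sqrt (star M * M)) := by
  have h1 : Continuous fun M : Matrix (Fin T) (Fin T) ℂ => CFC.sqrt (star M * M) :=
    CFC.continuousOn_sqrt.comp_continuous (by fun_prop) fun M => star_mul_self_nonneg M
  exact CFC.continuousOn_sqrt.comp_continuous h1 fun M => CFC.sqrt_nonneg (star M * M)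

open scoped Matrix.Norms.L2Operator MatrixOrder in
lemma exists_isRoot {T : ℕ} {f : ℝ → Matrix (Fin T) (Fin T) ℂ}
    (hint : ∀ p q, Integrable (fun t => f t p q) circ)
    (hpos : ∀ᵐ t ∂circ, (f t).PosSemidef) (hdet : ∀ᵐ t ∂circ, IsUnit (f t).det) :
    ∃ S, IsRoot f S := by
  set A : ℝ → Matrix (Fin T) (Fin T) ℂ := fun t => (1 / (2 * Real.pi) : ℂ) • (f t)ᵀ with hA
  set S : ℝ → Matrix (Fin T) (Fin T) ℂ := fun t => CFC.sqrt (CFC.sqrt (star (A t) * A t)) with hS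
  have hc : (1 / (2 * Real.pi) : ℂ) = ((1 / (2 * Real.pi) : ℝ) : ℂ) := by push_cast; rfl
  have hc0 : (0 : ℂ) ≤ 1 / (2 * Real.pi) := by
    rw [hc]; exact_mod_cast (by positivity : (0 : ℝ) ≤ 1 / (2 * Real.pi))
  have hgram : ∀ᵐ t ∂circ, (S t)ᴴ * S t = A t := by
    filter_upwards [hpos] with t ht
    have hAt : (0 : Matrix (Fin T) (Fin T) ℂ) ≤ A t := by
      rw [Matrix.nonneg_iff_posSemidef]
      exact ht.transpose.smul hc0
    have hsa : star (A t) = A t := (IsSelfAdjoint.of_nonneg hAt)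
    have h1 : CFC.sqrt (star (A t) * A t) = A t := by
      rw [hsa, CFC.sqrt_mul_self (A t) hAt]
    have h2 : S t = CFC.sqrt (A t) := by rw [hS]; simp only [h1]
    have h3 : (S t)ᴴ = S t := by
      rw [h2]; exact (IsSelfAdjoint.of_nonneg (CFC.sqrt_nonneg (A t)))
    rw [h3, h2, CFC.sqrt_mul_sqrt_self (A t) hAt]
  have hmeas : AEStronglyMeasurable S circ := by
    refine (continuous_sqrt_sqrt T).comp_aestronglyMeasurable (g := _) (f := A) ?_
    exact aestronglyMeasurable_pi.2 fun p => aestronglyMeasurable_pi.2 fun q =>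
      ((hint q p).aestronglyMeasurable.const_mul (1 / (2 * Real.pi) : ℂ))
  have hmeas' : ∀ p q, AEStronglyMeasurable (fun t => S t p q) circ := fun p q =>
    aestronglyMeasurable_pi.1 (aestronglyMeasurable_pi.1 hmeas p) q
  refine ⟨S, fun p q => ?_, hgram, ?_⟩
  · rw [memLp_two_iff_integrable_sq_norm (hmeas' p q)]
    refine (((hint q q).const_mul (1 / (2 * Real.pi) : ℂ)).re).mono'
      ((hmeas' p q).norm.pow 2) ?_
    filter_upwards [hgram] with t ht
    have h1 := congrFun (congrFun ht q) q
    simp only [Matrix.mul_apply, Matrix.conjTranspose_apply, hA, Matrix.smul_apply,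
      Matrix.transpose_apply, smul_eq_mul] at h1
    rw [Real.norm_eq_abs, abs_of_nonneg (by positivity), RCLike.re_eq_complex_re, ← h1,
      Complex.re_sum]
    have h2 : ∀ i, (star (S t i q) * S t i q).re = ‖S t i q‖ ^ 2 := by
      intro i
      rw [Complex.star_def, ← Complex.normSq_eq_conj_mul_self, Complex.ofReal_re,
        Complex.normSq_eq_norm_sq]
    simp only [h2]
    exact Finset.single_le_sum (f := fun i => ‖S t i q‖ ^ 2) (fun _ _ => by positivity)
      (Finset.mem_univ p)
  · filter_upwards [hgram, hdet] with t h1 h2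
    have h3 : IsUnit (A t).det := by
      rw [hA, Matrix.det_smul, Matrix.det_transpose]
      refine IsUnit.mul (IsUnit.pow _ ?_) h2
      rw [isUnit_iff_ne_zero, hc]
      exact_mod_cast (by positivity : (1 / (2 * Real.pi) : ℝ) ≠ 0)
    rw [← h1, Matrix.det_mul] at h3
    exact isUnit_of_mul_isUnit_right h3

/-- The function `S g` with values in Euclidean space. -/
def weighted {T : ℕ} (S : ℝ → Matrix (Fin T) (Fin T) ℂ) (g : ℝ → Fin T → ℂ) (t : ℝ) :
    EuclideanSpace ℂ (Fin T) :=
  WithLp.toLp 2 (S t *ᵥ g t)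

/-- The Hilbert space of square integrable vector functions on `(-π, π]`. -/
abbrev VecL2 (T : ℕ) := Lp (EuclideanSpace ℂ (Fin T)) 2 circ

open Classical in
/-- The class of `S g`, or zero when `S g` is not square integrable. -/
def vec {T : ℕ} (S : ℝ → Matrix (Fin T) (Fin T) ℂ) (g : ℝ → Fin T → ℂ) : VecL2 T :=
  if h : MemLp (weighted S g) 2 circ then h.toLp _ else 0

/-- The function `S⁻¹ x`. -/
def unweighted {T : ℕ} (S : ℝ → Matrix (Fin T) (Fin T) ℂ) (x : ℝ → EuclideanSpace ℂ (Fin T))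
    (t : ℝ) : Fin T → ℂ :=
  (S t)⁻¹ *ᵥ (x t).ofLp

section

variable {T : ℕ} {f S : ℝ → Matrix (Fin T) (Fin T) ℂ}

lemma inner_weighted_left (S : ℝ → Matrix (Fin T) (Fin T) ℂ) (g : ℝ → Fin T → ℂ) (t : ℝ)
    (y : EuclideanSpace ℂ (Fin T)) :
    inner ℂ (weighted S g t) y = star (g t) ⬝ᵥ ((S t)ᴴ *ᵥ y.ofLp) := by
  rw [EuclideanSpace.inner_eq_star_dotProduct, weighted, Matrix.star_mulVec, dotProduct_comm,
    Matrix.dotProduct_mulVec]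

lemma inner_weighted {t : ℝ} (ht : (S t)ᴴ * S t = (1 / (2 * Real.pi) : ℂ) • (f t)ᵀ)
    (g g' : ℝ → Fin T → ℂ) :
    inner ℂ (weighted S g' t) (weighted S g t) =
      1 / (2 * Real.pi) * (g t ⬝ᵥ (f t *ᵥ star (g' t))) := by
  rw [inner_weighted_left]
  simp only [weighted]
  rw [Matrix.mulVec_mulVec, ht, Matrix.smul_mulVec, dotProduct_smul, smul_eq_mul,
    Matrix.mulVec_transpose, dotProduct_comm, Matrix.dotProduct_mulVec]

lemma norm_weighted_sq {t : ℝ} (ht : (S t)ᴴ * S t = (1 / (2 * Real.pi) : ℂ) • (f t)ᵀ)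
    (g : ℝ → Fin T → ℂ) :
    (g t ⬝ᵥ (f t *ᵥ star (g t))).re = 2 * Real.pi * ‖weighted S g t‖ ^ 2 := by
  have h := inner_weighted ht g g
  rw [inner_self_eq_norm_sq_to_K] at h
  have hpi : (2 * Real.pi : ℂ) ≠ 0 := by exact_mod_cast Real.two_pi_pos.ne'
  have h2 : g t ⬝ᵥ (f t *ᵥ star (g t)) = ((2 * Real.pi * ‖weighted S g t‖ ^ 2 : ℝ) : ℂ) := by
    push_cast
    rw [show ((‖weighted S g t‖ : ℂ)) ^ 2 = ((RCLike.ofReal ‖weighted S g t‖ : ℂ)) ^ 2 from rfl, h]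
    field_simp
  rw [h2, Complex.ofReal_re]

lemma weighted_add (S : ℝ → Matrix (Fin T) (Fin T) ℂ) (g g' : ℝ → Fin T → ℂ) :
    weighted S (fun t => g t + g' t) = weighted S g + weighted S g' := by
  funext t
  simp [weighted, Matrix.mulVec_add]

lemma weighted_sub (S : ℝ → Matrix (Fin T) (Fin T) ℂ) (g g' : ℝ → Fin T → ℂ) :
    weighted S (fun t => g t - g' t) = weighted S g - weighted S g' := by
  funext t
  simp [weighted, Matrix.mulVec_sub]

lemma weighted_smul (S : ℝ → Matrix (Fin T) (Fin T) ℂ) (c : ℂ) (g : ℝ → Fin T → ℂ) :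
    weighted S (fun t => c • g t) = c • weighted S g := by
  funext t
  simp [weighted, Matrix.mulVec_smul]

lemma eLpNorm_two_sq {X E : Type*} [MeasurableSpace X] [NormedAddCommGroup E] {ν : Measure X}
    (F : X → E) : eLpNorm F 2 ν ^ 2 = ∫⁻ x, ‖F x‖ₑ ^ 2 ∂ν := by
  rw [eLpNorm_eq_lintegral_rpow_enorm_toReal (by norm_num) (by norm_num), ← ENNReal.rpow_natCast,
    ← ENNReal.rpow_mul]
  norm_num

namespace IsRoot

lemma aestronglyMeasurable (hS : IsRoot f S) (p q : Fin T) :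
    AEStronglyMeasurable (fun t => S t p q) circ := (hS.memLp p q).aestronglyMeasurable

lemma normSqL2_eq (hS : IsRoot f S) (g : ℝ → Fin T → ℂ) :
    normSqL2 f g = ENNReal.ofReal (2 * Real.pi) * eLpNorm (weighted S g) 2 circ ^ 2 := by
  rw [eLpNorm_two_sq, ← lintegral_const_mul' _ _ ENNReal.ofReal_ne_top, normSqL2]
  refine lintegral_congr_ae ?_
  filter_upwards [hS.gram] with t ht
  rw [norm_weighted_sq ht, ENNReal.ofReal_mul Real.two_pi_pos.le, ENNReal.ofReal_pow (norm_nonneg _),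
    ofReal_norm]

end IsRoot

lemma aestronglyMeasurable_weighted {R : ℝ → Matrix (Fin T) (Fin T) ℂ}
    (hR : ∀ p q, AEStronglyMeasurable (fun t => R t p q) circ) {g : ℝ → Fin T → ℂ}
    (hg : ∀ p, AEStronglyMeasurable (fun t => g t p) circ) :
    AEStronglyMeasurable (weighted R g) circ := by
  refine (PiLp.continuous_toLp 2 _).comp_aestronglyMeasurable
    (f := fun t => R t *ᵥ g t) (aestronglyMeasurable_pi.2 fun p => ?_)
  simp only [Matrix.mulVec, dotProduct]
  exact Finset.aestronglyMeasurable_fun_sum _ fun q _ => (hR p q).mul (hg q)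

lemma aestronglyMeasurable_inv {R : ℝ → Matrix (Fin T) (Fin T) ℂ}
    (hR : ∀ p q, AEStronglyMeasurable (fun t => R t p q) circ) (p q : Fin T) :
    AEStronglyMeasurable (fun t => (R t)⁻¹ p q) circ := by
  have hR' : AEStronglyMeasurable R circ :=
    aestronglyMeasurable_pi.2 fun p => aestronglyMeasurable_pi.2 fun q => hR p q
  have h1 : AEStronglyMeasurable (fun t => (R t).det) circ :=
    (Continuous.matrix_det continuous_id).comp_aestronglyMeasurable hR'
  have h2 : AEStronglyMeasurable (fun t => (R t).adjugate p q) circ :=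
    ((Continuous.matrix_adjugate continuous_id).matrix_elem p q).comp_aestronglyMeasurable hR'
  simp only [Matrix.inv_def, Matrix.smul_apply, Ring.inverse_eq_inv', smul_eq_mul]
  exact (h1.aemeasurable.inv.aestronglyMeasurable).mul h2

lemma aestronglyMeasurable_unweighted (hS : ∀ p q, AEStronglyMeasurable (fun t => S t p q) circ)
    {x : ℝ → EuclideanSpace ℂ (Fin T)} (hx : AEStronglyMeasurable x circ) (p : Fin T) :
    AEStronglyMeasurable (fun t => unweighted S x t p) circ := by
  simp only [unweighted, Matrix.mulVec, dotProduct]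
  exact Finset.aestronglyMeasurable_fun_sum _ fun q _ => (aestronglyMeasurable_inv hS p q).mul
    ((EuclideanSpace.proj q : EuclideanSpace ℂ (Fin T) →L[ℂ] ℂ).continuous.comp_aestronglyMeasurable
      hx)

namespace IsRoot

lemma unweighted_weighted (hS : IsRoot f S) (g : ℝ → Fin T → ℂ) :
    unweighted S (weighted S g) =ᵐ[circ] g := by
  filter_upwards [hS.isUnit_det] with t ht
  simp only [weighted, unweighted]
  rw [Matrix.mulVec_mulVec, Matrix.nonsing_inv_mul _ ht, Matrix.one_mulVec]

lemma memL2_iff (hS : IsRoot f S) {g : ℝ → Fin T → ℂ} :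
    MemL2 f g ↔ MemLp (weighted S g) 2 circ := by
  have hfin : normSqL2 f g < ⊤ ↔ eLpNorm (weighted S g) 2 circ < ⊤ := by
    rw [hS.normSqL2_eq]
    constructor
    · intro h
      by_contra h'
      rw [not_lt, top_le_iff] at h'
      rw [h', ENNReal.top_pow two_ne_zero, ENNReal.mul_top] at h
      · exact h.ne rfl
      · exact (ENNReal.ofReal_pos.2 Real.two_pi_pos).ne'
    · intro h
      exact ENNReal.mul_lt_top ENNReal.ofReal_lt_top (ENNReal.pow_lt_top h)
  constructor
  · rintro ⟨h1, h2⟩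
    refine ⟨aestronglyMeasurable_weighted hS.aestronglyMeasurable fun p => ?_, hfin.1 h2⟩
    exact (aemeasurable_pi_iff.1 h1 p).aestronglyMeasurable
  · rintro ⟨h1, h2⟩
    refine ⟨?_, hfin.2 h2⟩
    refine AEMeasurable.congr (aemeasurable_pi_iff.2 fun p => ?_) (hS.unweighted_weighted g)
    exact (aestronglyMeasurable_unweighted hS.aestronglyMeasurable h1 p).aemeasurable

lemma coeFn_vec (hS : IsRoot f S) {g : ℝ → Fin T → ℂ} (hg : MemL2 f g) :
    vec S g =ᵐ[circ] weighted S g := by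
  have h := hS.memL2_iff.1 hg
  rw [vec, dif_pos h]
  exact h.coeFn_toLp

lemma eq_vec (hS : IsRoot f S) {g : ℝ → Fin T → ℂ} {x : VecL2 T}
    (h : x =ᵐ[circ] weighted S g) : vec S g = x := by
  have h1 : MemL2 f g := hS.memL2_iff.2 ((memLp_congr_ae h).1 (Lp.memLp x))
  exact Lp.ext ((hS.coeFn_vec h1).trans h.symm)

lemma memL2_of_coeFn (hS : IsRoot f S) {g : ℝ → Fin T → ℂ} {x : VecL2 T}
    (h : x =ᵐ[circ] weighted S g) : MemL2 f g :=
  hS.memL2_iff.2 ((memLp_congr_ae h).1 (Lp.memLp x))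

lemma memL2_add (hS : IsRoot f S) {g g' : ℝ → Fin T → ℂ} (hg : MemL2 f g) (hg' : MemL2 f g') :
    MemL2 f (fun t => g t + g' t) := by
  rw [hS.memL2_iff] at *
  rw [weighted_add]
  exact hg.add hg'

lemma memL2_smul (hS : IsRoot f S) {g : ℝ → Fin T → ℂ} (hg : MemL2 f g) (c : ℂ) :
    MemL2 f (fun t => c • g t) := by
  rw [hS.memL2_iff] at *
  rw [weighted_smul]
  exact hg.const_smul c

lemma memL2_sub (hS : IsRoot f S) {g g' : ℝ → Fin T → ℂ} (hg : MemL2 f g) (hg' : MemL2 f g') :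
    MemL2 f (fun t => g t - g' t) := by
  rw [hS.memL2_iff] at *
  rw [weighted_sub]
  exact hg.sub hg'

lemma vec_add (hS : IsRoot f S) {g g' : ℝ → Fin T → ℂ} (hg : MemL2 f g) (hg' : MemL2 f g') :
    vec S (fun t => g t + g' t) = vec S g + vec S g' := by
  refine hS.eq_vec ?_
  filter_upwards [hS.coeFn_vec hg, hS.coeFn_vec hg', Lp.coeFn_add (vec S g) (vec S g')]
    with t h1 h2 h3
  rw [h3, weighted_add, Pi.add_apply, Pi.add_apply, h1, h2]

lemma vec_sub (hS : IsRoot f S) {g g' : ℝ → Fin T → ℂ} (hg : MemL2 f g) (hg' : MemL2 f g') :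
    vec S (fun t => g t - g' t) = vec S g - vec S g' := by
  refine hS.eq_vec ?_
  filter_upwards [hS.coeFn_vec hg, hS.coeFn_vec hg', Lp.coeFn_sub (vec S g) (vec S g')]
    with t h1 h2 h3
  rw [h3, weighted_sub, Pi.sub_apply, Pi.sub_apply, h1, h2]

lemma vec_smul (hS : IsRoot f S) {g : ℝ → Fin T → ℂ} (hg : MemL2 f g) (c : ℂ) :
    vec S (fun t => c • g t) = c • vec S g := by
  refine hS.eq_vec ?_
  filter_upwards [hS.coeFn_vec hg, Lp.coeFn_smul c (vec S g)] with t h1 h2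
  rw [h2, weighted_smul, Pi.smul_apply, Pi.smul_apply, h1]

lemma memL2_zero (hS : IsRoot f S) : MemL2 f (fun _ => (0 : Fin T → ℂ)) := by
  rw [hS.memL2_iff]
  convert MemLp.zero' (ε := EuclideanSpace ℂ (Fin T)) (p := 2) (μ := circ) using 1
  funext t
  simp [weighted]

lemma vec_zero (hS : IsRoot f S) : vec S (fun _ => (0 : Fin T → ℂ)) = 0 := by
  have := hS.vec_smul hS.memL2_zero 0
  simpa using this

lemma memL2_sum_and_vec_sum (hS : IsRoot f S) {ι : Type*} (I : Finset ι)
    {g : ι → ℝ → Fin T → ℂ} (hg : ∀ i, MemL2 f (g i)) :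
    MemL2 f (fun t => ∑ i ∈ I, g i t) ∧ vec S (fun t => ∑ i ∈ I, g i t) = ∑ i ∈ I, vec S (g i) := by
  classical
  induction I using Finset.induction_on with
  | empty => exact ⟨by simpa using hS.memL2_zero, by simpa using hS.vec_zero⟩
  | insert i I hi ih =>
    simp only [Finset.sum_insert hi]
    exact ⟨hS.memL2_add (hg i) ih.1, by rw [hS.vec_add (hg i) ih.1, ih.2]⟩

lemma inner_vec (hS : IsRoot f S) {g g' : ℝ → Fin T → ℂ} (hg : MemL2 f g) (hg' : MemL2 f g') :
    inner ℂ (vec S g') (vec S g) =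
      1 / (2 * Real.pi) * ∫ t, g t ⬝ᵥ (f t *ᵥ star (g' t)) ∂circ := by
  rw [L2.inner_def, ← integral_const_mul]
  refine integral_congr_ae ?_
  filter_upwards [hS.coeFn_vec hg, hS.coeFn_vec hg', hS.gram] with t h1 h2 h3
  rw [h1, h2, inner_weighted h3]

lemma normSqL2_eq_vec (hS : IsRoot f S) {g : ℝ → Fin T → ℂ} (hg : MemL2 f g) :
    normSqL2 f g = ENNReal.ofReal (2 * Real.pi) * ‖vec S g‖ₑ ^ 2 := by
  rw [hS.normSqL2_eq, Lp.enorm_def, eLpNorm_congr_ae (hS.coeFn_vec hg)]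

/-- The components of `S^* x` are integrable, and they represent the functional
`g ↦ ⟨S g, x⟩`. -/
lemma integrable_conjTranspose_mulVec (hS : IsRoot f S) (x : VecL2 T) (p : Fin T) :
    Integrable (fun t => ((S t)ᴴ *ᵥ (x t).ofLp) p) circ := by
  simp only [Matrix.mulVec, dotProduct, Matrix.conjTranspose_apply]
  refine integrable_finsetSum _ fun q _ => ?_
  exact MemLp.integrable_mul (p := 2) (q := 2) (hS.memLp q p).star
    ((EuclideanSpace.proj q : EuclideanSpace ℂ (Fin T) →L[ℂ] ℂ).comp_memLp' (Lp.memLp x))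

lemma inner_vec_single (hS : IsRoot f S) {φ : ℝ → ℂ} {p : Fin T}
    (hφ : MemL2 f (fun t => Pi.single p (φ t))) (x : VecL2 T) :
    inner ℂ (vec S fun t => Pi.single p (φ t)) x =
      ∫ t, conj (φ t) * ((S t)ᴴ *ᵥ (x t).ofLp) p ∂circ := by
  rw [L2.inner_def]
  refine integral_congr_ae ?_
  filter_upwards [hS.coeFn_vec hφ] with t h1
  rw [h1, inner_weighted_left, ← Pi.single_star, single_dotProduct]
  rfl

lemma eq_zero_of_conjTranspose_mulVec (hS : IsRoot f S) {x : VecL2 T}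
    (h : ∀ p, (fun t => ((S t)ᴴ *ᵥ (x t).ofLp) p) =ᵐ[circ] 0) : x = 0 := by
  rw [Lp.eq_zero_iff_ae_eq_zero]
  filter_upwards [hS.isUnit_det, eventually_all.2 h] with t h1 h2
  have h3 : (S t)ᴴ *ᵥ (x t).ofLp = 0 := funext fun p => h2 p
  have h4 : IsUnit ((S t)ᴴ).det := by
    rw [Matrix.det_conjTranspose]; exact h1.star
  have h5 : (x t).ofLp = 0 := by
    have := congrArg (fun v => ((S t)ᴴ)⁻¹ *ᵥ v) h3
    simpa [Matrix.mulVec_mulVec, Matrix.nonsing_inv_mul _ h4] using this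
  rw [Pi.zero_apply, ← WithLp.toLp_ofLp 2 (x t), h5]
  rfl

lemma memL2_single (hS : IsRoot f S) {φ : ℝ → ℂ} (p : Fin T)
    (hφ : AEStronglyMeasurable φ circ) {K : ℝ} (hK : ∀ t, ‖φ t‖ ≤ K) :
    MemL2 f (fun t => Pi.single p (φ t)) := by
  rw [hS.memL2_iff]
  refine MemLp.of_eval_piLp fun i => ?_
  have h : ∀ t, (weighted S (fun t => Pi.single p (φ t)) t) i = φ t * S t i p := fun t => by
    simp [weighted, mul_comm]
  simp only [h]
  refine MemLp.of_le_mul (c := K) (hS.memLp i p) (hφ.mul (hS.aestronglyMeasurable i p))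
    (Eventually.of_forall fun t => ?_)
  rw [norm_mul]
  gcongr
  exact hK t

end IsRoot

end

/-! ### The spectral isometry -/

/-- Two families with the same Gram matrix, the first of them total, are related by an isometry. -/
lemma exists_linearIsometry_of_gram {ι E F : Type*} [NormedAddCommGroup E] [InnerProductSpace ℂ E]
    [NormedAddCommGroup F] [InnerProductSpace ℂ F] [CompleteSpace F] {x : ι → E} {y : ι → F}
    (h : ∀ i j, inner ℂ (x i) (x j) = inner ℂ (y i) (y j))
    (hx : (Submodule.span ℂ (Set.range x)).topologicalClosure = ⊤) :
    ∃ U : E →ₗᵢ[ℂ] F, ∀ i, U (x i) = y i := by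
  set A := Finsupp.linearCombination ℂ x
  set B := Finsupp.linearCombination ℂ y
  have hinner : ∀ c, inner ℂ (B c) (B c) = inner ℂ (A c) (A c) := by
    intro c
    simp only [A, B, Finsupp.linearCombination_apply, Finsupp.sum, sum_inner, inner_sum,
      inner_smul_left, inner_smul_right, h]
  have hnorm : ∀ c, ‖B c‖ = ‖A c‖ := by
    intro c
    have := hinner c
    rw [inner_self_eq_norm_sq_to_K, inner_self_eq_norm_sq_to_K] at this
    exact (pow_left_inj₀ (norm_nonneg _) (norm_nonneg _) two_ne_zero).1 (by exact_mod_cast this)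
  have hdense : DenseRange A := by
    have h1 : Set.range A = (Submodule.span ℂ (Set.range x) : Set E) := by
      rw [← Finsupp.range_linearCombination]; rfl
    rw [DenseRange, h1]
    exact Submodule.dense_iff_topologicalClosure_eq_top.2 hx
  have hext : ∀ c, B.extendOfNorm A (A c) = B c :=
    LinearMap.extendOfNorm_eq hdense ⟨1, fun c => by rw [one_mul, hnorm]⟩
  refine ⟨⟨(B.extendOfNorm A).toLinearMap, fun z => ?_⟩, fun i => ?_⟩
  · refine hdense.induction_on (p := fun z => ‖B.extendOfNorm A z‖ = ‖z‖) z
      (isClosed_eq (by fun_prop) continuous_norm) fun c => ?_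
    rw [hext, hnorm]
  · have := hext (Finsupp.single i 1)
    simpa [A, B] using this

/-- The function `e^{imλ} χ_ν(e^{-iλ}) β(iλ)⁻¹ δ_p`. -/
def gen {r T : ℕ} (s d : Fin r → ℕ) (ν : Fin r → ℤ) (m : ℤ) (p : Fin T) (t : ℝ) : Fin T → ℂ :=
  Pi.single p (ex m t * ratio s d ν t)

section

variable {T : ℕ} {f S : ℝ → Matrix (Fin T) (Fin T) ℂ} {r : ℕ} {s : Fin r → ℕ}

namespace IsRoot

lemma memL2_gen (hS : IsRoot f S) (hs : ∀ i, 0 < s i) (d : Fin r → ℕ) (ν : Fin r → ℤ) (m : ℤ)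
    (p : Fin T) : MemL2 f (gen s d ν m p) := by
  obtain ⟨K, hK0, hK⟩ := exists_norm_ratio_le hs d ν
  refine hS.memL2_single p (((continuous_ex m).measurable.mul
    (measurable_ratio s d ν)).aestronglyMeasurable) (K := K) fun t => ?_
  rw [norm_mul, norm_ex, one_mul]
  exact hK t

lemma inner_gen (hS : IsRoot f S) (hs : ∀ i, 0 < s i) (d : Fin r → ℕ) (ν₁ ν₂ : Fin r → ℤ)
    (m₁ m₂ : ℤ) (p q : Fin T) :
    inner ℂ (vec S (gen s d ν₂ m₂ q)) (vec S (gen s d ν₁ m₁ p)) =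
      1 / (2 * Real.pi) * ∫ t, ex (m₁ - m₂) t * chi s d ν₁ (ex (-1) t) * chi s d ν₂ (ex 1 t) /
        ((‖beta s d t‖ ^ 2 : ℝ) : ℂ) * f t p q ∂circ := by
  rw [hS.inner_vec (hS.memL2_gen hs d ν₁ m₁ p) (hS.memL2_gen hs d ν₂ m₂ q)]
  congr 1
  refine integral_congr_ae (Eventually.of_forall fun t => ?_)
  simp only [gen, ← Pi.single_star, single_dotProduct, Matrix.mulVec_single, ratio,
    Complex.star_def, map_mul, map_div₀, conj_ex, conj_chi, sub_eq_add_neg, ex_add]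
  simp only [Matrix.col, Pi.smul_apply, Matrix.transpose_apply, MulOpposite.smul_eq_mul_unop,
    MulOpposite.unop_op]
  have h : (((‖beta s d t‖ ^ 2 : ℝ)) : ℂ) = beta s d t * conj (beta s d t) := by
    rw [Complex.mul_conj, Complex.normSq_eq_norm_sq]
  rw [h, div_mul_eq_mul_div, mul_div_assoc]
  ring

/-- The inner products with the functions `e^{imλ} χ_ν(e^{-iλ}) β(iλ)⁻¹ δ_p` are Fourier coefficients
of an integrable function. -/
lemma inner_vec_gen (hS : IsRoot f S) (hs : ∀ i, 0 < s i) (d : Fin r → ℕ) (ν : Fin r → ℤ) (m : ℤ)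
    (p : Fin T) (x : VecL2 T) :
    inner ℂ (vec S (gen s d ν m p)) x =
      ∫ t, ex (-m) t * (conj (ratio s d ν t) * ((S t)ᴴ *ᵥ (x t).ofLp) p) ∂circ := by
  have h := hS.inner_vec_single (hS.memL2_gen hs d ν m p) x
  simp only [map_mul, conj_ex, mul_assoc] at h
  exact h

lemma integrable_conj_ratio_mul (hS : IsRoot f S) (hs : ∀ i, 0 < s i) (d : Fin r → ℕ)
    (ν : Fin r → ℤ) (x : VecL2 T) (p : Fin T) :
    Integrable (fun t => conj (ratio s d ν t) * ((S t)ᴴ *ᵥ (x t).ofLp) p) circ := by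
  obtain ⟨K, -, hK⟩ := exists_norm_ratio_le hs d ν
  refine (hS.integrable_conjTranspose_mulVec x p).bdd_mul (c := K) ?_
    (Eventually.of_forall fun t => by rw [RCLike.norm_conj]; exact hK t)
  exact (Complex.continuous_conj.measurable.comp (measurable_ratio s d ν)).aestronglyMeasurable

lemma span_gen_dense (hS : IsRoot f S) (hs : ∀ i, 0 < s i) (d : Fin r → ℕ) {ν : Fin r → ℤ}
    (hν : ∀ i, ν i ≠ 0) :
    (Submodule.span ℂ (Set.range fun i : ℤ × Fin T =>
      vec S (gen s d ν i.1 i.2))).topologicalClosure = ⊤ := by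
  rw [Submodule.topologicalClosure_eq_top_iff, Submodule.eq_bot_iff]
  intro x hx
  refine hS.eq_zero_of_conjTranspose_mulVec fun p => ?_
  have h0 := ae_eq_zero_of_fourier (hS.integrable_conj_ratio_mul hs d ν x p) fun m => by
    have := (Submodule.mem_orthogonal _ _).1 hx _ (Submodule.subset_span ⟨(-m, p), rfl⟩)
    rwa [hS.inner_vec_gen hs, neg_neg] at this
  filter_upwards [h0, ae_ratio_ne_zero hs d hν] with t h1 h2
  exact (mul_eq_zero.1 h1).resolve_left ((map_ne_zero _).2 h2)

/-- The spectral isometry: it carries `e^{imλ} χ_ν(e^{-iλ}) β(iλ)⁻¹ δ_p` to the increment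
`χ_ν(B) ξ_p(m)`, simultaneously for all admissible steps. -/
lemma exists_spectralIsometry (hS : IsRoot f S) (hs : ∀ i, 0 < s i) (d : Fin r → ℕ)
    {Ω : Type*} [MeasurableSpace Ω] {P : Measure Ω} {ξ : ℤ → Fin T → Ω → ℂ}
    (hξ : HasStationaryIncrements P s d ξ) (hf : IsSpectralDensity P s d ξ f) :
    ∃ U : VecL2 T →ₗᵢ[ℂ] Lp ℂ 2 P, ∀ ν, AdmissibleStep ν → ∀ m p,
      U (vec S (gen s d ν m p)) =ᵐ[P] increment s d ν ξ m p := by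
  let x : {ν : Fin r → ℤ // AdmissibleStep ν} × ℤ × Fin T → VecL2 T := fun i =>
    vec S (gen s d i.1.1 i.2.1 i.2.2)
  let y : {ν : Fin r → ℤ // AdmissibleStep ν} × ℤ × Fin T → Lp ℂ 2 P := fun i =>
    (hξ.memLp i.1.1 i.1.2 i.2.1 i.2.2).toLp _
  have hgram : ∀ i j, inner ℂ (x i) (x j) = inner ℂ (y i) (y j) := by
    rintro ⟨⟨ν₂, h₂⟩, m₂, q⟩ ⟨⟨ν₁, h₁⟩, m₁, p⟩
    have h := hf.structural ν₁ ν₂ h₁ h₂ m₂ (m₁ - m₂) p q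
    rw [add_sub_cancel] at h
    rw [hS.inner_gen hs, ← h, L2.inner_def]
    refine integral_congr_ae ?_
    filter_upwards [(hξ.memLp ν₁ h₁ m₁ p).coeFn_toLp, (hξ.memLp ν₂ h₂ m₂ q).coeFn_toLp]
      with ω h3 h4
    simp only [y, h3, h4, RCLike.inner_apply]
  have hdense : (Submodule.span ℂ (Set.range x)).topologicalClosure = ⊤ := by
    have h1 : AdmissibleStep (fun _ : Fin r => (1 : ℤ)) := Or.inl fun _ => one_pos
    rw [eq_top_iff, ← hS.span_gen_dense hs d h1.ne_zero]
    refine Submodule.topologicalClosure_mono (Submodule.span_mono ?_)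
    rintro _ ⟨⟨m, p⟩, rfl⟩
    exact ⟨(⟨_, h1⟩, m, p), rfl⟩
  obtain ⟨U, hU⟩ := exists_linearIsometry_of_gram hgram hdense
  refine ⟨U, fun ν hν m p => ?_⟩
  have := hU (⟨ν, hν⟩, m, p)
  simp only [x, y] at this
  rw [this]
  exact (hξ.memLp ν hν m p).coeFn_toLp

end IsRoot

/-! ### Stochastic integrals -/

/-- Makes the square of an `L₂` norm, scaled by the factor `2π` between `L₂(f)` and the coordinate
space, smaller than `δ`. -/
lemma two_pi_mul_sq_lt {x δ : ℝ≥0∞} (hx : x < min δ 1 / 7) :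
    ENNReal.ofReal (2 * Real.pi) * x ^ 2 < δ := by
  have h7 : ENNReal.ofReal (2 * Real.pi) ≤ 7 := by
    rw [show (7 : ℝ≥0∞) = ENNReal.ofReal 7 by norm_num]
    exact ENNReal.ofReal_le_ofReal (by linarith [Real.pi_lt_d2])
  have hle : min δ 1 / 7 ≤ min δ 1 :=
    ENNReal.div_le_of_le_mul (le_mul_of_one_le_right zero_le (by norm_num))
  have h3 : x ^ 2 ≤ x := by
    rw [sq]
    exact mul_le_of_le_one_right zero_le (hx.le.trans (hle.trans (min_le_right _ _)))
  calc ENNReal.ofReal (2 * Real.pi) * x ^ 2 ≤ 7 * x := by gcongr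
    _ < 7 * (min δ 1 / 7) := by
      rw [ENNReal.mul_lt_mul_iff_right (by norm_num) (by norm_num)]; exact hx
    _ = min δ 1 := ENNReal.mul_div_cancel (by norm_num) (by norm_num)
    _ ≤ δ := min_le_left _ _

namespace StepFn

/-- The sum of two step functions. -/
def add (u u' : StepFn T) : StepFn T where
  n := u.n + u'.n
  x := Fin.append u.x u'.x
  y := Fin.append u.y u'.y
  v := Fin.append u.v u'.v
  lower i := by
    refine Fin.addCases (fun i => ?_) (fun i => ?_) i
    · simpa using u.lower i
    · simpa using u'.lower i
  ordered i := by
    refine Fin.addCases (fun i => ?_) (fun i => ?_) i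
    · simpa using u.ordered i
    · simpa using u'.ordered i
  upper i := by
    refine Fin.addCases (fun i => ?_) (fun i => ?_) i
    · simpa using u.upper i
    · simpa using u'.upper i

/-- A scalar multiple of a step function. -/
def smul (c : ℂ) (u : StepFn T) : StepFn T where
  n := u.n
  x := u.x
  y := u.y
  v := fun i => c • u.v i
  lower := u.lower
  ordered := u.ordered
  upper := u.upper

/-- The zero step function. -/
def zero (T : ℕ) : StepFn T where
  n := 0
  x := Fin.elim0
  y := Fin.elim0
  v := Fin.elim0
  lower i := i.elim0
  ordered i := i.elim0
  upper i := i.elim0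

/-- The step function `1_{[x, y)} v`. -/
def single {x y : ℝ} (h1 : -Real.pi ≤ x) (h2 : x ≤ y) (h3 : y ≤ Real.pi) (v : Fin T → ℂ) :
    StepFn T where
  n := 1
  x _ := x
  y _ := y
  v _ := v
  lower _ := h1
  ordered _ := h2
  upper _ := h3

lemma eval_add (u u' : StepFn T) : (u.add u').eval = fun t => u.eval t + u'.eval t := by
  funext t
  refine (Fin.sum_univ_add (a := u.n) (b := u'.n) _).trans ?_
  simp only [eval, add, Fin.append_left, Fin.append_right]

lemma eval_smul (c : ℂ) (u : StepFn T) : (u.smul c).eval = fun t => c • u.eval t := by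
  funext t
  simp only [eval, smul, Finset.smul_sum]
  refine Finset.sum_congr rfl fun i _ => ?_
  by_cases h : t ∈ Set.Ico (u.x i) (u.y i) <;> simp [h]

lemma eval_zero : (zero T).eval = fun _ => 0 := by
  funext t
  simp [eval, zero]

lemma integral_add {Ω : Type*} (u u' : StepFn T) (Z : ℝ → Fin T → Ω → ℂ) :
    (u.add u').integral Z = fun ω => u.integral Z ω + u'.integral Z ω := by
  funext ω
  refine (Fin.sum_univ_add (a := u.n) (b := u'.n) _).trans ?_
  simp only [integral, add, Fin.append_left, Fin.append_right]

lemma integral_smul {Ω : Type*} (c : ℂ) (u : StepFn T) (Z : ℝ → Fin T → Ω → ℂ) :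
    (u.smul c).integral Z = fun ω => c * u.integral Z ω := by
  funext ω
  simp only [integral, Finset.mul_sum, ← mul_assoc]
  rfl

lemma integral_zero {Ω : Type*} (Z : ℝ → Fin T → Ω → ℂ) :
    (zero T).integral Z = fun _ => 0 := by
  funext ω
  simp [integral, zero]

lemma memLp_integral {Ω : Type*} [MeasurableSpace Ω] {P : Measure Ω} {Z : ℝ → Fin T → Ω → ℂ}
    (hZ : ∀ t ∈ Set.Icc (-Real.pi) Real.pi, ∀ p, MemLp (Z t p) 2 P) (u : StepFn T) :
    MemLp (u.integral Z) 2 P := by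
  unfold integral
  refine memLp_finsetSum _ fun i _ => memLp_finsetSum _ fun p _ => ?_
  exact ((hZ _ ⟨(u.lower i).trans (u.ordered i), u.upper i⟩ p).sub
    (hZ _ ⟨u.lower i, (u.ordered i).trans (u.upper i)⟩ p)).const_mul _

lemma eval_eq_sum (u : StepFn T) : u.eval = fun t => ∑ i, ∑ p,
    u.v i p • (Pi.single p ((Set.Ico (u.x i) (u.y i)).indicator (fun _ => (1 : ℂ)) t) :
      Fin T → ℂ) := by
  funext t
  unfold StepFn.eval
  refine Finset.sum_congr rfl fun i _ => ?_
  ext q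
  by_cases h : t ∈ Set.Ico (u.x i) (u.y i) <;>
    simp [h, Finset.sum_apply, Pi.single_apply]

end StepFn

namespace IsRoot

lemma memL2_indicator (hS : IsRoot f S) (x y : ℝ) (p : Fin T) :
    MemL2 f (fun t => Pi.single p ((Set.Ico x y).indicator (fun _ => (1 : ℂ)) t)) := by
  refine hS.memL2_single p ((measurable_const.indicator measurableSet_Ico).aestronglyMeasurable)
    (K := 1) fun t => ?_
  by_cases h : t ∈ Set.Ico x y <;> simp [h]

lemma memL2_eval_and_vec_eval (hS : IsRoot f S) (u : StepFn T) : MemL2 f u.eval ∧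
    vec S u.eval = ∑ i, ∑ p, u.v i p •
      vec S (fun t => Pi.single p ((Set.Ico (u.x i) (u.y i)).indicator (fun _ => (1 : ℂ)) t)) := by
  have h1 : ∀ i, _ := fun i => hS.memL2_sum_and_vec_sum Finset.univ fun p =>
    hS.memL2_smul (hS.memL2_indicator (u.x i) (u.y i) p) (u.v i p)
  have h2 := hS.memL2_sum_and_vec_sum Finset.univ fun i => (h1 i).1
  rw [StepFn.eval_eq_sum]
  refine ⟨h2.1, h2.2.trans (Finset.sum_congr rfl fun i _ => (h1 i).2.trans
    (Finset.sum_congr rfl fun p _ => ?_))⟩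
  rw [hS.vec_smul (hS.memL2_indicator _ _ p)]

/-- The graph of the elementary stochastic integral: the pairs `(u, ∫ uᵀ dZ)` for step functions
`u`, in coordinates. -/
def stepGraph (hS : IsRoot f S) {Ω : Type*} [MeasurableSpace Ω] {P : Measure Ω}
    {Z : ℝ → Fin T → Ω → ℂ}
    (hZ : ∀ t ∈ Set.Icc (-Real.pi) Real.pi, ∀ p, MemLp (Z t p) 2 P) :
    Submodule ℂ (VecL2 T × Lp ℂ 2 P) where
  carrier := {w | ∃ u : StepFn T, w = (vec S u.eval, (u.memLp_integral hZ).toLp _)}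
  add_mem' := by
    rintro _ _ ⟨u, rfl⟩ ⟨u', rfl⟩
    refine ⟨u.add u', Prod.ext ?_ ?_⟩
    · simp only [StepFn.eval_add, Prod.fst_add]
      exact (hS.vec_add (hS.memL2_eval_and_vec_eval u).1 (hS.memL2_eval_and_vec_eval u').1).symm
    · simp only [Prod.snd_add]
      rw [← MemLp.toLp_add]
      exact MemLp.toLp_congr _ _ (by rw [StepFn.integral_add]; rfl)
  zero_mem' := by
    refine ⟨StepFn.zero T, Prod.ext ?_ ?_⟩
    · simp only [StepFn.eval_zero, hS.vec_zero, Prod.fst_zero]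
    · symm
      rw [Prod.snd_zero, Lp.eq_zero_iff_ae_eq_zero]
      refine ((StepFn.zero T).memLp_integral hZ).coeFn_toLp.trans ?_
      rw [StepFn.integral_zero]; rfl
  smul_mem' := by
    rintro c _ ⟨u, rfl⟩
    refine ⟨u.smul c, Prod.ext ?_ ?_⟩
    · simp only [StepFn.eval_smul, Prod.smul_fst]
      exact (hS.vec_smul (hS.memL2_eval_and_vec_eval u).1 c).symm
    · simp only [Prod.smul_snd]
      rw [← MemLp.toLp_const_smul]
      exact MemLp.toLp_congr _ _ (by rw [StepFn.integral_smul]; rfl)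

/-- The stochastic integral is the closure of the elementary one. -/
lemma hasStochIntegral_iff (hS : IsRoot f S) {Ω : Type*} [MeasurableSpace Ω] {P : Measure Ω}
    {Z : ℝ → Fin T → Ω → ℂ}
    (hZ : ∀ t ∈ Set.Icc (-Real.pi) Real.pi, ∀ p, MemLp (Z t p) 2 P)
    {g : ℝ → Fin T → ℂ} (hg : MemL2 f g) {Y : Ω → ℂ} {y : Lp ℂ 2 P} (hY : y =ᵐ[P] Y) :
    HasStochIntegral P f Z g Y ↔ (vec S g, y) ∈ (hS.stepGraph hZ).topologicalClosure := by
  have hYm : MemLp Y 2 P := (memLp_congr_ae hY).1 (Lp.memLp y)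
  have h1 : ∀ u : StepFn T, normSqL2 f (fun t => g t - u.eval t) =
      ENNReal.ofReal (2 * Real.pi) * edist (vec S g) (vec S u.eval) ^ 2 := by
    intro u
    have hu := (hS.memL2_eval_and_vec_eval u).1
    rw [hS.normSqL2_eq_vec (hS.memL2_sub hg hu), hS.vec_sub hg hu, edist_eq_enorm_sub]
  have h2 : ∀ u : StepFn T, eLpNorm (fun ω => Y ω - u.integral Z ω) 2 P =
      edist y ((u.memLp_integral hZ).toLp _) := by
    intro u
    rw [Lp.edist_def]
    refine eLpNorm_congr_ae ?_
    filter_upwards [hY, (u.memLp_integral hZ).coeFn_toLp] with ω h3 h4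
    rw [Pi.sub_apply, h3, h4]
  have hc0 : ENNReal.ofReal (2 * Real.pi) ≠ 0 := (ENNReal.ofReal_pos.2 Real.two_pi_pos).ne'
  rw [← SetLike.mem_coe, Submodule.topologicalClosure_coe, EMetric.mem_closure_iff]
  constructor
  · rintro ⟨-, -, h⟩ ε hε
    obtain ⟨u, hu1, hu2⟩ := h (min ε (ENNReal.ofReal (2 * Real.pi) * ε ^ 2))
      (lt_min hε (pos_iff_ne_zero.2 (mul_ne_zero hc0 (pow_ne_zero _ hε.ne'))))
    refine ⟨_, ⟨u, rfl⟩, max_lt ?_ ?_⟩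
    · have h3 := hu1.trans_le (min_le_right _ _)
      rw [h1, ENNReal.mul_lt_mul_iff_right hc0 ENNReal.ofReal_ne_top] at h3
      exact lt_of_pow_lt_pow_left' 2 h3
    · rw [← h2]
      exact hu2.trans_le (min_le_left _ _)
  · intro h
    refine ⟨hg, hYm, fun δ hδ => ?_⟩
    obtain ⟨_, ⟨u, rfl⟩, hu⟩ := h (min δ 1 / 7)
      (ENNReal.div_pos (lt_min hδ one_pos).ne' (by norm_num))
    obtain ⟨hu1, hu2⟩ := max_lt_iff.1 hu
    refine ⟨u, by rw [h1]; exact two_pi_mul_sq_lt hu1, ?_⟩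
    rw [h2]
    exact hu2.trans_le ((ENNReal.div_le_of_le_mul (le_mul_of_one_le_right zero_le
      (by norm_num))).trans (min_le_left _ _))

/-- If the stochastic integral with respect to `Z` agrees with an isometry on a total set, then it
agrees with it everywhere. -/
lemma hasStochIntegral_of_dense (hS : IsRoot f S) {Ω : Type*} [MeasurableSpace Ω]
    {P : Measure Ω} {Z : ℝ → Fin T → Ω → ℂ}
    (hZ : ∀ t ∈ Set.Icc (-Real.pi) Real.pi, ∀ p, MemLp (Z t p) 2 P)
    (U : VecL2 T →ₗᵢ[ℂ] Lp ℂ 2 P) {D : Set (VecL2 T)}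
    (hD : (Submodule.span ℂ D).topologicalClosure = ⊤)
    (h : ∀ x ∈ D, (x, U x) ∈ (hS.stepGraph hZ).topologicalClosure)
    {g : ℝ → Fin T → ℂ} (hg : MemL2 f g) {Y : Ω → ℂ} (hY : U (vec S g) =ᵐ[P] Y) :
    HasStochIntegral P f Z g Y := by
  rw [hS.hasStochIntegral_iff hZ hg hY]
  let L : VecL2 T →L[ℂ] VecL2 T × Lp ℂ 2 P :=
    (ContinuousLinearMap.id ℂ _).prod U.toContinuousLinearMap
  have hle : (Submodule.span ℂ D).topologicalClosure ≤
      (hS.stepGraph hZ).topologicalClosure.comap L.toLinearMap := by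
    refine Submodule.topologicalClosure_minimal _ (Submodule.span_le.2 fun x hx => h x hx) ?_
    exact (hS.stepGraph hZ).isClosed_topologicalClosure.preimage L.continuous
  exact hle (hD ▸ Submodule.mem_top)

lemma span_step_dense (hS : IsRoot f S) :
    (Submodule.span ℂ (Set.range fun u : StepFn T => vec S u.eval)).topologicalClosure = ⊤ := by
  rw [Submodule.topologicalClosure_eq_top_iff, Submodule.eq_bot_iff]
  intro x hx
  refine hS.eq_zero_of_conjTranspose_mulVec fun p => ?_
  refine ae_eq_zero_of_forall_Ico (hS.integrable_conjTranspose_mulVec x p) fun a b h1 h2 h3 => ?_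
  have h := (Submodule.mem_orthogonal _ _).1 hx _
    (Submodule.subset_span ⟨StepFn.single h1 h2 h3 (Pi.single p 1), rfl⟩)
  have he : (StepFn.single h1 h2 h3 (Pi.single p 1)).eval =
      fun t => (Pi.single p ((Set.Ico a b).indicator (fun _ => (1 : ℂ)) t) : Fin T → ℂ) := by
    funext t
    refine (Fin.sum_univ_one _).trans ?_
    by_cases ht : t ∈ Set.Ico a b <;> simp [StepFn.single, ht]
  simp only [he] at h
  rw [hS.inner_vec_single (hS.memL2_indicator a b p)] at h
  rw [← h, ← integral_indicator measurableSet_Ico]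
  refine integral_congr_ae (Eventually.of_forall fun t => ?_)
  by_cases ht : t ∈ Set.Ico a b <;> simp [ht]

/-- The spectral process is the image of the indicator functions `1_{[-π, t)} δ_p` under the
spectral isometry. -/
lemma exists_isSpectralProcess (hS : IsRoot f S) (hs : ∀ i, 0 < s i) {d : Fin r → ℕ}
    {Ω : Type*} [MeasurableSpace Ω] {P : Measure Ω} {ξ : ℤ → Fin T → Ω → ℂ}
    {U : VecL2 T →ₗᵢ[ℂ] Lp ℂ 2 P} (hU : ∀ ν, AdmissibleStep ν → ∀ m p,
      U (vec S (gen s d ν m p)) =ᵐ[P] increment s d ν ξ m p) :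
    ∃ Z, IsSpectralProcess P s d ξ f Z := by
  let I : ℝ → ℝ → Fin T → ℝ → Fin T → ℂ := fun x y p t =>
    Pi.single p ((Set.Ico x y).indicator (fun _ => (1 : ℂ)) t)
  have hI : ∀ x y p, MemL2 f (I x y p) := fun x y p => hS.memL2_indicator x y p
  let Z : ℝ → Fin T → Ω → ℂ := fun t p => U (vec S (I (-Real.pi) t p))
  have hZ : ∀ t ∈ Set.Icc (-Real.pi) Real.pi, ∀ p, MemLp (Z t p) 2 P := fun t _ p => Lp.memLp _
  have hinc : ∀ x y : ℝ, -Real.pi ≤ x → x ≤ y → ∀ p,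
      U (vec S (I x y p)) =ᵐ[P] fun ω => Z y p ω - Z x p ω := by
    intro x y h1 h2 p
    have h3 : I x y p = fun t => I (-Real.pi) y p t - I (-Real.pi) x p t := by
      funext t
      simp only [I, ← Pi.single_sub]
      congr 1
      simp only [Set.indicator, Set.mem_Ico]
      grind
    rw [h3, hS.vec_sub (hI _ _ p) (hI _ _ p), map_sub]
    exact Lp.coeFn_sub _ _
  refine ⟨Z, hZ, ?_, ?_⟩
  · intro x y x' y' h1 h2 h3 h1' h2' h3' p q
    have h4 : ∫ ω, (Z y p ω - Z x p ω) * conj (Z y' q ω - Z x' q ω) ∂P =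
        inner ℂ (U (vec S (I x' y' q))) (U (vec S (I x y p))) := by
      rw [L2.inner_def]
      refine integral_congr_ae ?_
      filter_upwards [hinc x y h1 h2 p, hinc x' y' h1' h2' q] with ω h5 h6
      rw [h5, h6, RCLike.inner_apply]
    rw [h4, LinearIsometry.inner_map_map, hS.inner_vec (hI _ _ _) (hI _ _ _)]
    congr 1
    have hm : MeasurableSet (Set.Ico x y ∩ Set.Ico x' y') :=
      measurableSet_Ico.inter measurableSet_Ico
    have hsub : Set.Ico x y ∩ Set.Ico x' y' ⊆ Set.Ico (-Real.pi) Real.pi := fun t ht =>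
      ⟨h1.trans ht.1.1, ht.1.2.trans_le h3⟩
    have hIco : circ = volume.restrict (Set.Ico (-Real.pi) Real.pi) :=
      (restrict_Ico_eq_restrict_Ioc).symm
    have h5 : ∀ t, I x y p t ⬝ᵥ (f t *ᵥ star (I x' y' q t)) =
        (Set.Ico x y ∩ Set.Ico x' y').indicator (fun t => f t p q) t := by
      intro t
      simp only [I, ← Pi.single_star, single_dotProduct, Matrix.mulVec_single]
      by_cases ha : t ∈ Set.Ico x y <;> by_cases hb : t ∈ Set.Ico x' y' <;> simp [ha, hb]
    simp only [h5]
    rw [integral_indicator hm, hIco, Measure.restrict_restrict hm, Set.inter_eq_left.2 hsub]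
  · intro ν hν m p
    refine hS.hasStochIntegral_of_dense hZ U hS.span_step_dense ?_ (hS.memL2_gen hs d ν m p)
      (hU ν hν m p)
    rintro _ ⟨u, rfl⟩
    refine Submodule.le_topologicalClosure _ ⟨u, Prod.ext rfl (Lp.ext ?_)⟩
    refine EventuallyEq.trans ?_ (u.memLp_integral hZ).coeFn_toLp.symm
    simp only [(hS.memL2_eval_and_vec_eval u).2, map_sum, map_smul]
    refine (Lp.coeFn_fun_finsetSum _ _).trans ?_
    have h6 : ∀ᵐ ω ∂P, ∀ i, (∑ p, u.v i p • U (vec S (I (u.x i) (u.y i) p)) : Lp ℂ 2 P) ω =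
        ∑ p, u.v i p * (Z (u.y i) p ω - Z (u.x i) p ω) := by
      refine eventually_all.2 fun i => ?_
      filter_upwards [Lp.coeFn_fun_finsetSum Finset.univ
        (fun p => u.v i p • U (vec S (I (u.x i) (u.y i) p))),
        eventually_all.2 fun p => hinc (u.x i) (u.y i) (u.lower i) (u.ordered i) p,
        eventually_all.2 fun p => Lp.coeFn_smul (u.v i p) (U (vec S (I (u.x i) (u.y i) p)))]
        with ω h7 h8 h9
      rw [h7]
      refine Finset.sum_congr rfl fun p _ => ?_
      rw [h9, Pi.smul_apply, h8, smul_eq_mul]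
    filter_upwards [h6] with ω h7
    exact Finset.sum_congr rfl fun i _ => h7 i

/-- For every spectral process the stochastic integral is the spectral isometry. -/
lemma hasStochIntegral (hS : IsRoot f S) (hs : ∀ i, 0 < s i) {d : Fin r → ℕ}
    {Ω : Type*} [MeasurableSpace Ω] {P : Measure Ω} {ξ : ℤ → Fin T → Ω → ℂ}
    {U : VecL2 T →ₗᵢ[ℂ] Lp ℂ 2 P} (hU : ∀ ν, AdmissibleStep ν → ∀ m p,
      U (vec S (gen s d ν m p)) =ᵐ[P] increment s d ν ξ m p)
    {Z : ℝ → Fin T → Ω → ℂ} (hZ : IsSpectralProcess P s d ξ f Z)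
    {g : ℝ → Fin T → ℂ} (hg : MemL2 f g) {Y : Ω → ℂ} (hY : U (vec S g) =ᵐ[P] Y) :
    HasStochIntegral P f Z g Y := by
  have h1 : AdmissibleStep (fun _ : Fin r => (1 : ℤ)) := Or.inl fun _ => one_pos
  refine hS.hasStochIntegral_of_dense hZ.memLp U (hS.span_gen_dense hs d h1.ne_zero) ?_ hg hY
  rintro _ ⟨⟨m, p⟩, rfl⟩
  exact (hS.hasStochIntegral_iff hZ.memLp (hS.memL2_gen hs d _ m p) (hU _ h1 m p)).1
    (hZ.representation _ h1 m p)

end IsRoot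

end

/-! ### The past in the frequency domain and the projection problem -/

/-- The closed span of the functions `e^{ikλ} χ_ν(e^{-iλ}) β(iλ)⁻¹ δ_p`, `k ≤ m`, in coordinates. -/
def past {r T : ℕ} (S : ℝ → Matrix (Fin T) (Fin T) ℂ) (s d : Fin r → ℕ) (ν : Fin r → ℤ) (m : ℤ) :
    Submodule ℂ (VecL2 T) :=
  (Submodule.span ℂ {x | ∃ k ≤ m, ∃ p, x = vec S (gen s d ν k p)}).topologicalClosure

section

variable {T : ℕ} {f S : ℝ → Matrix (Fin T) (Fin T) ℂ} {r : ℕ} {s d : Fin r → ℕ} {μ : Fin r → ℕ}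
  {ν : Fin r → ℤ}

lemma isClosed_past (m : ℤ) : IsClosed (past S s d ν m : Set (VecL2 T)) :=
  Submodule.isClosed_topologicalClosure _

lemma vec_gen_mem_past {k m : ℤ} (h : k ≤ m) (p : Fin T) :
    vec S (gen s d ν k p) ∈ past S s d ν m :=
  Submodule.le_topologicalClosure _ (Submodule.subset_span ⟨k, h, p, rfl⟩)

lemma past_le {m : ℤ} {K : Submodule ℂ (VecL2 T)} (hK : IsClosed (K : Set (VecL2 T)))
    (h : ∀ k ≤ m, ∀ p, vec S (gen s d ν k p) ∈ K) : past S s d ν m ≤ K := by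
  refine Submodule.topologicalClosure_minimal _ (Submodule.span_le.2 ?_) hK
  rintro _ ⟨k, hk, p, rfl⟩
  exact h k hk p

lemma past_mono {m m' : ℤ} (h : m ≤ m') : past S s d ν m ≤ past S s d ν m' :=
  past_le (isClosed_past m') fun _ hk p => vec_gen_mem_past (hk.trans h) p

lemma exists_projection_past (m : ℤ) (x : VecL2 T) :
    ∃ y ∈ past S s d ν m, ∀ z ∈ past S s d ν m, inner ℂ z (x - y) = 0 := by
  have : CompleteSpace (past S s d ν m) := (isClosed_past m).completeSpace_coe
  exact ⟨(past S s d ν m).starProjection x, Submodule.starProjection_apply_mem _ _,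
    fun z hz => (Submodule.mem_orthogonal _ _).1
      (Submodule.sub_starProjection_mem_orthogonal x) z hz⟩

lemma inner_past_eq_zero {m : ℤ} {e : VecL2 T}
    (h : ∀ k ≤ m, ∀ p, inner ℂ (vec S (gen s d ν k p)) e = 0) :
    ∀ z ∈ past S s d ν m, inner ℂ z e = 0 := by
  have hle : past S s d ν m ≤ (Submodule.span ℂ {e})ᗮ := by
    refine past_le (Submodule.isClosed_orthogonal _) fun k hk p => ?_
    rw [Submodule.mem_orthogonal_singleton_iff_inner_left]
    exact h k hk p
  intro z hz
  exact (Submodule.mem_orthogonal_singleton_iff_inner_left).1 (hle hz)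

namespace IsRoot

lemma vec_trigPolynomial (hS : IsRoot f S) (hs : ∀ i, 0 < s i) {ι : Type*} (I : Finset ι)
    (j : ι → ℤ) (u : ι → Fin T → ℂ) :
    MemL2 f (fun t => ratio s d ν t • ∑ k ∈ I, ex (j k) t • u k) ∧
    vec S (fun t => ratio s d ν t • ∑ k ∈ I, ex (j k) t • u k) =
      ∑ k ∈ I, ∑ p, u k p • vec S (gen s d ν (j k) p) := by
  have h : (fun t => ratio s d ν t • ∑ k ∈ I, ex (j k) t • u k) =
      fun t => ∑ k ∈ I, ∑ p, u k p • gen s d ν (j k) p t := by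
    funext t
    rw [Finset.smul_sum]
    refine Finset.sum_congr rfl fun k _ => ?_
    ext q
    simp only [gen, Pi.smul_apply, smul_eq_mul, Finset.sum_apply, Pi.single_apply]
    simp
    ring
  have h1 : ∀ k, _ := fun k => hS.memL2_sum_and_vec_sum Finset.univ fun p =>
    hS.memL2_smul (hS.memL2_gen hs d ν (j k) p) (u k p)
  have h2 := hS.memL2_sum_and_vec_sum I fun k => (h1 k).1
  rw [h]
  refine ⟨h2.1, h2.2.trans (Finset.sum_congr rfl fun k _ => (h1 k).2.trans
    (Finset.sum_congr rfl fun p _ => ?_))⟩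
  rw [hS.vec_smul (hS.memL2_gen hs d ν _ p)]

lemma memL2Minus_iff (hS : IsRoot f S) (hs : ∀ i, 0 < s i) {h : ℝ → Fin T → ℂ} :
    MemL2Minus s d μ f h ↔
      MemL2 f h ∧ vec S h ∈ past S s d (fun i => (μ i : ℤ)) (-1) := by
  set ν : Fin r → ℤ := fun i => (μ i : ℤ)
  set D : Set (VecL2 T) := {x | ∃ (n : ℕ) (u : ℕ → Fin T → ℂ),
    x = ∑ k ∈ Finset.Icc 1 n, ∑ p, u k p • vec S (gen s d ν (-(k : ℤ)) p)} with hD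
  have hspan : (Submodule.span ℂ {x | ∃ k ≤ (-1 : ℤ), ∃ p, x = vec S (gen s d ν k p)} :
      Set (VecL2 T)) = D := by
    apply Set.Subset.antisymm
    · intro x hx
      -- the induction carries coefficients of finite support
      suffices H : ∃ (n : ℕ) (u : ℕ → Fin T → ℂ), ∀ n' ≥ n,
          x = ∑ k ∈ Finset.Icc 1 n', ∑ p, u k p • vec S (gen s d ν (-(k : ℤ)) p) by
        obtain ⟨n, u, hu⟩ := H
        exact ⟨n, u, hu n le_rfl⟩
      induction hx using Submodule.span_induction with
      | mem x hx =>
        obtain ⟨k, hk, p, rfl⟩ := hx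
        obtain ⟨j, rfl⟩ : ∃ j : ℕ, k = -(j : ℤ) := ⟨k.natAbs, by omega⟩
        refine ⟨j, Pi.single j (Pi.single p 1), fun n' hn' => ?_⟩
        rw [Finset.sum_eq_single j, Finset.sum_eq_single p]
        · simp
        · intro q _ hq
          simp [hq]
        · simp
        · intro k _ hk
          simp [hk]
        · intro hj
          exact absurd (Finset.mem_Icc.2 ⟨by omega, hn'⟩) hj
      | zero => exact ⟨0, 0, fun n' _ => by simp⟩
      | add x y _ _ hx hy =>
        obtain ⟨n, u, hu⟩ := hx
        obtain ⟨n₂, u₂, hu₂⟩ := hy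
        refine ⟨max n n₂, u + u₂, fun n' hn' => ?_⟩
        rw [hu n' ((le_max_left _ _).trans hn'), hu₂ n' ((le_max_right _ _).trans hn')]
        simp only [Pi.add_apply, add_smul, Finset.sum_add_distrib]
      | smul c x _ hx =>
        obtain ⟨n, u, hu⟩ := hx
        refine ⟨n, c • u, fun n' hn' => ?_⟩
        rw [hu n' hn']
        simp only [Pi.smul_apply, smul_assoc, Finset.smul_sum]
    · rintro _ ⟨n, u, rfl⟩
      refine Submodule.sum_mem _ fun k hk => Submodule.sum_mem _ fun p _ =>
        Submodule.smul_mem _ _ (Submodule.subset_span ⟨_, ?_, p, rfl⟩)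
      have := (Finset.mem_Icc.1 hk).1
      omega
  refine and_congr_right fun hh => ?_
  have h1 : ∀ (n : ℕ) (u : ℕ → Fin T → ℂ), normSqL2 f (fun t => h t - ratio s d ν t •
      ∑ k ∈ Finset.Icc 1 n, ex (-(k : ℤ)) t • u k) = ENNReal.ofReal (2 * Real.pi) *
        edist (vec S h) (∑ k ∈ Finset.Icc 1 n, ∑ p, u k p • vec S (gen s d ν (-(k : ℤ)) p)) ^ 2 := by
    intro n u
    have h2 := hS.vec_trigPolynomial (d := d) (ν := ν) hs (Finset.Icc 1 n)
      (fun k : ℕ => -(k : ℤ)) u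
    rw [hS.normSqL2_eq_vec (hS.memL2_sub hh h2.1), hS.vec_sub hh h2.1, h2.2, edist_eq_enorm_sub]
  have hc0 : ENNReal.ofReal (2 * Real.pi) ≠ 0 := (ENNReal.ofReal_pos.2 Real.two_pi_pos).ne'
  rw [past, ← SetLike.mem_coe, Submodule.topologicalClosure_coe, hspan, EMetric.mem_closure_iff]
  constructor
  · intro H ε hε
    obtain ⟨n, u, hu⟩ := H (ENNReal.ofReal (2 * Real.pi) * ε ^ 2)
      (pos_iff_ne_zero.2 (mul_ne_zero hc0 (pow_ne_zero _ hε.ne')))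
    refine ⟨_, ⟨n, u, rfl⟩, ?_⟩
    rw [h1, ENNReal.mul_lt_mul_iff_right hc0 ENNReal.ofReal_ne_top] at hu
    exact lt_of_pow_lt_pow_left' 2 hu
  · intro H δ hδ
    obtain ⟨_, ⟨n, u, rfl⟩, hu⟩ := H (min δ 1 / 7)
      (ENNReal.div_pos (lt_min hδ one_pos).ne' (by norm_num))
    exact ⟨n, u, by rw [h1]; exact two_pi_mul_sq_lt hu⟩

end IsRoot

section estimate

variable {Ω : Type*} [MeasurableSpace Ω] {P : Measure Ω} {ξ : ℤ → Fin T → Ω → ℂ}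
  {U : VecL2 T →ₗᵢ[ℂ] Lp ℂ 2 P}

/-- The spectral isometry carries the past in the frequency domain onto the past of the
increments. -/
lemma pastSpace_eq_map (hμ : ∀ i, 0 < μ i) (hU : ∀ ν, AdmissibleStep ν → ∀ m p,
      U (vec S (gen s d ν m p)) =ᵐ[P] increment s d ν ξ m p) (m : ℤ) :
    pastSpace P (increment s d (fun i => (μ i : ℤ)) ξ) m =
      (past S s d (fun i => (μ i : ℤ)) m).map U.toLinearMap := by
  have hν := admissibleStep_natCast hμ
  apply le_antisymm
  · refine Submodule.topologicalClosure_minimal _ (Submodule.span_le.2 ?_) ?_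
    · rintro g ⟨⟨⟨k, hk⟩, p⟩, hg⟩
      exact ⟨_, vec_gen_mem_past hk p, Lp.ext ((hU _ hν k p).trans hg.symm)⟩
    · exact U.isometry.isClosedEmbedding.isClosedMap _ (isClosed_past m)
  · rw [Submodule.map_le_iff_le_comap]
    refine past_le ((Submodule.isClosed_topologicalClosure _).preimage U.continuous)
      fun k hk p => ?_
    exact Submodule.le_topologicalClosure _ (Submodule.subset_span ⟨(⟨k, hk⟩, p), hU _ hν k p⟩)

lemma map_sum_gen_ae_eq (hμ : ∀ i, 0 < μ i) (hU : ∀ ν, AdmissibleStep ν → ∀ m p,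
      U (vec S (gen s d ν m p)) =ᵐ[P] increment s d ν ξ m p) (a : ℕ → Fin T → ℂ) (N : ℕ) :
    U (∑ k ∈ Finset.range (N + 1), ∑ p, bN s d μ a N k p •
        vec S (gen s d (fun i => (μ i : ℤ)) (k : ℤ) p)) =ᵐ[P] functionalB s d μ a N ξ := by
  have hν := admissibleStep_natCast hμ
  simp only [map_sum, map_smul]
  refine (Lp.coeFn_fun_finsetSum _ _).trans ?_
  have h : ∀ᵐ ω ∂P, ∀ k : ℕ, (∑ p, bN s d μ a N k p •
      U (vec S (gen s d (fun i => (μ i : ℤ)) (k : ℤ) p)) : Lp ℂ 2 P) ω =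
      ∑ p, bN s d μ a N k p * increment s d (fun i => (μ i : ℤ)) ξ k p ω := by
    refine ae_all_iff.2 fun k => ?_
    filter_upwards [Lp.coeFn_fun_finsetSum Finset.univ (fun p => bN s d μ a N k p •
        U (vec S (gen s d (fun i => (μ i : ℤ)) (k : ℤ) p))),
      eventually_all.2 fun p => hU _ hν (k : ℤ) p,
      eventually_all.2 fun p => Lp.coeFn_smul (bN s d μ a N k p)
        (U (vec S (gen s d (fun i => (μ i : ℤ)) (k : ℤ) p)))] with ω h1 h2 h3
    rw [h1]
    refine Finset.sum_congr rfl fun p _ => ?_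
    rw [h3, Pi.smul_apply, h2, smul_eq_mul]
  filter_upwards [h] with ω h1
  exact Finset.sum_congr rfl fun k _ => h1 k

lemma mse_eq (hs : ∀ i, 0 < s i) (hμ : ∀ i, 0 < μ i) (a : ℕ → Fin T → ℂ) (N : ℕ)
    {x₀ x : VecL2 T} (hx₀ : U x₀ =ᵐ[P] functionalB s d μ a N ξ) {Y : Ω → ℂ}
    (hY : Y =ᵐ[P] fun ω => U x ω - functionalV s d μ a N ξ ω) :
    mse P ξ a N Y = ‖x₀ - x‖ₑ ^ 2 := by
  have h : ‖x₀ - x‖ₑ = ‖U x₀ - U x‖ₑ := by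
    rw [← map_sub, ← ofReal_norm, ← ofReal_norm, LinearIsometry.norm_map]
  rw [h, Lp.enorm_def, eLpNorm_two_sq, mse]
  refine lintegral_congr_ae ?_
  filter_upwards [hx₀, hY, Lp.coeFn_sub (U x₀) (U x)] with ω h1 h2 h3
  rw [h3, Pi.sub_apply, h1, h2, ← functionalA_add_functionalV d hs hμ]
  congr 2
  ring

/-- The forecasting problem is solved by any `h` in `L₂^{0-}(f)` for which the error
`B_N χ_μ / β - h` is orthogonal to `L₂^{0-}(f)`, the mean square error being the squared norm of this
error. -/
lemma solvesForecast (hS : IsRoot f S) (hs : ∀ i, 0 < s i) (hμ : ∀ i, 0 < μ i)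
    (hU : ∀ ν, AdmissibleStep ν → ∀ m p,
      U (vec S (gen s d ν m p)) =ᵐ[P] increment s d ν ξ m p)
    {Z : ℝ → Fin T → Ω → ℂ} (hZ : IsSpectralProcess P s d ξ f Z)
    (a : ℕ → Fin T → ℂ) (N : ℕ) {h : ℝ → Fin T → ℂ} (hh : MemL2 f h) {e : VecL2 T}
    (he : vec S h = vec S (fun t => ratio s d (fun i => (μ i : ℤ)) t • BN s d μ a N t) - e)
    (hpast : vec S h ∈ past S s d (fun i => (μ i : ℤ)) (-1))
    (horth : ∀ z ∈ past S s d (fun i => (μ i : ℤ)) (-1), inner ℂ z e = 0) {Δ : ℂ}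
    (hΔ : Δ = ((‖e‖ ^ 2 : ℝ) : ℂ)) :
    SolvesForecast P s d μ ξ f Z a N h Δ := by
  obtain ⟨hB, hBvec⟩ := hS.vec_trigPolynomial (d := d) (ν := fun i => (μ i : ℤ)) hs
    (Finset.range (N + 1)) (fun k : ℕ => (k : ℤ)) (bN s d μ a N)
  set x₀ := vec S (fun t => ratio s d (fun i => (μ i : ℤ)) t • BN s d μ a N t) with hx₀def
  have hx₀ : U x₀ =ᵐ[P] functionalB s d μ a N ξ := by
    have h1 := map_sum_gen_ae_eq hμ hU a N
    rw [← hBvec] at h1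
    exact h1
  have he' : x₀ - vec S h = e := by rw [he, sub_sub_cancel]
  have hpyth : ∀ x ∈ past S s d (fun i => (μ i : ℤ)) (-1),
      ‖x₀ - x‖ ^ 2 = ‖e‖ ^ 2 + ‖vec S h - x‖ ^ 2 := by
    intro x hx
    have h1 : x₀ - x = (vec S h - x) + e := by rw [← he']; abel
    have h2 : inner ℂ (vec S h - x) e = 0 := horth _ (Submodule.sub_mem _ hpast hx)
    have h3 := norm_add_sq_eq_norm_sq_add_norm_sq_of_inner_eq_zero (𝕜 := ℂ) (vec S h - x) e h2
    rw [h1, sq, h3]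
    ring
  have hmin : ∀ x ∈ past S s d (fun i => (μ i : ℤ)) (-1), ‖e‖ₑ ≤ ‖x₀ - x‖ₑ := by
    intro x hx
    rw [← ofReal_norm, ← ofReal_norm]
    refine ENNReal.ofReal_le_ofReal (le_of_sq_le_sq ?_ (norm_nonneg _))
    rw [hpyth x hx]
    exact le_add_of_nonneg_right (by positivity)
  have hest : ∀ Y, IsLinearEstimate P s d μ ξ a N Y →
      ∃ x ∈ past S s d (fun i => (μ i : ℤ)) (-1),
        Y =ᵐ[P] fun ω => U x ω - functionalV s d μ a N ξ ω := by
    rintro Y ⟨η, hη, hY⟩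
    rw [pastSpace_eq_map hμ hU] at hη
    obtain ⟨x, hx, rfl⟩ := hη
    exact ⟨x, hx, hY⟩
  have hopt : IsOptimalEstimate P s d μ ξ a N
      (fun ω => U (vec S h) ω - functionalV s d μ a N ξ ω) := by
    refine ⟨⟨U (vec S h), ?_, EventuallyEq.rfl⟩, fun Y' hY' => ?_⟩
    · rw [pastSpace_eq_map hμ hU]
      exact ⟨_, hpast, rfl⟩
    · obtain ⟨x, hx, hY⟩ := hest Y' hY'
      rw [mse_eq hs hμ a N hx₀ EventuallyEq.rfl, mse_eq hs hμ a N hx₀ hY, he']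
      gcongr
      exact hmin x hx
  refine ⟨⟨(hS.memL2Minus_iff hs).2 ⟨hh, hpast⟩, fun g hg => ?_⟩, ⟨_, hopt⟩, fun Y hY => ?_⟩
  · obtain ⟨hg1, hg2⟩ := (hS.memL2Minus_iff hs).1 hg
    have h1 := hS.inner_vec (hS.memL2_sub hB hh) hg1
    rw [hS.vec_sub hB hh] at h1
    have h2 : inner ℂ (vec S g) (x₀ - vec S h) = 0 := by rw [he']; exact horth _ hg2
    have h3 := h1.symm.trans h2
    have hpi : (1 / (2 * Real.pi) : ℂ) ≠ 0 :=
      one_div_ne_zero (by exact_mod_cast Real.two_pi_pos.ne')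
    exact (mul_eq_zero.1 h3).resolve_left hpi
  · obtain ⟨x, hx, hYx⟩ := hest Y hY.1
    have h1 : mse P ξ a N Y = ‖e‖ₑ ^ 2 := by
      apply le_antisymm
      · refine (hY.2 _ hopt.1).trans_eq ?_
        rw [mse_eq hs hμ a N hx₀ EventuallyEq.rfl, he']
      · rw [mse_eq hs hμ a N hx₀ hYx]
        gcongr
        exact hmin x hx
    have h2 : vec S h = x := by
      rw [mse_eq hs hμ a N hx₀ hYx, ← ofReal_norm, ← ofReal_norm, ← ENNReal.ofReal_pow (norm_nonneg _),
        ← ENNReal.ofReal_pow (norm_nonneg _),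
        ENNReal.ofReal_eq_ofReal_iff (by positivity) (by positivity), hpyth x hx] at h1
      have h3 : ‖vec S h - x‖ ^ 2 = 0 := by linarith
      rwa [sq_eq_zero_iff, norm_eq_zero, sub_eq_zero] at h3
    refine ⟨hS.hasStochIntegral hs hU hZ hh ?_, ?_, ?_⟩
    · rw [h2]
      filter_upwards [hYx] with ω h3
      rw [h3, sub_add_cancel]
    · rw [h1]
      exact ENNReal.pow_ne_top enorm_ne_top
    · rw [h1, hΔ, ENNReal.toReal_pow, toReal_enorm]

end estimate

end

/-! ### Mean square convergent series -/

lemma isL2Sum_iff {X : Type*} [MeasurableSpace X] {ν : Measure X} {u : ℕ → X → ℂ} {C : X → ℂ}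
    (hu : ∀ k, MemLp (u k) 2 ν) (hC : MemLp C 2 ν) : IsL2Sum ν u C ↔
      Tendsto (fun n => ∑ k ∈ Finset.range n, (hu k).toLp (u k)) atTop (𝓝 (hC.toLp C)) := by
  have h : ∀ n, eLpNorm (fun x => C x - ∑ k ∈ Finset.range n, u k x) 2 ν =
      edist (∑ k ∈ Finset.range n, (hu k).toLp (u k)) (hC.toLp C) := by
    intro n
    rw [edist_comm, Lp.edist_def]
    refine eLpNorm_congr_ae ?_
    filter_upwards [hC.coeFn_toLp, Lp.coeFn_fun_finsetSum (Finset.range n)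
      (fun k => (hu k).toLp (u k)), ae_all_iff.2 fun k => (hu k).coeFn_toLp] with x h1 h2 h3
    rw [Pi.sub_apply, h1, h2]
    simp only [h3]
  rw [IsL2Sum, tendsto_iff_edist_tendsto_0]
  simp only [h, hC, true_and]

lemma memLp_ex (k : ℤ) : MemLp (ex k) 2 circ :=
  MemLp.of_bound (continuous_ex k).aestronglyMeasurable 1
    (Eventually.of_forall fun t => (norm_ex k t).le)

/-- The class of `e^{ikλ}`. -/
def exLp (k : ℤ) : Lp ℂ 2 circ := (memLp_ex k).toLp _

lemma inner_exLp (k : ℤ) {G : ℝ → ℂ} {y : Lp ℂ 2 circ} (hG : y =ᵐ[circ] G) :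
    inner ℂ (exLp k) y = ∫ t, ex (-k) t * G t ∂circ := by
  rw [L2.inner_def]
  refine integral_congr_ae ?_
  filter_upwards [(memLp_ex k).coeFn_toLp, hG] with t h1 h2
  simp only [exLp, h1, h2, RCLike.inner_apply, conj_ex, mul_comm]

lemma inner_exLp_exLp (k j : ℤ) :
    inner ℂ (exLp k) (exLp j) = if k = j then (2 * Real.pi : ℂ) else 0 := by
  rw [inner_exLp k (y := exLp j) (memLp_ex j).coeFn_toLp]
  simp only [← ex_add]
  rw [integral_ex]
  congr 1
  rw [neg_add_eq_zero]

/-- A square integrable function is the sum of its Fourier series; here the coefficients with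
negative indices vanish. -/
lemma isL2Sum_fourier {G : ℝ → ℂ} (hG : MemLp G 2 circ)
    (hneg : ∀ m : ℤ, m < 0 → ∫ t, ex (-m) t * G t ∂circ = 0) :
    IsL2Sum circ (fun k t => (1 / (2 * Real.pi) * ∫ τ, ex (-(k : ℤ)) τ * G τ ∂circ) * ex k t) G := by
  have hpi := Real.two_pi_pos
  set c : ℂ := (((Real.sqrt (2 * Real.pi))⁻¹ : ℝ) : ℂ) with hc
  have hcc : c * c = 1 / (2 * Real.pi) := by
    rw [hc, ← Complex.ofReal_mul, ← mul_inv, Real.mul_self_sqrt hpi.le]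
    push_cast
    ring
  have hcconj : conj c = c := Complex.conj_ofReal _
  have horth : Orthonormal ℂ fun k : ℤ => c • exLp k := by
    rw [orthonormal_iff_ite]
    intro i j
    rw [inner_smul_left, inner_smul_right, inner_exLp_exLp, hcconj, ← mul_assoc, hcc]
    split_ifs
    · have : (2 * Real.pi : ℂ) ≠ 0 := by exact_mod_cast hpi.ne'
      field_simp
    · rw [mul_zero]
  have hc0 : c ≠ 0 := by
    rw [hc]; exact_mod_cast (inv_ne_zero (Real.sqrt_ne_zero'.2 hpi))
  have hdense : ⊤ ≤ (Submodule.span ℂ (Set.range fun k : ℤ => c • exLp k)).topologicalClosure := by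
    rw [top_le_iff, Submodule.topologicalClosure_eq_top_iff, Submodule.eq_bot_iff]
    intro x hx
    rw [Lp.eq_zero_iff_ae_eq_zero]
    refine ae_eq_zero_of_fourier ((Lp.memLp x).integrable (by norm_num)) fun m => ?_
    have h := (Submodule.mem_orthogonal _ _).1 hx _ (Submodule.subset_span ⟨-m, rfl⟩)
    rw [inner_smul_left, inner_exLp (-m) EventuallyEq.rfl, neg_neg, hcconj] at h
    exact (mul_eq_zero.1 h).resolve_left hc0
  let b := HilbertBasis.mk horth hdense
  have hsum := b.hasSum_repr (hG.toLp G)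
  have hterm : ∀ k : ℤ, (b.repr (hG.toLp G)) k • b k =
      (1 / (2 * Real.pi) * ∫ τ, ex (-k) τ * G τ ∂circ) • exLp k := by
    intro k
    rw [HilbertBasis.repr_apply_apply]
    simp only [b, HilbertBasis.coe_mk]
    rw [inner_smul_left, inner_exLp k hG.coeFn_toLp, hcconj, smul_smul]
    congr 1
    rw [← hcc]
    ring
  simp only [hterm] at hsum
  have hsum' := (Nat.cast_injective (R := ℤ)).hasSum_iff (f := fun k : ℤ =>
    (1 / (2 * Real.pi) * ∫ τ, ex (-k) τ * G τ ∂circ) • exLp k) (a := hG.toLp G) fun k hk => by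
      have hk' : k < 0 := by
        by_contra h
        exact hk ⟨k.toNat, Int.toNat_of_nonneg (not_lt.1 h)⟩
      rw [hneg k hk', mul_zero, zero_smul]
  have hlim := (hsum'.2 hsum).tendsto_sum_nat
  rw [isL2Sum_iff (fun k => (memLp_ex k).const_mul _) hG]
  exact hlim

lemma integral_ex_mul_of_isL2Sum {x : ℕ → ℂ} {X : ℝ → ℂ}
    (h : IsL2Sum circ (fun k t => x k * ex k t) X) (m : ℤ) :
    ∫ t, ex (-m) t * X t ∂circ = if 0 ≤ m then 2 * Real.pi * x m.toNat else 0 := by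
  have hu : ∀ k : ℕ, MemLp (fun t => x k * ex k t) 2 circ := fun k => (memLp_ex k).const_mul _
  have h1 := (isL2Sum_iff hu h.1).1 h
  have hterm : ∀ k : ℕ, (hu k).toLp _ = x k • exLp k := fun k => rfl
  simp only [hterm] at h1
  have h2 := (Filter.Tendsto.inner (𝕜 := ℂ) (tendsto_const_nhds (x := exLp m)) h1)
  rw [inner_exLp m h.1.coeFn_toLp] at h2
  refine tendsto_nhds_unique h2 (tendsto_const_nhds.congr' ?_)
  filter_upwards [eventually_gt_atTop m.toNat] with n hn
  simp only [inner_sum, inner_smul_right, inner_exLp_exLp]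
  split_ifs with hm
  · rw [Finset.sum_eq_single m.toNat]
    · rw [if_pos (by omega), mul_comm]
    · intro k _ hk
      rw [if_neg (by omega), mul_zero]
    · intro hk
      exact absurd (Finset.mem_range.2 hn) hk
  · symm
    refine Finset.sum_eq_zero fun k _ => ?_
    rw [if_neg (by omega), mul_zero]

/-! ### Boundedness of the prediction error -/

section

variable {T : ℕ} {f S : ℝ → Matrix (Fin T) (Fin T) ℂ} {r : ℕ} {s d : Fin r → ℕ} {μ : Fin r → ℕ}
  {ν : Fin r → ℤ}

lemma memLp_ex_smul (j : ℤ) (x : VecL2 T) : MemLp (fun t => ex j t • x t) 2 circ := by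
  refine (Lp.memLp x).of_le ((continuous_ex j).aestronglyMeasurable.smul
    (Lp.aestronglyMeasurable x)) (Eventually.of_forall fun t => ?_)
  rw [norm_smul, norm_ex, one_mul]

/-- Multiplication by `e^{ijλ}`. -/
def mulEx (T : ℕ) (j : ℤ) : VecL2 T →ₗᵢ[ℂ] VecL2 T where
  toFun x := (memLp_ex_smul j x).toLp _
  map_add' x y := by
    rw [← MemLp.toLp_add]
    refine MemLp.toLp_congr _ _ ?_
    filter_upwards [Lp.coeFn_add x y] with t h
    simp only [h, Pi.add_apply, smul_add]
  map_smul' c x := by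
    rw [RingHom.id_apply, ← MemLp.toLp_const_smul]
    refine MemLp.toLp_congr _ _ ?_
    filter_upwards [Lp.coeFn_smul c x] with t h
    simp only [h, Pi.smul_apply, smul_comm c]
  norm_map' x := by
    change ‖(memLp_ex_smul j x).toLp _‖ = ‖x‖
    rw [Lp.norm_toLp, Lp.norm_def]
    congr 1
    refine eLpNorm_congr_norm_ae (Eventually.of_forall fun t => ?_)
    rw [norm_smul, norm_ex, one_mul]

lemma coeFn_mulEx (j : ℤ) (x : VecL2 T) : mulEx T j x =ᵐ[circ] fun t => ex j t • x t :=
  (memLp_ex_smul j x).coeFn_toLp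

namespace IsRoot

lemma mulEx_vec_gen (hS : IsRoot f S) (hs : ∀ i, 0 < s i) (j k : ℤ) (p : Fin T) :
    mulEx T j (vec S (gen s d ν k p)) = vec S (gen s d ν (k + j) p) := by
  refine Lp.ext ?_
  filter_upwards [coeFn_mulEx j (vec S (gen s d ν k p)), hS.coeFn_vec (hS.memL2_gen hs d ν k p),
    hS.coeFn_vec (hS.memL2_gen hs d ν (k + j) p)] with t h1 h2 h3
  rw [h1, h2, h3]
  ext i
  simp only [weighted, gen, ex_add, Matrix.mulVec_single, PiLp.smul_apply, Pi.smul_apply,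
    MulOpposite.smul_eq_mul_unop, MulOpposite.unop_op, smul_eq_mul]
  ring

lemma mulEx_mem_past (hS : IsRoot f S) (hs : ∀ i, 0 < s i) (j m : ℤ) {x : VecL2 T}
    (hx : x ∈ past S s d ν m) : mulEx T j x ∈ past S s d ν (m + j) := by
  have hle : past S s d ν m ≤ (past S s d ν (m + j)).comap (mulEx T j).toLinearMap := by
    refine past_le ((isClosed_past _).preimage (mulEx T j).continuous) fun k hk p => ?_
    rw [Submodule.mem_comap]
    change mulEx T j _ ∈ _
    rw [hS.mulEx_vec_gen hs]
    exact vec_gen_mem_past (by omega) p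
  exact hle hx

/-- A wandering vector `w`, which lies in the past at time `k` and is orthogonal to the past at time
`k - 1`, has constant modulus: it is orthogonal to all `e^{ijλ} w` with `j ≠ 0`, so the Fourier
coefficients of `‖w‖²` vanish except for the zeroth one. -/
lemma exists_norm_le_of_wandering (hS : IsRoot f S) (hs : ∀ i, 0 < s i) {k : ℤ} {w : VecL2 T}
    (hw : w ∈ past S s d ν k) (horth : ∀ z ∈ past S s d ν (k - 1), inner ℂ z w = 0) :
    ∃ K : ℝ, ∀ᵐ t ∂circ, ‖w t‖ ≤ K := by
  have hint : Integrable (fun t => ((‖w t‖ ^ 2 : ℝ) : ℂ)) circ := by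
    exact ((memLp_two_iff_integrable_sq_norm (Lp.aestronglyMeasurable w)).1 (Lp.memLp w)).ofReal
  have hself : ∀ t, inner ℂ (w t) (w t) = ((‖w t‖ ^ 2 : ℝ) : ℂ) := fun t => by
    rw [inner_self_eq_norm_sq_to_K]; push_cast; rfl
  have hpos : ∀ j : ℤ, 0 < j → ∫ t, ex j t * ((‖w t‖ ^ 2 : ℝ) : ℂ) ∂circ = 0 := by
    intro j hj
    have h1 := horth _ (past_mono (by omega) (hS.mulEx_mem_past hs (-j) k hw))
    rw [← h1, L2.inner_def]
    refine integral_congr_ae ?_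
    filter_upwards [coeFn_mulEx (-j) w] with t ht
    rw [ht, inner_smul_left, hself, conj_ex, neg_neg]
  have hneg : ∀ j : ℤ, 0 < j → ∫ t, ex (-j) t * ((‖w t‖ ^ 2 : ℝ) : ℂ) ∂circ = 0 := by
    intro j hj
    have h1 := congrArg conj (hpos j hj)
    rw [← integral_conj, map_zero] at h1
    rw [← h1]
    refine integral_congr_ae (Eventually.of_forall fun t => ?_)
    simp only [map_mul, conj_ex, Complex.conj_ofReal]
  have hpi : (2 * Real.pi : ℂ) ≠ 0 := by exact_mod_cast Real.two_pi_pos.ne'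
  set c : ℂ := 1 / (2 * Real.pi) * ∫ t, ((‖w t‖ ^ 2 : ℝ) : ℂ) ∂circ with hc
  have hconst : (fun t => ((‖w t‖ ^ 2 : ℝ) : ℂ) - c) =ᵐ[circ] 0 := by
    refine ae_eq_zero_of_fourier (hint.sub (integrable_const c)) fun m => ?_
    simp only [mul_sub]
    rw [integral_sub (integrable_ex_mul hint m) (integrable_ex_mul (integrable_const c) m),
      integral_mul_const, integral_ex]
    rcases lt_trichotomy m 0 with hm | rfl | hm
    · have := hneg (-m) (by omega)
      rw [neg_neg] at this
      rw [this, if_neg hm.ne, zero_mul, sub_zero]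
    · rw [if_pos rfl, hc]
      simp only [ex_zero, one_mul]
      field_simp
      ring
    · rw [hpos m hm, if_neg hm.ne', zero_mul, sub_zero]
  refine ⟨Real.sqrt c.re, ?_⟩
  filter_upwards [hconst] with t ht
  have h1 := congrArg Complex.re (sub_eq_zero.1 ht)
  rw [Complex.ofReal_re] at h1
  rw [← h1, Real.sqrt_sq (norm_nonneg _)]

/-- The error of predicting an element of the past at time `N` from the past at time `-1` is a sum of
`N + 1` wandering vectors, and is bounded. -/
lemma exists_norm_le_prediction_error (hS : IsRoot f S) (hs : ∀ i, 0 < s i) {N : ℕ} {x₀ y : VecL2 T}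
    (hx₀ : x₀ ∈ past S s d ν N) (hy : y ∈ past S s d ν (-1))
    (horth : ∀ z ∈ past S s d ν (-1), inner ℂ z (x₀ - y) = 0) :
    ∃ K : ℝ, ∀ᵐ t ∂circ, ‖(x₀ - y : VecL2 T) t‖ ≤ K := by
  choose π hπmem hπ using fun k : ℕ => exists_projection_past (S := S) (s := s) (d := d) (ν := ν)
    ((k : ℤ) - 1) x₀
  have huniq : ∀ m : ℤ, ∀ u ∈ past S s d ν m, ∀ v ∈ past S s d ν m,
      (∀ z ∈ past S s d ν m, inner ℂ z (x₀ - u) = 0) →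
      (∀ z ∈ past S s d ν m, inner ℂ z (x₀ - v) = 0) → u = v := by
    intro m u hu v hv h1 h2
    have h3 : inner ℂ (u - v) (u - v) = 0 := by
      have h4 : u - v = (x₀ - v) - (x₀ - u) := by abel
      nth_rewrite 2 [h4]
      rw [inner_sub_right, h1 _ (Submodule.sub_mem _ hu hv), h2 _ (Submodule.sub_mem _ hu hv),
        sub_zero]
    exact sub_eq_zero.1 (inner_self_eq_zero.1 h3)
  have h0 : π 0 = y := huniq (-1) _ (by simpa using hπmem 0) _ hy (by simpa using hπ 0) horth
  have hN : π (N + 1) = x₀ := by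
    have hcast : (((N + 1 : ℕ) : ℤ) - 1) = N := by push_cast; ring
    refine huniq N _ (hcast ▸ hπmem (N + 1)) _ hx₀ (hcast ▸ hπ (N + 1)) fun z _ => ?_
    rw [sub_self, inner_zero_right]
  have htel : x₀ - y = ∑ k ∈ Finset.range (N + 1), (π (k + 1) - π k) := by
    rw [Finset.sum_range_sub, h0, hN]
  have hpiece : ∀ k : ℕ, ∃ K : ℝ, ∀ᵐ t ∂circ, ‖(π (k + 1) - π k : VecL2 T) t‖ ≤ K := by
    intro k
    have hcast : (((k + 1 : ℕ) : ℤ) - 1) = k := by push_cast; ring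
    have hmem := hπmem (k + 1)
    have ho := hπ (k + 1)
    rw [hcast] at hmem ho
    refine hS.exists_norm_le_of_wandering hs (d := d) (ν := ν) (k := k)
      (Submodule.sub_mem _ hmem (past_mono (by omega) (hπmem k))) fun z hz => ?_
    have h4 : π (k + 1) - π k = (x₀ - π k) - (x₀ - π (k + 1)) := by abel
    rw [h4, inner_sub_right, hπ k z hz, ho z (past_mono (by omega) hz), sub_zero]
  choose K hK using hpiece
  refine ⟨∑ k ∈ Finset.range (N + 1), K k, ?_⟩
  rw [htel]
  filter_upwards [Lp.coeFn_fun_finsetSum (Finset.range (N + 1)) (fun k => π (k + 1) - π k),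
    ae_all_iff.2 hK] with t h1 h2
  rw [h1]
  exact norm_sum_le_of_le _ fun k _ => h2 k

end IsRoot

end

/-! ### The form of the operator `F_μ` in coordinates -/

/-- The coordinates of the element `e = conj(ρ)⁻¹ (fᵀ)⁻¹ X` of `L₂(f)`, where `ρ = χ_μ / β`. This is
the `e` with `X = conj(ρ) fᵀ e`, so that the Fourier coefficients of `X` are the inner products of `e`
with the generators of `L₂(f)`; the form of `F_μ` is the inner product in these coordinates. -/
def formCoord {r T : ℕ} (S : ℝ → Matrix (Fin T) (Fin T) ℂ) (s d : Fin r → ℕ) (ν : Fin r → ℤ)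
    (X : ℝ → Fin T → ℂ) (t : ℝ) : EuclideanSpace ℂ (Fin T) :=
  WithLp.toLp 2 ((1 / (2 * Real.pi * conj (ratio s d ν t)) : ℂ) • (((S t)ᴴ)⁻¹ *ᵥ X t))

section

variable {T : ℕ} {f S : ℝ → Matrix (Fin T) (Fin T) ℂ} {r : ℕ} {s d : Fin r → ℕ} {μ : Fin r → ℕ}

lemma two_pi_ne_zero_complex : (2 * Real.pi : ℂ) ≠ 0 := by
  exact_mod_cast Real.two_pi_pos.ne'

lemma transpose_inv_eq {t : ℝ} (ht : (S t)ᴴ * S t = (1 / (2 * Real.pi) : ℂ) • (f t)ᵀ) :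
    ((f t)⁻¹)ᵀ = (1 / (2 * Real.pi) : ℂ) • ((S t)⁻¹ * ((S t)ᴴ)⁻¹) := by
  have h : (f t)ᵀ = (2 * Real.pi : ℂ) • ((S t)ᴴ * S t) := by
    rw [ht, smul_smul, mul_one_div_cancel two_pi_ne_zero_complex, one_smul]
  have hu : IsUnit (2 * Real.pi : ℂ) := isUnit_iff_ne_zero.2 two_pi_ne_zero_complex
  rw [Matrix.transpose_nonsing_inv, h, ← Matrix.mul_inv_rev, one_div]
  by_cases hd : IsUnit ((S t)ᴴ * S t).det
  · have := Matrix.inv_smul' ((S t)ᴴ * S t) hu.unit hd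
    simpa [Units.smul_def] using this
  · rw [Matrix.nonsing_inv_apply_not_isUnit _ hd, smul_zero, Matrix.nonsing_inv_apply_not_isUnit]
    rw [Matrix.det_smul, IsUnit.mul_iff]
    exact fun h => hd h.2

lemma conj_beta_div_chi (s d : Fin r → ℕ) (ν : Fin r → ℤ) (t : ℝ) :
    conj (beta s d t) / chi s d ν (ex 1 t) = (conj (ratio s d ν t))⁻¹ := by
  rw [ratio, map_div₀, conj_chi, inv_div]

lemma star_dotProduct_symbolF_mulVec {t : ℝ}
    (ht : (S t)ᴴ * S t = (1 / (2 * Real.pi) : ℂ) • (f t)ᵀ) (X Y : ℝ → Fin T → ℂ) :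
    star (Y t) ⬝ᵥ (symbolF s d μ f t *ᵥ X t) =
      2 * Real.pi * inner ℂ (formCoord S s d (fun i => (μ i : ℤ)) Y t)
        (formCoord S s d (fun i => (μ i : ℤ)) X t) := by
  set ν : Fin r → ℤ := fun i => (μ i : ℤ)
  have h1 : ((‖beta s d t‖ ^ 2 / ‖chi s d ν (ex (-1) t)‖ ^ 2 : ℝ) : ℂ) =
      (ratio s d ν t)⁻¹ * (conj (ratio s d ν t))⁻¹ := by
    rw [← mul_inv, Complex.mul_conj, Complex.normSq_eq_norm_sq, ratio, norm_div, div_pow]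
    push_cast
    rw [inv_div]
  have h2 : star (((S t)ᴴ)⁻¹ *ᵥ Y t) = star (Y t) ᵥ* (S t)⁻¹ := by
    rw [Matrix.star_mulVec, Matrix.conjTranspose_nonsing_inv, Matrix.conjTranspose_conjTranspose]
  have hr : ((ratio s d ν t)⁻¹ * (conj (ratio s d ν t))⁻¹) * (1 / (2 * Real.pi) : ℂ) =
      2 * Real.pi * (conj (1 / (2 * Real.pi * conj (ratio s d ν t)) : ℂ) *
        (1 / (2 * Real.pi * conj (ratio s d ν t)) : ℂ)) := by
    simp only [map_div₀, map_mul, map_one, Complex.conj_conj, Complex.conj_ofReal, map_ofNat]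
    have := two_pi_ne_zero_complex
    have hpi : (Real.pi : ℂ) ≠ 0 := by exact_mod_cast Real.pi_ne_zero
    simp only [one_div, mul_inv]
    field_simp
  unfold symbolF
  rw [h1, transpose_inv_eq ht, smul_smul, hr, EuclideanSpace.inner_eq_star_dotProduct]
  simp only [formCoord]
  have h3 : (((S t)ᴴ)⁻¹ *ᵥ X t) ⬝ᵥ (star (Y t) ᵥ* (S t)⁻¹) =
      star (Y t) ⬝ᵥ (((S t)⁻¹ * ((S t)ᴴ)⁻¹) *ᵥ X t) := by
    rw [dotProduct_comm, ← Matrix.dotProduct_mulVec, Matrix.mulVec_mulVec]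
  rw [star_smul, h2, smul_dotProduct, dotProduct_smul, h3, Matrix.smul_mulVec, dotProduct_smul]
  simp only [smul_eq_mul, Complex.star_def]
  ring

namespace IsRoot

lemma formF_eq (hS : IsRoot f S) {X Y : ℝ → Fin T → ℂ} {x y : VecL2 T}
    (hx : x =ᵐ[circ] formCoord S s d (fun i => (μ i : ℤ)) X)
    (hy : y =ᵐ[circ] formCoord S s d (fun i => (μ i : ℤ)) Y) :
    formF s d μ f X Y = inner ℂ y x := by
  rw [formF, L2.inner_def, ← integral_const_mul]
  refine integral_congr_ae ?_
  filter_upwards [hS.gram, hx, hy] with t h1 h2 h3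
  rw [star_dotProduct_symbolF_mulVec h1, h2, h3, ← mul_assoc,
    one_div_mul_cancel two_pi_ne_zero_complex, one_mul]

lemma finiteEnergy_iff (hS : IsRoot f S) {X : ℝ → Fin T → ℂ} :
    FiniteEnergy s d μ f X ↔
      eLpNorm (formCoord S s d (fun i => (μ i : ℤ)) X) 2 circ < ⊤ := by
  have h : ∫⁻ t, ENNReal.ofReal (star (X t) ⬝ᵥ (symbolF s d μ f t *ᵥ X t)).re ∂circ =
      ENNReal.ofReal (2 * Real.pi) *
        eLpNorm (formCoord S s d (fun i => (μ i : ℤ)) X) 2 circ ^ 2 := by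
    rw [eLpNorm_two_sq, ← lintegral_const_mul' _ _ ENNReal.ofReal_ne_top]
    refine lintegral_congr_ae ?_
    filter_upwards [hS.gram] with t ht
    rw [star_dotProduct_symbolF_mulVec ht, inner_self_eq_norm_sq_to_K]
    rw [← ofReal_norm, ← ENNReal.ofReal_pow (norm_nonneg _), ← ENNReal.ofReal_mul Real.two_pi_pos.le]
    congr 1
    have : (2 * Real.pi * ((‖formCoord S s d (fun i => (μ i : ℤ)) X t‖ : ℝ) : ℂ) ^ 2) =
      ((2 * Real.pi * ‖formCoord S s d (fun i => (μ i : ℤ)) X t‖ ^ 2 : ℝ) : ℂ) := by push_cast; rfl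
    exact (congrArg Complex.re this).trans (Complex.ofReal_re _)
  rw [FiniteEnergy, h]
  constructor
  · intro h
    by_contra h'
    rw [not_lt, top_le_iff] at h'
    rw [h', ENNReal.top_pow two_ne_zero,
      ENNReal.mul_top (ENNReal.ofReal_pos.2 Real.two_pi_pos).ne'] at h
    exact h.ne rfl
  · intro h
    exact ENNReal.mul_lt_top ENNReal.ofReal_lt_top (ENNReal.pow_lt_top h)

lemma aestronglyMeasurable_formCoord (hS : IsRoot f S) (s d : Fin r → ℕ) (ν : Fin r → ℤ)
    {X : ℝ → Fin T → ℂ} (hX : ∀ p, AEStronglyMeasurable (fun t => X t p) circ) :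
    AEStronglyMeasurable (formCoord S s d ν X) circ := by
  have h1 : ∀ p q, AEStronglyMeasurable (fun t => ((S t)ᴴ)⁻¹ p q) circ :=
    aestronglyMeasurable_inv fun p q => (hS.aestronglyMeasurable q p).star
  have h2 : AEStronglyMeasurable (fun t => (1 / (2 * Real.pi * conj (ratio s d ν t)) : ℂ)) circ :=
    (measurable_const.div (measurable_const.mul
      (Complex.continuous_conj.measurable.comp (measurable_ratio s d ν)))).aestronglyMeasurable
  exact h2.smul (aestronglyMeasurable_weighted h1 hX)

/-- A function of finite energy, in coordinates; its inner products with the generators are its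
Fourier coefficients. -/
lemma exists_formCoord (hS : IsRoot f S) (hs : ∀ i, 0 < s i) (hμ : ∀ i, 0 < μ i)
    {x : ℕ → Fin T → ℂ} {X : ℝ → Fin T → ℂ} (hx : IsFourierSum x X)
    (hX : FiniteEnergy s d μ f X) :
    ∃ z : VecL2 T, z =ᵐ[circ] formCoord S s d (fun i => (μ i : ℤ)) X ∧
      ∀ m p, inner ℂ (vec S (gen s d (fun i => (μ i : ℤ)) m p)) z =
        if 0 ≤ m then x m.toNat p else 0 := by
  have hmem : MemLp (formCoord S s d (fun i => (μ i : ℤ)) X) 2 circ :=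
    ⟨hS.aestronglyMeasurable_formCoord s d _ fun p => (hx p).1.aestronglyMeasurable,
      hS.finiteEnergy_iff.1 hX⟩
  refine ⟨hmem.toLp _, hmem.coeFn_toLp, fun m p => ?_⟩
  have h1 := integral_ex_mul_of_isL2Sum (hx p) m
  have h2 : ∫ t, ex (-m) t * (conj (ratio s d (fun i => (μ i : ℤ)) t) *
      ((S t)ᴴ *ᵥ (hmem.toLp _ t).ofLp) p) ∂circ =
      ∫ t, 1 / (2 * Real.pi) * (ex (-m) t * X t p) ∂circ := by
    refine integral_congr_ae ?_
    filter_upwards [hmem.coeFn_toLp, hS.isUnit_det,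
      ae_ratio_ne_zero hs d (admissibleStep_natCast hμ).ne_zero] with t h3 h4 h5
    have h6 : IsUnit ((S t)ᴴ).det := by
      rw [Matrix.det_conjTranspose]; exact h4.star
    rw [h3]
    simp only [formCoord]
    rw [Matrix.mulVec_smul, Matrix.mulVec_mulVec, Matrix.mul_nonsing_inv _ h6, Matrix.one_mulVec,
      Pi.smul_apply, smul_eq_mul]
    have h7 : conj (ratio s d (fun i => (μ i : ℤ)) t) ≠ 0 := (map_ne_zero _).2 h5
    have h8 := two_pi_ne_zero_complex
    have hpi : (Real.pi : ℂ) ≠ 0 := by exact_mod_cast Real.pi_ne_zero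
    field_simp
  rw [hS.inner_vec_gen hs, h2, integral_const_mul, h1]
  split_ifs
  · have h8 := two_pi_ne_zero_complex
    field_simp
  · rw [mul_zero]

lemma weighted_vecMul_inv (hS : IsRoot f S) (X : ℝ → Fin T → ℂ) :
    weighted S (fun t => (conj (beta s d t) / chi s d (fun i => (μ i : ℤ)) (ex 1 t)) •
      (X t ᵥ* (f t)⁻¹)) =ᵐ[circ] formCoord S s d (fun i => (μ i : ℤ)) X := by
  filter_upwards [hS.gram, hS.isUnit_det] with t h1 h2
  simp only [weighted, formCoord]
  rw [conj_beta_div_chi, ← Matrix.mulVec_transpose, transpose_inv_eq h1, Matrix.mulVec_smul,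
    Matrix.smul_mulVec, Matrix.mulVec_smul, Matrix.mulVec_mulVec, ← mul_assoc,
    Matrix.mul_nonsing_inv _ h2, one_mul, smul_smul]
  congr 2
  rw [one_div, one_div, mul_inv (2 * Real.pi : ℂ), mul_comm]

/-- The function `C = conj(ρ) fᵀ e` belonging to a bounded vector `e` of coordinates which is
orthogonal to the past at time `-1`. It is square integrable, because `S` is, and its Fourier
coefficients with negative indices vanish, because of the orthogonality. -/
lemma exists_fourierSum_of_bounded (hS : IsRoot f S) (hs : ∀ i, 0 < s i) (hμ : ∀ i, 0 < μ i)
    {e : VecL2 T} {K : ℝ} (hK : ∀ᵐ t ∂circ, ‖e t‖ ≤ K)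
    (horth : ∀ z ∈ past S s d (fun i => (μ i : ℤ)) (-1), inner ℂ z e = 0) :
    ∃ C : ℝ → Fin T → ℂ, e =ᵐ[circ] formCoord S s d (fun i => (μ i : ℤ)) C ∧
      IsFourierSum (fun k p => inner ℂ (vec S (gen s d (fun i => (μ i : ℤ)) (k : ℤ) p)) e) C := by
  set ν : Fin r → ℤ := fun i => (μ i : ℤ) with hν
  set C : ℝ → Fin T → ℂ := fun t p =>
    2 * Real.pi * (conj (ratio s d ν t) * ((S t)ᴴ *ᵥ (e t).ofLp) p) with hC
  obtain ⟨M, hM0, hM⟩ := exists_norm_ratio_le hs d ν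
  have hCmem : ∀ p, MemLp (fun t => C t p) 2 circ := by
    intro p
    have h1 : MemLp (fun t => ∑ q, ‖S t q p‖) 2 circ :=
      memLp_finsetSum _ fun q _ => (hS.memLp q p).norm
    refine MemLp.of_le_mul (c := 2 * Real.pi * M * K) h1
      ((hS.integrable_conj_ratio_mul hs d ν e p).aestronglyMeasurable.const_mul _) ?_
    filter_upwards [hK] with t ht
    have h2 : ‖((S t)ᴴ *ᵥ (e t).ofLp) p‖ ≤ (∑ q, ‖S t q p‖) * K := by
      rw [Matrix.mulVec, dotProduct, Finset.sum_mul]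
      refine norm_sum_le_of_le _ fun q _ => ?_
      rw [norm_mul, Matrix.conjTranspose_apply, norm_star]
      gcongr
      exact (PiLp.norm_apply_le (e t) q).trans ht
    have h3 : 0 ≤ ∑ q, ‖S t q p‖ := Finset.sum_nonneg fun _ _ => norm_nonneg _
    simp only [hC]
    rw [norm_mul (2 * Real.pi : ℂ), norm_mul (conj _), RCLike.norm_conj, Real.norm_of_nonneg h3]
    have h4 : ‖(2 * Real.pi : ℂ)‖ = 2 * Real.pi := by
      rw [norm_mul, Complex.norm_real, Real.norm_of_nonneg Real.pi_pos.le]; norm_num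
    rw [h4]
    calc 2 * Real.pi * (‖ratio s d ν t‖ * ‖((S t)ᴴ *ᵥ (e t).ofLp) p‖)
        ≤ 2 * Real.pi * (M * ((∑ q, ‖S t q p‖) * K)) := by
          gcongr
          exact hM t
      _ = 2 * Real.pi * M * K * ∑ q, ‖S t q p‖ := by ring
  have hcoeff : ∀ (m : ℤ) p, ∫ t, ex (-m) t * C t p ∂circ =
      2 * Real.pi * inner ℂ (vec S (gen s d ν m p)) e := by
    intro m p
    rw [hS.inner_vec_gen hs, ← integral_const_mul]
    refine integral_congr_ae (Eventually.of_forall fun t => ?_)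
    simp only [hC]
    ring
  refine ⟨C, ?_, fun p => ?_⟩
  · filter_upwards [hS.isUnit_det, ae_ratio_ne_zero hs d (admissibleStep_natCast hμ).ne_zero]
      with t h1 h2
    have h3 : IsUnit ((S t)ᴴ).det := by
      rw [Matrix.det_conjTranspose]; exact h1.star
    have h4 : C t = (2 * Real.pi * conj (ratio s d ν t)) • ((S t)ᴴ *ᵥ (e t).ofLp) := by
      ext p
      simp only [hC, Pi.smul_apply, smul_eq_mul, mul_assoc]
    have h5 : (2 * Real.pi * conj (ratio s d ν t)) ≠ 0 :=
      mul_ne_zero two_pi_ne_zero_complex ((map_ne_zero _).2 h2)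
    rw [formCoord, h4, Matrix.mulVec_smul, Matrix.mulVec_mulVec, Matrix.nonsing_inv_mul _ h3,
      Matrix.one_mulVec, smul_smul, one_div_mul_cancel h5, one_smul, WithLp.toLp_ofLp]
  · have h1 := isL2Sum_fourier (hCmem p) fun m hm => by
      rw [hcoeff, horth _ (vec_gen_mem_past (by omega) p), mul_zero]
    simp only [hcoeff, ← mul_assoc, one_div_mul_cancel two_pi_ne_zero_complex, one_mul] at h1
    exact h1

end IsRoot

/-! ### The solution in terms of `F_μ` -/

lemma sum_bN_smul_mem_past (a : ℕ → Fin T → ℂ) (N : ℕ) :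
    ∑ k ∈ Finset.range (N + 1), ∑ p, bN s d μ a N k p •
      vec S (gen s d (fun i => (μ i : ℤ)) (k : ℤ) p) ∈ past S s d (fun i => (μ i : ℤ)) N := by
  refine Submodule.sum_mem _ fun k hk => Submodule.sum_mem _ fun p _ =>
    Submodule.smul_mem _ _ (vec_gen_mem_past ?_ p)
  have := Finset.mem_range.1 hk
  omega

/-- The solution of `F_μ c = D_N a_N` exists, is unique and gives the spectral characteristic and the
mean square error. -/
lemma solvesForecast_operatorF {Ω : Type*} [MeasurableSpace Ω] {P : Measure Ω}
    {ξ : ℤ → Fin T → Ω → ℂ} {U : VecL2 T →ₗᵢ[ℂ] Lp ℂ 2 P}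
    (hS : IsRoot f S) (hs : ∀ i, 0 < s i) (hμ : ∀ i, 0 < μ i)
    (hU : ∀ ν, AdmissibleStep ν → ∀ m p,
      U (vec S (gen s d ν m p)) =ᵐ[P] increment s d ν ξ m p)
    {Z : ℝ → Fin T → Ω → ℂ} (hZ : IsSpectralProcess P s d ξ f Z) (a : ℕ → Fin T → ℂ) (N : ℕ) :
    ∃ c : ℕ → Fin T → ℂ,
      OperatorF s d μ f c (bN s d μ a N) ∧
      (∀ c', OperatorF s d μ f c' (bN s d μ a N) → c' = c) ∧
      ∃ C : ℝ → Fin T → ℂ, IsFourierSum c C ∧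
        SolvesForecast P s d μ ξ f Z a N (hOfC s d μ f a N C)
          (∑ k ∈ Finset.range (N + 1), bN s d μ a N k ⬝ᵥ star (c k)) ∧
        ∑ k ∈ Finset.range (N + 1), bN s d μ a N k ⬝ᵥ star (c k) =
          1 / (2 * Real.pi) * ∫ t, conj (beta s d t) / chi s d (fun i => (μ i : ℤ)) (ex 1 t) *
            ((C t ᵥ* (f t)⁻¹) ⬝ᵥ star (C t)) *
            (beta s d t / chi s d (fun i => (μ i : ℤ)) (ex (-1) t)) ∂circ := by
  set ν : Fin r → ℤ := fun i => (μ i : ℤ) with hν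
  obtain ⟨hB, hBvec⟩ := hS.vec_trigPolynomial (d := d) (ν := ν) hs
    (Finset.range (N + 1)) (fun k : ℕ => (k : ℤ)) (bN s d μ a N)
  set x₀ := vec S (fun t => ratio s d ν t • BN s d μ a N t) with hx₀
  have hBvec' : x₀ = ∑ k ∈ Finset.range (N + 1), ∑ p, bN s d μ a N k p •
      vec S (gen s d ν (k : ℤ) p) := hBvec
  have hx₀mem : x₀ ∈ past S s d ν N := hBvec' ▸ sum_bN_smul_mem_past a N
  obtain ⟨y, hy, horth⟩ := exists_projection_past (S := S) (s := s) (d := d) (ν := ν) (-1) x₀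
  obtain ⟨K, hK⟩ := hS.exists_norm_le_prediction_error hs hx₀mem hy horth
  obtain ⟨C, hC, hcC⟩ := hS.exists_fourierSum_of_bounded hs hμ hK horth
  set e := x₀ - y with he
  set c : ℕ → Fin T → ℂ := fun k p => inner ℂ (vec S (gen s d ν (k : ℤ) p)) e with hc
  have hCE : FiniteEnergy s d μ f C :=
    hS.finiteEnergy_iff.2 (((memLp_congr_ae hC).1 (Lp.memLp e)).2)
  -- the right-hand side `b` represents the functional `z ↦ ⟨z, e⟩` on the orthogonal complement
  -- of the past
  have hpair : ∀ (z : VecL2 T) (x : ℕ → Fin T → ℂ), (∀ m p, inner ℂ (vec S (gen s d ν m p)) z =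
      if 0 ≤ m then x m.toNat p else 0) →
      inner ℂ z e = ∑ k ∈ Finset.range (N + 1), bN s d μ a N k ⬝ᵥ star (x k) := by
    intro z x hz
    have h1 : inner ℂ z y = 0 := by
      rw [inner_eq_zero_symm]
      refine inner_past_eq_zero (fun k hk p => ?_) y hy
      rw [hz, if_neg (by omega)]
    rw [he, inner_sub_right, h1, sub_zero, hBvec']
    simp only [inner_sum, inner_smul_right, dotProduct]
    refine Finset.sum_congr rfl fun k _ => Finset.sum_congr rfl fun p _ => ?_
    rw [← inner_conj_symm, hz, if_pos (Int.natCast_nonneg k), Int.toNat_natCast]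
    rfl
  have hself : ∀ m p, inner ℂ (vec S (gen s d ν m p)) e = if 0 ≤ m then c m.toNat p else 0 := by
    intro m p
    split_ifs with hm
    · simp only [hc, Int.toNat_of_nonneg hm]
    · exact horth _ (vec_gen_mem_past (by omega) p)
  have htsum : ∀ x : ℕ → Fin T → ℂ, ∑' k, bN s d μ a N k ⬝ᵥ star (x k) =
      ∑ k ∈ Finset.range (N + 1), bN s d μ a N k ⬝ᵥ star (x k) := by
    intro x
    refine tsum_eq_sum fun k hk => ?_
    rw [Finset.mem_range] at hk
    rw [bN_eq_zero s d μ a (by omega), zero_dotProduct]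
  have hΔ : ∑ k ∈ Finset.range (N + 1), bN s d μ a N k ⬝ᵥ star (c k) = ((‖e‖ ^ 2 : ℝ) : ℂ) := by
    rw [← hpair e c hself, inner_self_eq_norm_sq_to_K]
    push_cast
    rfl
  refine ⟨c, ⟨?_, C, hcC, hCE, ?_⟩, ?_, C, hcC, ?_, ?_⟩
  · refine summable_of_ne_finset_zero (s := Finset.range (N + 1)) fun k hk => ?_
    rw [Finset.mem_range] at hk
    rw [bN_eq_zero s d μ a (by omega)]
    simp
  · intro x X hx hX
    obtain ⟨z, hz, hzx⟩ := hS.exists_formCoord hs hμ hx hX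
    rw [hS.formF_eq hC hz, hpair z x hzx, htsum]
  · rintro c' ⟨-, C', hcC', hCE', hform⟩
    obtain ⟨z, hz, hzx⟩ := hS.exists_formCoord hs hμ hcC' hCE'
    have h1 : inner ℂ z z = inner ℂ z e := by
      rw [← hS.formF_eq hz hz, hform c' C' hcC' hCE', htsum, hpair z c' hzx]
    have h2 : inner ℂ e z = inner ℂ e e := by
      rw [← hS.formF_eq hz hC, hform c C hcC hCE, htsum, hpair e c hself]
    have h3 : z - e = 0 := by
      rw [← inner_self_eq_zero (𝕜 := ℂ), inner_sub_left, inner_sub_right z z e,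
        inner_sub_right e z e, h1, h2]
      ring
    rw [sub_eq_zero] at h3
    funext k p
    have h4 := hzx (k : ℤ) p
    rw [if_pos (Int.natCast_nonneg k), Int.toNat_natCast, h3] at h4
    exact h4.symm
  · have hE := hC.trans (hS.weighted_vecMul_inv C).symm
    have hEmem := hS.memL2_of_coeFn hE
    have hvec : vec S (hOfC s d μ f a N C) = x₀ - e :=
      (hS.vec_sub hB hEmem).trans (congrArg (x₀ - ·) (hS.eq_vec hE))
    have hh : MemL2 f (hOfC s d μ f a N C) := hS.memL2_sub hB hEmem
    refine solvesForecast hS hs hμ hU hZ a N hh hvec ?_ horth hΔ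
    rw [hvec, he, sub_sub_cancel]
    exact hy
  · rw [← hpair e c hself, ← hS.formF_eq hC hC, formF]
    congr 1
    refine integral_congr_ae (Eventually.of_forall fun t => ?_)
    simp only [symbolF]
    have h1 : ((‖beta s d t‖ ^ 2 / ‖chi s d ν (ex (-1) t)‖ ^ 2 : ℝ) : ℂ) =
        (conj (beta s d t) / chi s d ν (ex 1 t)) * (beta s d t / chi s d ν (ex (-1) t)) := by
      rw [← conj_chi, div_mul_div_comm, mul_comm (conj _), mul_comm (conj _), Complex.mul_conj,
        Complex.mul_conj, Complex.normSq_eq_norm_sq, Complex.normSq_eq_norm_sq]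
      push_cast
      rfl
    rw [h1, Matrix.smul_mulVec, dotProduct_smul, Matrix.mulVec_transpose, smul_eq_mul,
      dotProduct_comm]
    ring

end

/-! ### The solution in terms of the canonical factorization -/

section

variable {T q : ℕ} {f S : ℝ → Matrix (Fin T) (Fin T) ℂ} {r : ℕ} {s d : Fin r → ℕ} {μ : Fin r → ℕ}

lemma sum_transpose_mulVec_bN (φ : ℕ → Matrix (Fin T) (Fin q) ℂ) (a : ℕ → Fin T → ℂ) (N : ℕ)
    (k : ℕ) :
    rCoeff s d μ a N φ k = ∑ m ∈ Finset.range (N + 1), (φ m)ᵀ *ᵥ bN s d μ a N (k + m) := by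
  unfold rCoeff bN
  refine Finset.sum_congr rfl fun m _ => ?_
  rw [Matrix.mulVec_sum]
  rw [← Finset.sum_filter_of_ne (s := Finset.Icc k N) (p := fun l => m + l ≤ N)]
  · refine Finset.sum_bij' (fun l _ => m + l) (fun l _ => l - m) ?_ ?_ ?_ ?_ ?_
    · intro l hl
      simp at hl ⊢; omega
    · intro l hl
      simp at hl ⊢; omega
    · intro l hl
      simp
    · intro l hl
      simp at hl ⊢; omega
    · intro l hl
      simp only [Finset.mem_filter, Finset.mem_Icc] at hl
      rw [if_pos hl.2, Matrix.mulVec_smul, show m + l - (k + m) = l - k by omega]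
  · intro l _ h
    by_contra hlt
    exact h (by rw [if_neg hlt, Matrix.mulVec_zero, smul_zero])

lemma sum_norm_rFun_sq (a : ℕ → Fin T → ℂ) (N : ℕ) (φ : ℕ → Matrix (Fin T) (Fin q) ℂ) :
    ∑ k ∈ Finset.range (N + 1), ∑ j, ‖rCoeff s d μ a N φ k j‖ ^ 2 =
      1 / (2 * Real.pi) * ∫ t, ∑ j, ‖rFun s d μ a N φ t j‖ ^ 2 ∂circ := by
  set R := rCoeff s d μ a N φ
  have hint : ∀ j, Integrable (fun t => ‖rFun s d μ a N φ t j‖ ^ 2) circ := by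
    intro j
    have h : MemLp (fun t => rFun s d μ a N φ t j) 2 circ := by
      simp only [rFun, Finset.sum_apply, Pi.smul_apply, smul_eq_mul]
      exact memLp_finsetSum _ fun k _ => (memLp_ex k).mul_const _
    exact (memLp_two_iff_integrable_sq_norm h.aestronglyMeasurable).1 h
  have hj : ∀ j, ∫ t, ‖rFun s d μ a N φ t j‖ ^ 2 ∂circ =
      2 * Real.pi * ∑ k ∈ Finset.range (N + 1), ‖R k j‖ ^ 2 := by
    intro j
    have h1 : ∀ t, ((‖rFun s d μ a N φ t j‖ ^ 2 : ℝ) : ℂ) =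
        ∑ k ∈ Finset.range (N + 1), ∑ l ∈ Finset.range (N + 1),
          (R k j * conj (R l j)) * ex ((k : ℤ) - l) t := by
      intro t
      rw [← Complex.normSq_eq_norm_sq, ← Complex.mul_conj]
      simp only [rFun, Finset.sum_apply, Pi.smul_apply, smul_eq_mul, map_sum, map_mul, conj_ex,
        Finset.sum_mul_sum, sub_eq_add_neg, ex_add]
      refine Finset.sum_congr rfl fun k _ => Finset.sum_congr rfl fun l _ => ?_
      ring
    have hex : ∀ k : ℤ, Integrable (ex k) circ := fun k => (memLp_ex k).integrable (by norm_num)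
    apply Complex.ofReal_injective
    rw [← integral_complex_ofReal]
    simp only [h1]
    rw [integral_finsetSum _ fun k _ => integrable_finsetSum _ fun l _ => (hex _).const_mul _]
    push_cast
    rw [Finset.mul_sum]
    refine Finset.sum_congr rfl fun k hk => ?_
    rw [integral_finsetSum _ fun l _ => (hex _).const_mul _, Finset.sum_eq_single k]
    · rw [integral_const_mul, integral_ex, if_pos (sub_self _), Complex.mul_conj,
        Complex.normSq_eq_norm_sq]
      push_cast
      ring
    · intro l _ hl
      rw [integral_const_mul, integral_ex, if_neg (by omega), mul_zero]
    · exact fun h => absurd hk h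
  rw [integral_finsetSum _ fun j _ => hint j]
  simp only [hj]
  rw [← Finset.mul_sum, ← mul_assoc, one_div_mul_cancel Real.two_pi_pos.ne', one_mul,
    Finset.sum_comm]

/-- The function `ρ Ψᵀ e^{ikλ} δ_j`, the spectral counterpart of the innovation `ε_j(k)`. -/
def innov (s d : Fin r → ℕ) (μ : Fin r → ℕ) (Ψ : ℝ → Matrix (Fin q) (Fin T) ℂ) (k : ℤ) (j : Fin q)
    (t : ℝ) : Fin T → ℂ :=
  ratio s d (fun i => (μ i : ℤ)) t • ((Ψ t)ᵀ *ᵥ Pi.single j (ex k t))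

variable {Ω : Type*} [MeasurableSpace Ω] {P : Measure Ω} {ξ : ℤ → Fin T → Ω → ℂ}
  {ε : ℤ → Fin q → Ω → ℂ} {φ : ℕ → Matrix (Fin T) (Fin q) ℂ} {Φ : ℝ → Matrix (Fin T) (Fin q) ℂ}
  {Ψ : ℝ → Matrix (Fin q) (Fin T) ℂ}

namespace IsCanonicalFactorization

/-- The factorization gives `Ψ |ρ|² f = Φ^*`. -/
lemma smul_mul_eq_conjTranspose (hfac : IsCanonicalFactorization P s d μ ξ f ε φ Φ)
    (hΨ : ∀ᵐ t ∂circ, Ψ t * Φ t = 1) : ∀ᵐ t ∂circ,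
      (conj (ratio s d (fun i => (μ i : ℤ)) t) * ratio s d (fun i => (μ i : ℤ)) t) •
        (Ψ t * f t) = (Φ t)ᴴ := by
  filter_upwards [hfac.factorization, hΨ] with t h1 h2
  have h3 : ((‖chi s d (fun i => (μ i : ℤ)) (ex (-1) t)‖ ^ 2 / ‖beta s d t‖ ^ 2 : ℝ) : ℂ) =
      conj (ratio s d (fun i => (μ i : ℤ)) t) * ratio s d (fun i => (μ i : ℤ)) t := by
    rw [mul_comm, Complex.mul_conj, Complex.normSq_eq_norm_sq, ratio, norm_div, div_pow]
  rw [← h3, ← Matrix.mul_smul, ← h1, ← Matrix.mul_assoc, h2, Matrix.one_mul]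

lemma memLp_entry (hfac : IsCanonicalFactorization P s d μ ξ f ε φ Φ) (p : Fin T) (j : Fin q) :
    MemLp (fun t => Φ t p j) 2 circ := (hfac.series p j).1

lemma weighted_innov (hfac : IsCanonicalFactorization P s d μ ξ f ε φ Φ)
    (hΨ : ∀ᵐ t ∂circ, Ψ t * Φ t = 1) (hS : IsRoot f S) (hs : ∀ i, 0 < s i) (hμ : ∀ i, 0 < μ i)
    (k : ℤ) (j : Fin q) :
    weighted S (innov s d μ Ψ k j) =ᵐ[circ]
      formCoord S s d (fun i => (μ i : ℤ)) (fun t p => ex k t * conj (Φ t p j)) := by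
  filter_upwards [hfac.smul_mul_eq_conjTranspose hΨ, hS.gram, hS.isUnit_det,
    ae_ratio_ne_zero hs d (admissibleStep_natCast hμ).ne_zero] with t h1 h2 h3 h4
  set ρ := ratio s d (fun i => (μ i : ℤ)) t with hρ
  have h5 : IsUnit ((S t)ᴴ).det := by
    rw [Matrix.det_conjTranspose]; exact h3.star
  have h6 : (2 * Real.pi * conj ρ : ℂ) ≠ 0 :=
    mul_ne_zero two_pi_ne_zero_complex ((map_ne_zero _).2 h4)
  have h7 : (fun p => ex k t * conj (Φ t p j)) =
      (2 * Real.pi * conj ρ : ℂ) • ((S t)ᴴ *ᵥ (S t *ᵥ innov s d μ Ψ k j t)) := by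
    have h8 : (fun p => ex k t * conj (Φ t p j)) = ((Φ t)ᴴ)ᵀ *ᵥ Pi.single j (ex k t) := by
      ext p
      simp [mul_comm]
    rw [h8, ← h1, innov, Matrix.mulVec_mulVec, h2, Matrix.mulVec_smul, Matrix.transpose_smul,
      Matrix.transpose_mul, Matrix.smul_mulVec, Matrix.smul_mulVec, Matrix.mulVec_mulVec,
      smul_smul, smul_smul, ← hρ]
    congr 1
    have := two_pi_ne_zero_complex
    have hpi : (Real.pi : ℂ) ≠ 0 := by exact_mod_cast Real.pi_ne_zero
    field_simp
  simp only [formCoord, weighted]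
  rw [h7, Matrix.mulVec_smul, Matrix.mulVec_mulVec, Matrix.nonsing_inv_mul _ h5, Matrix.one_mulVec,
    smul_smul, one_div_mul_cancel h6, one_smul]

lemma memL2_innov (hfac : IsCanonicalFactorization P s d μ ξ f ε φ Φ)
    (hΨ : ∀ᵐ t ∂circ, Ψ t * Φ t = 1) (hS : IsRoot f S) (hs : ∀ i, 0 < s i) (hμ : ∀ i, 0 < μ i)
    (k : ℤ) (j : Fin q) : MemL2 f (innov s d μ Ψ k j) := by
  rw [hS.memL2_iff]
  have hmeas : AEStronglyMeasurable (weighted S (innov s d μ Ψ k j)) circ := by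
    refine AEStronglyMeasurable.congr ?_ (hfac.weighted_innov hΨ hS hs hμ k j).symm
    refine hS.aestronglyMeasurable_formCoord s d _ fun p => ?_
    exact (continuous_ex k).aestronglyMeasurable.mul
      (hfac.memLp_entry p j).aestronglyMeasurable.star
  refine MemLp.of_bound hmeas 1 ?_
  filter_upwards [hfac.smul_mul_eq_conjTranspose hΨ, hS.gram, hΨ] with t h1 h2 h3
  set ρ := ratio s d (fun i => (μ i : ℤ)) t with hρ
  set v : Fin q → ℂ := Pi.single j (ex k t) with hv
  have h4 : innov s d μ Ψ k j t ⬝ᵥ (f t *ᵥ star (innov s d μ Ψ k j t)) = 1 := by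
    have h5 : star (innov s d μ Ψ k j t) = conj ρ • ((Ψ t)ᴴ *ᵥ star v) := by
      have h7 : ((Ψ t)ᵀ)ᴴ = ((Ψ t)ᴴ)ᵀ := rfl
      rw [innov, star_smul, Matrix.star_mulVec, h7, Matrix.vecMul_transpose]
      rfl
    have h6 : (Φ t)ᴴ * (Ψ t)ᴴ = 1 := by
      rw [← Matrix.conjTranspose_mul, h3, Matrix.conjTranspose_one]
    rw [h5, innov, ← hρ, smul_dotProduct, Matrix.mulVec_smul, dotProduct_smul, smul_smul,
      mul_comm ρ, Matrix.mulVec_transpose, ← Matrix.dotProduct_mulVec, Matrix.mulVec_mulVec,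
      Matrix.mulVec_mulVec, ← dotProduct_smul, ← Matrix.smul_mulVec,
      ← Matrix.smul_mul, h1, h6, Matrix.one_mulVec, hv, ← Pi.single_star, single_dotProduct]
    simp only [Pi.single_eq_same, Complex.star_def]
    rw [Complex.mul_conj, Complex.normSq_eq_norm_sq, norm_ex]
    norm_num
  have h8 := norm_weighted_sq h2 (innov s d μ Ψ k j)
  rw [h4, Complex.one_re] at h8
  refine le_of_sq_le_sq ?_ zero_le_one
  nlinarith [Real.pi_gt_three, sq_nonneg ‖weighted S (innov s d μ Ψ k j) t‖]

/-- The inner products with the generators are the coefficients of the moving average. -/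
lemma inner_gen_innov (hfac : IsCanonicalFactorization P s d μ ξ f ε φ Φ)
    (hΨ : ∀ᵐ t ∂circ, Ψ t * Φ t = 1) (hS : IsRoot f S) (hs : ∀ i, 0 < s i) (hμ : ∀ i, 0 < μ i)
    (k m : ℤ) (j : Fin q) (p : Fin T) :
    inner ℂ (vec S (gen s d (fun i => (μ i : ℤ)) m p)) (vec S (innov s d μ Ψ k j)) =
      if k ≤ m then conj (φ (m - k).toNat p j) else 0 := by
  have h1 : ∫ t, ex (k - m) t * conj (Φ t p j) ∂circ =
      if k ≤ m then 2 * Real.pi * conj (φ (m - k).toNat p j) else 0 := by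
    have hser : IsL2Sum circ (fun l t => conj (φ l p j) * ex l t) (fun t => conj (Φ t p j)) := by
      refine ⟨(hfac.memLp_entry p j).star, ?_⟩
      refine (hfac.series p j).2.congr fun n => eLpNorm_congr_norm_ae
        (Eventually.of_forall fun t => ?_)
      rw [← RCLike.norm_conj]
      simp only [map_sub, map_sum, map_mul, conj_ex, neg_neg]
    have h2 := integral_ex_mul_of_isL2Sum hser (m - k)
    rw [neg_sub] at h2
    rw [h2]
    simp only [sub_nonneg]
  rw [hS.inner_vec_gen hs]
  have h2 : ∫ t, ex (-m) t * (conj (ratio s d (fun i => (μ i : ℤ)) t) *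
      ((S t)ᴴ *ᵥ (vec S (innov s d μ Ψ k j) t).ofLp) p) ∂circ =
      ∫ t, 1 / (2 * Real.pi) * (ex (k - m) t * conj (Φ t p j)) ∂circ := by
    refine integral_congr_ae ?_
    filter_upwards [hS.coeFn_vec (hfac.memL2_innov hΨ hS hs hμ k j),
      hfac.weighted_innov hΨ hS hs hμ k j, hS.isUnit_det,
      ae_ratio_ne_zero hs d (admissibleStep_natCast hμ).ne_zero] with t h3 h4 h5 h6
    have h7 : IsUnit ((S t)ᴴ).det := by
      rw [Matrix.det_conjTranspose]; exact h5.star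
    rw [h3, h4]
    simp only [formCoord]
    rw [Matrix.mulVec_smul, Matrix.mulVec_mulVec, Matrix.mul_nonsing_inv _ h7, Matrix.one_mulVec,
      Pi.smul_apply, smul_eq_mul, sub_eq_add_neg, ex_add]
    have h8 : conj (ratio s d (fun i => (μ i : ℤ)) t) ≠ 0 := (map_ne_zero _).2 h6
    have hpi : (Real.pi : ℂ) ≠ 0 := by exact_mod_cast Real.pi_ne_zero
    field_simp
  rw [h2, integral_const_mul, h1]
  split_ifs
  · rw [← mul_assoc, one_div_mul_cancel two_pi_ne_zero_complex, one_mul]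
  · rw [mul_zero]

lemma inner_innovation (hfac : IsCanonicalFactorization P s d μ ξ f ε φ Φ) (k k' : ℤ)
    (j j' : Fin q) :
    inner ℂ ((hfac.memLp k' j').toLp _) ((hfac.memLp k j).toLp _) =
      if k = k' ∧ j = j' then (1 : ℂ) else 0 := by
  rw [← hfac.orthonormal k k' j j', L2.inner_def]
  refine integral_congr_ae ?_
  filter_upwards [(hfac.memLp k' j').coeFn_toLp, (hfac.memLp k j).coeFn_toLp] with ω h1 h2
  rw [h1, h2, RCLike.inner_apply]

/-- The spectral isometry carries `ρ Ψᵀ e^{ikλ} δ_j` to the innovation `ε_j(k)`: the inner products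
of both with the increments are the coefficients of the moving average. -/
lemma map_innov (hfac : IsCanonicalFactorization P s d μ ξ f ε φ Φ)
    (hΨ : ∀ᵐ t ∂circ, Ψ t * Φ t = 1) (hS : IsRoot f S) (hs : ∀ i, 0 < s i) (hμ : ∀ i, 0 < μ i)
    {U : VecL2 T →ₗᵢ[ℂ] Lp ℂ 2 P} (hU : ∀ ν, AdmissibleStep ν → ∀ m p,
      U (vec S (gen s d ν m p)) =ᵐ[P] increment s d ν ξ m p) (k : ℤ) (j : Fin q) :
    vec S (innov s d μ Ψ k j) ∈ past S s d (fun i => (μ i : ℤ)) k ∧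
      U (vec S (innov s d μ Ψ k j)) = (hfac.memLp k j).toLp _ := by
  have hν := admissibleStep_natCast hμ
  set η : Lp ℂ 2 P := (hfac.memLp k j).toLp _ with hη
  have hmem : η ∈ pastSpace P ε k :=
    Submodule.le_topologicalClosure _ (Submodule.subset_span
      ⟨(⟨k, le_rfl⟩, j), (hfac.memLp k j).coeFn_toLp⟩)
  rw [← hfac.innovation, pastSpace_eq_map hμ hU] at hmem
  obtain ⟨x, hx, hUx⟩ := hmem
  have hUx' : U x = η := hUx
  suffices h : x = vec S (innov s d μ Ψ k j) by rw [← h]; exact ⟨hx, hUx'⟩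
  have hinner : ∀ (m : ℤ) (p : Fin T), inner ℂ (vec S (gen s d (fun i => (μ i : ℤ)) m p)) x =
      if k ≤ m then conj (φ (m - k).toNat p j) else 0 := by
    intro m p
    rw [← U.inner_map_map, hUx']
    have hu : ∀ l : ℕ, MemLp (fun ω => ∑ j, φ l p j * ε (m - l) j ω) 2 P := fun l =>
      memLp_finsetSum _ fun i _ => (hfac.memLp _ i).const_mul _
    have hMA := hfac.movingAverage m p
    have h1 := (isL2Sum_iff hu hMA.1).1 hMA
    have h2 : U (vec S (gen s d (fun i => (μ i : ℤ)) m p)) = hMA.1.toLp _ :=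
      Lp.ext ((hU _ hν m p).trans hMA.1.coeFn_toLp.symm)
    have h3 : ∀ l : ℕ, inner ℂ ((hu l).toLp _) η =
        if (k = m - l) then conj (φ l p j) else 0 := by
      intro l
      have h4 : (hu l).toLp _ = ∑ i, φ l p i • (hfac.memLp (m - l) i).toLp _ := by
        refine Lp.ext ((hu l).coeFn_toLp.trans ?_)
        filter_upwards [Lp.coeFn_fun_finsetSum Finset.univ
          (fun i => φ l p i • (hfac.memLp (m - l) i).toLp _),
          eventually_all.2 fun i => Lp.coeFn_smul (φ l p i) ((hfac.memLp (m - l) i).toLp _),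
          eventually_all.2 fun i => (hfac.memLp (m - l) i).coeFn_toLp] with ω h5 h6 h7
        rw [h5]
        refine Finset.sum_congr rfl fun i _ => ?_
        rw [h6, Pi.smul_apply, h7, smul_eq_mul]
      rw [h4]
      simp only [sum_inner, inner_smul_left, hη, hfac.inner_innovation]
      by_cases hk : k = m - l
      · simp [hk]
      · simp [hk]
    have h4 := Filter.Tendsto.inner (𝕜 := ℂ) h1 (tendsto_const_nhds (x := η))
    rw [h2]
    refine tendsto_nhds_unique h4 (tendsto_const_nhds.congr' ?_)
    filter_upwards [eventually_gt_atTop (m - k).toNat] with n hn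
    simp only [sum_inner, h3]
    split_ifs with hkm
    · rw [Finset.sum_eq_single (m - k).toNat]
      · rw [if_pos (by omega)]
      · intro l _ hl
        rw [if_neg (by omega)]
      · intro hl
        exact absurd (Finset.mem_range.2 hn) hl
    · symm
      exact Finset.sum_eq_zero fun l _ => if_neg (by omega)
  have hperp : x - vec S (innov s d μ Ψ k j) ∈ (Submodule.span ℂ (Set.range fun i : ℤ × Fin T =>
      vec S (gen s d (fun i => (μ i : ℤ)) i.1 i.2)))ᗮ := by
    have hle : Submodule.span ℂ (Set.range fun i : ℤ × Fin T =>
        vec S (gen s d (fun i => (μ i : ℤ)) i.1 i.2)) ≤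
        (Submodule.span ℂ {x - vec S (innov s d μ Ψ k j)})ᗮ := by
      refine Submodule.span_le.2 ?_
      rintro _ ⟨⟨m, p⟩, rfl⟩
      rw [SetLike.mem_coe, Submodule.mem_orthogonal_singleton_iff_inner_left, inner_sub_right,
        hinner, hfac.inner_gen_innov hΨ hS hs hμ, sub_self]
    exact (Submodule.mem_orthogonal _ _).2 fun u hu =>
      (Submodule.mem_orthogonal_singleton_iff_inner_left).1 (hle hu)
  rw [(Submodule.topologicalClosure_eq_top_iff).1 (hS.span_gen_dense hs d hν.ne_zero),
    Submodule.mem_bot, sub_eq_zero] at hperp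
  exact hperp

lemma solvesForecast_hOfPsi (hfac : IsCanonicalFactorization P s d μ ξ f ε φ Φ)
    (hΨ : ∀ᵐ t ∂circ, Ψ t * Φ t = 1) (hS : IsRoot f S) (hs : ∀ i, 0 < s i) (hμ : ∀ i, 0 < μ i)
    {U : VecL2 T →ₗᵢ[ℂ] Lp ℂ 2 P} (hU : ∀ ν, AdmissibleStep ν → ∀ m p,
      U (vec S (gen s d ν m p)) =ᵐ[P] increment s d ν ξ m p)
    {Z : ℝ → Fin T → Ω → ℂ} (hZ : IsSpectralProcess P s d ξ f Z) (a : ℕ → Fin T → ℂ) (N : ℕ) :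
    SolvesForecast P s d μ ξ f Z a N (hOfPsi s d μ a N φ Ψ)
      ((∑ k ∈ Finset.range (N + 1), ∑ j, ‖rCoeff s d μ a N φ k j‖ ^ 2 : ℝ) : ℂ) := by
  set ν : Fin r → ℤ := fun i => (μ i : ℤ) with hν
  set R := rCoeff s d μ a N φ with hR
  obtain ⟨hB, hBvec⟩ := hS.vec_trigPolynomial (d := d) (ν := ν) hs
    (Finset.range (N + 1)) (fun k : ℕ => (k : ℤ)) (bN s d μ a N)
  set x₀ := vec S (fun t => ratio s d ν t • BN s d μ a N t) with hx₀
  have hBvec' : x₀ = ∑ k ∈ Finset.range (N + 1), ∑ p, bN s d μ a N k p •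
      vec S (gen s d ν (k : ℤ) p) := hBvec
  have hx₀mem : x₀ ∈ past S s d ν N := hBvec' ▸ sum_bN_smul_mem_past a N
  have hmemI := hfac.memL2_innov hΨ hS hs hμ
  have hpastI := fun k j => (hfac.map_innov hΨ hS hs hμ hU k j).1
  have hUI := fun k j => (hfac.map_innov hΨ hS hs hμ hU k j).2
  have horthI : ∀ (k k' : ℤ) (j j' : Fin q), inner ℂ (vec S (innov s d μ Ψ k' j'))
      (vec S (innov s d μ Ψ k j)) = if k = k' ∧ j = j' then (1 : ℂ) else 0 := by
    intro k k' j j'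
    rw [← U.inner_map_map, hUI, hUI, hfac.inner_innovation]
  -- the error `ρ Ψᵀ r`
  have hefun : (fun t => ratio s d ν t • ((Ψ t)ᵀ *ᵥ rFun s d μ a N φ t)) =
      fun t => ∑ k ∈ Finset.range (N + 1), ∑ j, R k j • innov s d μ Ψ (k : ℤ) j t := by
    funext t
    have h1 : rFun s d μ a N φ t = ∑ k ∈ Finset.range (N + 1), ∑ j,
        R k j • (Pi.single j (ex k t) : Fin q → ℂ) := by
      refine Finset.sum_congr rfl fun k _ => ?_
      ext i
      simp only [Pi.smul_apply, smul_eq_mul, Finset.sum_apply, Pi.single_apply]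
      simp [mul_comm, hR]
    rw [h1, Matrix.mulVec_sum, Finset.smul_sum]
    refine Finset.sum_congr rfl fun k _ => ?_
    rw [Matrix.mulVec_sum, Finset.smul_sum]
    refine Finset.sum_congr rfl fun j _ => ?_
    rw [Matrix.mulVec_smul, innov, smul_comm]
  have h1 : ∀ k : ℕ, _ := fun k => hS.memL2_sum_and_vec_sum Finset.univ fun j =>
    hS.memL2_smul (hmemI (k : ℤ) j) (R k j)
  have h2 := hS.memL2_sum_and_vec_sum (Finset.range (N + 1)) fun k => (h1 k).1
  have hemem : MemL2 f (fun t => ratio s d ν t • ((Ψ t)ᵀ *ᵥ rFun s d μ a N φ t)) := by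
    rw [hefun]; exact h2.1
  set e := vec S (fun t => ratio s d ν t • ((Ψ t)ᵀ *ᵥ rFun s d μ a N φ t)) with he
  have hevec : e = ∑ k ∈ Finset.range (N + 1), ∑ j, R k j • vec S (innov s d μ Ψ (k : ℤ) j) := by
    rw [he, hefun]
    refine h2.2.trans (Finset.sum_congr rfl fun k _ => (h1 k).2.trans
      (Finset.sum_congr rfl fun j _ => ?_))
    rw [hS.vec_smul (hmemI (k : ℤ) j)]
  have hIe : ∀ (k : ℤ) (j : Fin q), k ≤ N → inner ℂ (vec S (innov s d μ Ψ k j)) e =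
      if 0 ≤ k then R k.toNat j else 0 := by
    intro k j hk
    rw [hevec]
    simp only [inner_sum, inner_smul_right, horthI]
    split_ifs with h0
    · rw [Finset.sum_eq_single k.toNat, Finset.sum_eq_single j]
      · simp [Int.toNat_of_nonneg h0]
      · intro j' _ hj'
        simp [hj']
      · simp
      · intro k' _ hk'
        refine Finset.sum_eq_zero fun j' _ => ?_
        rw [if_neg (by omega), mul_zero]
      · intro h
        exact absurd (Finset.mem_range.2 (by omega)) h
    · refine Finset.sum_eq_zero fun k' _ => Finset.sum_eq_zero fun j' _ => ?_
      rw [if_neg (by omega), mul_zero]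
  have hIx₀ : ∀ (k : ℕ) (j : Fin q), k ≤ N →
      inner ℂ (vec S (innov s d μ Ψ (k : ℤ) j)) x₀ = R k j := by
    intro k j hk
    rw [hBvec', hR, sum_transpose_mulVec_bN]
    simp only [inner_sum, inner_smul_right, Finset.sum_apply]
    have h3 : ∀ (m : ℕ) (p : Fin T), inner ℂ (vec S (innov s d μ Ψ (k : ℤ) j))
        (vec S (gen s d ν (m : ℤ) p)) = if k ≤ m then φ (m - k) p j else 0 := by
      intro m p
      rw [← inner_conj_symm, hfac.inner_gen_innov hΨ hS hs hμ]
      by_cases hkm : k ≤ m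
      · rw [if_pos (by exact_mod_cast hkm), if_pos hkm, Complex.conj_conj,
          show ((m : ℤ) - (k : ℤ)).toNat = m - k by omega]
      · rw [if_neg (by exact_mod_cast hkm), if_neg hkm, map_zero]
    simp only [h3]
    rw [← Finset.sum_filter_of_ne (s := Finset.range (N + 1)) (p := fun m => k ≤ m),
      ← Finset.sum_filter_of_ne (s := Finset.range (N + 1)) (p := fun m => k + m ≤ N)]
    · refine Finset.sum_bij' (fun m _ => m - k) (fun m _ => k + m) ?_ ?_ ?_ ?_ ?_
      · intro m hm
        simp at hm ⊢; omega
      · intro m hm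
        simp at hm ⊢; omega
      · intro m hm
        simp at hm ⊢; omega
      · intro m hm
        simp
      · intro m hm
        simp only [Finset.mem_filter, Finset.mem_range] at hm
        rw [Nat.add_sub_cancel' hm.2, Matrix.mulVec, dotProduct]
        refine Finset.sum_congr rfl fun p _ => ?_
        rw [if_pos hm.2, Matrix.transpose_apply, mul_comm]
    · intro m _ h
      by_contra hlt
      exact h (by rw [bN_eq_zero s d μ a (by omega), Matrix.mulVec_zero, Pi.zero_apply])
    · intro m _ h
      by_contra hlt
      exact h (Finset.sum_eq_zero fun p _ => by rw [if_neg hlt, mul_zero])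
  have hgene : ∀ k ≤ (-1 : ℤ), ∀ p, inner ℂ (vec S (gen s d ν k p)) e = 0 := by
    intro k hk p
    rw [hevec]
    simp only [inner_sum, inner_smul_right]
    refine Finset.sum_eq_zero fun k' _ => Finset.sum_eq_zero fun j' _ => ?_
    rw [hfac.inner_gen_innov hΨ hS hs hμ, if_neg (by omega), mul_zero]
  have horth := inner_past_eq_zero hgene
  -- the projection error `x₀ - y` and `e` have the same inner products with the innovations up to
  -- time `N`, which span the past at time `N`
  obtain ⟨y, hy, hyo⟩ := exists_projection_past (S := S) (s := s) (d := d) (ν := ν) (-1) x₀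
  have hey : x₀ - y - e = 0 := by
    set w := x₀ - y - e with hw
    have hwmem : w ∈ past S s d ν N := by
      refine Submodule.sub_mem _ (Submodule.sub_mem _ hx₀mem (past_mono (by omega) hy)) ?_
      rw [hevec]
      refine Submodule.sum_mem _ fun k hk => Submodule.sum_mem _ fun j _ =>
        Submodule.smul_mem _ _ (past_mono ?_ (hpastI k j))
      have := Finset.mem_range.1 hk
      omega
    have hwI : ∀ (k : ℤ) (j : Fin q), k ≤ N → inner ℂ (vec S (innov s d μ Ψ k j)) w = 0 := by
      intro k j hk
      rw [hw, inner_sub_right, hIe k j hk]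
      by_cases h0 : 0 ≤ k
      · have h3 : inner ℂ (vec S (innov s d μ Ψ k j)) y = 0 := by
          rw [inner_eq_zero_symm]
          refine inner_past_eq_zero (fun m hm p => ?_) y hy
          rw [hfac.inner_gen_innov hΨ hS hs hμ, if_neg (by omega)]
        have h4 := hIx₀ k.toNat j (by omega)
        rw [Int.toNat_of_nonneg h0] at h4
        rw [inner_sub_right, h3, h4, if_pos h0, sub_zero, sub_self]
      · rw [if_neg h0, sub_zero]
        exact hyo _ (past_mono (by omega) (hpastI k j))
    have hUw : U w ∈ pastSpace P ε N := by
      rw [← hfac.innovation, pastSpace_eq_map hμ hU]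
      exact ⟨w, hwmem, rfl⟩
    have hle : pastSpace P ε N ≤ (Submodule.span ℂ {U w})ᗮ := by
      refine Submodule.topologicalClosure_minimal _ (Submodule.span_le.2 ?_)
        (Submodule.isClosed_orthogonal _)
      rintro g ⟨⟨⟨k, hk⟩, j⟩, hg⟩
      have h3 : g = U (vec S (innov s d μ Ψ k j)) := by
        rw [hUI]
        exact Lp.ext (hg.trans (hfac.memLp k j).coeFn_toLp.symm)
      rw [SetLike.mem_coe, Submodule.mem_orthogonal_singleton_iff_inner_left, h3,
        U.inner_map_map, hwI k j hk]
    have h4 := (Submodule.mem_orthogonal_singleton_iff_inner_left).1 (hle hUw)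
    rw [U.inner_map_map] at h4
    exact inner_self_eq_zero.1 h4
  have hh : hOfPsi s d μ a N φ Ψ = fun t => ratio s d ν t • BN s d μ a N t -
      ratio s d ν t • ((Ψ t)ᵀ *ᵥ rFun s d μ a N φ t) := by
    funext t
    rw [hOfPsi, smul_sub]
  have hvec : vec S (hOfPsi s d μ a N φ Ψ) = x₀ - e := by
    rw [hh]
    exact hS.vec_sub hB hemem
  have hhmem : MemL2 f (hOfPsi s d μ a N φ Ψ) := by
    rw [hh]
    exact hS.memL2_sub hB hemem
  refine solvesForecast hS hs hμ hU hZ a N hhmem hvec ?_ horth ?_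
  · have h5 : x₀ - e = y := by
      rw [sub_sub, add_comm, ← sub_sub, sub_eq_zero] at hey
      exact hey
    rw [hvec, h5]
    exact hy
  · have h6 : inner ℂ e e = ∑ k ∈ Finset.range (N + 1), ∑ j, ((‖R k j‖ ^ 2 : ℝ) : ℂ) := by
      conv_lhs => rw [hevec]
      simp only [sum_inner, inner_smul_left]
      rw [← hevec]
      refine Finset.sum_congr rfl fun k hk => Finset.sum_congr rfl fun j _ => ?_
      have := Finset.mem_range.1 hk
      rw [hIe k j (by omega), if_pos (Int.natCast_nonneg k), Int.toNat_natCast, mul_comm,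
        Complex.mul_conj, Complex.normSq_eq_norm_sq]
    rw [inner_self_eq_norm_sq_to_K] at h6
    push_cast at h6 ⊢
    exact h6.symm

end IsCanonicalFactorization

end

end GMForecast

end

theorem mainTheorem2 {Ω : Type*} [MeasurableSpace Ω] (P : Measure Ω) [IsProbabilityMeasure P]
    {r T : ℕ} (s d μ : Fin r → ℕ)
    (hs : ∀ i, 0 < s i) (hd : ∀ i, 0 < d i) (hμ : ∀ i, 0 < μ i)
    (ξ : ℤ → Fin T → Ω → ℂ) (hξ : HasStationaryIncrements P s d ξ)
    (hmean : ∀ m p, ∫ ω, increment s d (fun i => (μ i : ℤ)) ξ m p ω ∂P = 0)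
    (f : ℝ → Matrix (Fin T) (Fin T) ℂ) (hf : IsSpectralDensity P s d ξ f)
    (hmin : MinimalityCondition s d (fun i => (μ i : ℤ)) f)
    (N : ℕ) (a : ℕ → Fin T → ℂ) :
    (∃ Z, IsSpectralProcess P s d ξ f Z) ∧
    ∀ Z, IsSpectralProcess P s d ξ f Z →
      (∃ c : ℕ → Fin T → ℂ,
        OperatorF s d μ f c (bN s d μ a N) ∧
        (∀ c', OperatorF s d μ f c' (bN s d μ a N) → c' = c) ∧
        ∃ C : ℝ → Fin T → ℂ, IsFourierSum c C ∧
          SolvesForecast P s d μ ξ f Z a N (hOfC s d μ f a N C)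
            (∑ k ∈ Finset.range (N + 1), bN s d μ a N k ⬝ᵥ star (c k)) ∧
          ∑ k ∈ Finset.range (N + 1), bN s d μ a N k ⬝ᵥ star (c k) =
            1 / (2 * Real.pi) * ∫ t, conj (beta s d t) / chi s d (fun i => (μ i : ℤ)) (ex 1 t) *
              ((C t ᵥ* (f t)⁻¹) ⬝ᵥ star (C t)) *
              (beta s d t / chi s d (fun i => (μ i : ℤ)) (ex (-1) t)) ∂circ) ∧
      (∀ (q : ℕ) (ε : ℤ → Fin q → Ω → ℂ) (φ : ℕ → Matrix (Fin T) (Fin q) ℂ)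
        (Φ : ℝ → Matrix (Fin T) (Fin q) ℂ) (Ψ : ℝ → Matrix (Fin q) (Fin T) ℂ),
        IsCanonicalFactorization P s d μ ξ f ε φ Φ →
        (∀ᵐ t ∂circ, Ψ t * Φ t = 1) →
        SolvesForecast P s d μ ξ f Z a N (hOfPsi s d μ a N φ Ψ)
          ((∑ k ∈ Finset.range (N + 1), ∑ j, ‖rCoeff s d μ a N φ k j‖ ^ 2 : ℝ) : ℂ) ∧
        ∑ k ∈ Finset.range (N + 1), ∑ j, ‖rCoeff s d μ a N φ k j‖ ^ 2 =
          1 / (2 * Real.pi) * ∫ t, ∑ j, ‖rFun s d μ a N φ t j‖ ^ 2 ∂circ) := by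
  obtain ⟨S, hS⟩ := exists_isRoot hf.integrable hf.posSemidef hmin.1
  obtain ⟨U, hU⟩ := hS.exists_spectralIsometry hs d hξ hf
  refine ⟨hS.exists_isSpectralProcess hs hU, fun Z hZ =>
    ⟨solvesForecast_operatorF hS hs hμ hU hZ a N, fun q ε φ Φ Ψ hfac hΨ =>
      ⟨hfac.solvesForecast_hOfPsi hΨ hS hs hμ hU hZ a N, sum_norm_rFun_sq a N φ⟩⟩⟩
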